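/- **Setting.** Let $q$ range over finitely many quantum variables with finite-dimensional state spaces $\mathcal H_q$ (orthonormal basis $\{|n\rangle\}$ containing $|0\rangle$), and let $\mathcal H=\bigotimes_q\mathcal H_q$. Programs with parameters $\boldsymbol\theta\in\mathbb R^k$ are generated by $$P::=\mathbf{skip}\mid q:=|0\rangle\mid \bar q:=\sigma\mid \bar q:=U[\bar q]\mid \bar q:=e^{-i\theta_l\sigma}[\bar q]\mid P_1;P_2\mid \mathbf{if}\,(\Box m\cdot M[\bar q]=m\to P_m)\,\mathbf{fi}\mid \mathbf{while}\ M[\bar q]=1\ \mathbf{do}\ Q\ \mathbf{od},$$ where $\bar q$ is a register of distinct variables, $U$ is unitary, $\sigma$ is a density operator, $\theta_l$ is one of the parameters, and $M=\{M_m\}$ is a measurement with finitely many outcomes ($\{M_0,M_1\}$ for a loop), $\sum_mM_m^\dagger M_m=I$. With $\mathcal E_m(\rho)=M_m\rho M_m^\dagger$, the semantics $[\![P]\!]$ is the usual one; $[\![\bar q:=\sigma]\!](\rho)=\mathrm{tr}_{\bar q}(\rho)\otimes\sigma$, and $[\![\mathbf{while}\ M[\bar q]=1\ \mathbf{do}\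 Q\ \mathbf{od}]\!](\rho)=\sum_{n\ge0}\mathcal E_0\circ([\![Q]\!]\circ\mathcal E_1)^n(\rho)$. A program $P$ terminates almost surely at $\boldsymbol\theta$ if $\mathrm{tr}[\![P]\!](\rho)=\mathrm{tr}\,\rho$ for all partial density operators $\rho$ (positive semidefinite, trace at most $1$) on $\mathcal H$. Fix one parameter $\theta$ among $\theta_1,\dots,\theta_k$. The running count $RC(P)$ is $1$ for $\bar q:=e^{-i\theta\sigma}[\bar q]$, $0$ for the other basic statements, $RC(P_1)+RC(P_2)$ for $P_1;P_2$, $\max_mRC(P_m)$ for a conditional and $RC(Q)$ for a loop with body $Q$. The loop count $LC(P)$ is $0$ for basic statements, $LC(P_1)+LC(P_2)$ for $P_1;P_2$, $\sum_mLC(P_m)$ for a conditional and $LC(Q)+1$ for a loop with body $Q$. Let $\mu$ be a probability distribution on $\{1,2,\dots\}$ with $\mu(n)>0$ for all $n$. Add fresh variables: qubits $q_1,q_2$, a counter $q_c$ with basis $\{|n\rangle:n\in\mathbb Z\}$, and a copy $q'$ of every variable $q$. Put $C=\sum_{j\ge0}|j+1\rangle\langle j|$, $b_j=\mu(j)/(1-\sum_{l=1}^{j-1}\mu(l))$,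 $GP=\sum_{j\ge1}|j\rangle\langle j|\otimes R_y(2\arcsin\sqrt{b_j})$ and $AS=|0\rangle\langle0|\otimes e^{-i\frac\pi4S}+|1\rangle\langle1|\otimes e^{i\frac\pi4S}$, with $S$ the swap of $\bar q$ and its copy $\bar q'$. The differential program is $$\partial P\equiv q_1:=|0\rangle;\ q_2:=|0\rangle;\ q_c:=|0\rangle;\ q_c:=C[q_c];\ q_c,q_2:=GP[q_c,q_2];\ T_\theta(P),$$ where $T_\theta$ commutes with all constructors and, on basic statements, changes only $\bar q:=e^{-i\theta\sigma}[\bar q]$: before this statement it inserts a measurement of $q_1,q_2$ with operators $|00\rangle\langle00|$, $|01\rangle\langle01|$, $|10\rangle\langle10|+|11\rangle\langle11|$, followed in the three cases by (0) $q_c:=C[q_c];\ q_c,q_2:=GP[q_c,q_2]$, (1) $q_1:=X[q_1];\ q_2:=I/2;\ \bar q':=\sigma;\ q_2,\bar q,\bar q':=AS[q_2,\bar q,\bar q']$, (2) $\mathbf{skip}$. Let $O_d=\sum_{j\ge1}\frac2{\mu(j)}|j\rangle\langle j|\otimes|1\rangle\langle1|\otimes Z$ on $q_c,q_1,q_2$.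 For an observable (Hermitian operator) $O$ on $\mathcal H$ and an input $\rho$, a partial density operator on the extended space, put $\langle O_d^2\otimes O^2\rangle=\mathrm{tr}\big((O_d^2\otimes O^2)[\![\partial P]\!](\rho)\big)$. For $\varepsilon\in(0,1)$ and an integer $N\ge1$ say that *the loops of $P$ decay with $(\varepsilon,N)$ at $\boldsymbol\theta$* if for every while-subprogram $\mathbf{while}\ M[\bar q]=1\ \mathbf{do}\ Q\ \mathbf{od}$ of $P$, every $n\ge0$ and every partial density operator $\rho$ on $\mathcal H$, $\mathrm{tr}\big(\mathcal E_0\circ([\![Q]\!]\circ\mathcal E_1)^n(\rho)\big)\le\varepsilon^{\lfloor n/N\rfloor}\,\mathrm{tr}\,\rho$. **Theorem.** 1. If all while-subprograms of $P$ terminate almost surely at $\boldsymbol\theta$ and $\lim_{n\to\infty}\mu(n)^{1/n}=1$, then for every observable $O$ there is $B$ such that, for every input $\rho$, the trace defining $\langle O_d^2\otimes O^2\rangle$ converges and $\langle O_d^2\otimes O^2\rangle\le B$. 2. If all while-subprograms of $P$ terminate almost surely at $\boldsymbol\theta$, then for every $\varepsilon\in(0,1)$ there is $N\ge1$ such that the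 loops of $P$ decay with $(\varepsilon,N)$ at $\boldsymbol\theta$. 3. For every $s\in(0,1]$ there is $K>0$, and for all $\varepsilon\in(0,1)$ and $N\ge1$ there is a function $C:\mathbb N\to(0,\infty)$ (depending only on $s,\varepsilon,N$) such that the following holds for all systems of variables, all $P$, $\boldsymbol\theta$, $\theta$, $O$ and $\rho$ as above. If all while-subprograms of $P$ terminate almost surely at $\boldsymbol\theta$, the loops of $P$ decay with $(\varepsilon,N)$ at $\boldsymbol\theta$, and $\mu(n)\propto\frac1{n\ln^{1+s}(n+e)}$, then, with $M_1=RC(P)$ and $M_2=LC(P)$, the trace converges and $$\langle O_d^2\otimes O^2\rangle\le K\,\|O\|^2\Big(M_1^2\ln^{1+s}(M_1+e)+M_1^{3+s}M_2^{2+s}\,C(M_2)\Big).$$ -/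

import Mathlib

open scoped Matrix

noncomputable section

namespace QWhile

/-! ### Operators written in a (possibly infinite) orthonormal basis

An operator on `ℓ²(I)` is represented by its matrix in the basis `|i⟩`, `i : I`. Sums over `I` are
unconditional sums; for finite `I` they are the usual finite sums. -/

/-- Product of two operators. -/
def imul {I : Type} (A B : Matrix I I ℂ) : Matrix I I ℂ :=
  fun x y => ∑' z, A x z * B z y

open Classical in
/-- Identity operator. -/
def iid (I : Type) : Matrix I I ℂ := fun x y => if x = y then 1 else 0

/-- Powers of an operator. -/
def ipow {I : Type} (A : Matrix I I ℂ) : ℕ → Matrix I I ℂ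
  | 0 => iid I
  | n + 1 => imul (ipow A n) A

/-- Exponential of an operator. -/
def iexp {I : Type} (A : Matrix I I ℂ) : Matrix I I ℂ :=
  fun x y => ∑' n : ℕ, ((n.factorial : ℂ)⁻¹) * ipow A n x y

/-- Trace of an operator. -/
def itrace {I : Type} (A : Matrix I I ℂ) : ℂ := ∑' x, A x x

/-- The map `ρ ↦ A ρ A†`. -/
def conj {I : Type} (A ρ : Matrix I I ℂ) : Matrix I I ℂ := imul (imul A ρ) Aᴴ

theorem imul_eq_mul {I : Type} [Fintype I] (A B : Matrix I I ℂ) : imul A B = A * B := by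
  ext x y
  simp [imul, Matrix.mul_apply, tsum_fintype]

theorem iid_eq_one (I : Type) [DecidableEq I] : iid I = 1 := by
  ext x y
  simp [iid, Matrix.one_apply]

theorem ipow_eq_pow {I : Type} [Fintype I] [DecidableEq I] (A : Matrix I I ℂ) (n : ℕ) :
    ipow A n = A ^ n := by
  induction n with
  | zero => simp [ipow, iid_eq_one]
  | succ n ih => simp [ipow, imul_eq_mul, ih, pow_succ]

theorem iexp_eq_exp {I : Type} [Fintype I] [DecidableEq I] (A : Matrix I I ℂ) :
    iexp A = NormedSpace.exp A := by
  let _ : NormedRing (Matrix I I ℂ) := Matrix.linftyOpNormedRing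
  let _ : NormedAlgebra ℂ (Matrix I I ℂ) := Matrix.linftyOpNormedAlgebra
  have h : Summable fun n : ℕ => ((n.factorial : ℂ)⁻¹) • A ^ n :=
    NormedSpace.expSeries_summable' (𝕂 := ℂ) A
  have he : NormedSpace.exp A = ∑' n : ℕ, ((n.factorial : ℂ)⁻¹) • A ^ n :=
    congrFun (NormedSpace.exp_eq_tsum ℂ) A
  refine Eq.trans ?_ he.symm
  ext x y
  have h1 : HasSum (fun n : ℕ => (((n.factorial : ℂ)⁻¹) • A ^ n) x y)
      ((∑' n : ℕ, ((n.factorial : ℂ)⁻¹) • A ^ n) x y) :=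
    (Pi.hasSum.1 ((Pi.hasSum.1 h.hasSum) x)) y
  rw [← h1.tsum_eq]
  simp [iexp, ipow_eq_pow]

open scoped ComplexOrder in
/-- Partial density operators: positive semidefinite, of trace at most one. -/
def IsPartialDensity {I : Type} (ρ : Matrix I I ℂ) : Prop :=
  ρ.PosSemidef ∧ Summable (fun x => ρ x x) ∧ (itrace ρ).re ≤ 1

open scoped ComplexOrder in
/-- Density operators: positive semidefinite, of trace one. -/
def IsDensity {I : Type} (ρ : Matrix I I ℂ) : Prop :=
  ρ.PosSemidef ∧ HasSum (fun x => ρ x x) 1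

/-- Unitary operators. -/
def IsUnitary {I : Type} (U : Matrix I I ℂ) : Prop :=
  imul Uᴴ U = iid I ∧ imul U Uᴴ = iid I

/-! ### Quantum variables, registers -/

/-- A system of quantum variables. The state space `H_q` of the variable `q` has the orthonormal
basis `|n⟩`, `n : Basis q`, and `zero q` is the label of the vector `|0⟩`. -/
structure QSystem where
  Var : Type
  Basis : Var → Type
  zero : ∀ q, Basis q

/-- The joint state space (the tensor product of the state spaces of the variables) has the
product basis. -/
abbrev Cfg (S : QSystem) : Type := ∀ q, S.Basis q

/-- Basis of the state space of a register, a family `q̄ = (q_i)` of distinct variables. -/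
abbrev RCfg {S : QSystem} {ι : Type} (q : ι → S.Var) : Type := ∀ i, S.Basis (q i)

/-- The basis label of the register inside that of the joint system. -/
def readReg {S : QSystem} {ι : Type} (q : ι → S.Var) (x : Cfg S) : RCfg q := fun i => x (q i)

open Classical in
/-- Overwrite the labels of the variables of the register by `w`. -/
def setReg {S : QSystem} {ι : Type} (q : ι → S.Var) (x : Cfg S) (w : RCfg q) : Cfg S :=
  fun v => if h : ∃ i, q i = v then h.choose_spec ▸ w h.choose else x v

theorem setReg_apply {S : QSystem} {ι : Type} (q : ι → S.Var) (hq : Function.Injective q)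
    (x : Cfg S) (w : RCfg q) (i : ι) : setReg q x w (q i) = w i := by
  have key : ∀ (j : ι) (h : q j = q i), (h ▸ w j : S.Basis (q i)) = w i := by
    intro j h
    obtain rfl := hq h
    rfl
  have h : ∃ j, q j = q i := ⟨i, rfl⟩
  simp only [setReg, h, dif_pos]
  exact key _ _

theorem setReg_of_notMem {S : QSystem} {ι : Type} (q : ι → S.Var) (x : Cfg S) (w : RCfg q)
    (v : S.Var) (hv : ∀ i, q i ≠ v) : setReg q x w v = x v := by
  have h : ¬ ∃ j, q j = v := by
    rintro ⟨j, hj⟩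
    exact hv j hj
  simp [setReg, h]

open Classical in
/-- The operator `A` of the register, tensored with the identity on all other variables. -/
def lift {S : QSystem} {ι : Type} (q : ι → S.Var) (A : Matrix (RCfg q) (RCfg q) ℂ) :
    Matrix (Cfg S) (Cfg S) ℂ :=
  fun x y => if ∀ v, (∀ i, q i ≠ v) → x v = y v then A (readReg q x) (readReg q y) else 0

open Classical in
/-- `ρ ↦ ∑ₙ |0⟩_q⟨n| ρ |n⟩_q⟨0|`. -/
def resetVar {S : QSystem} (q : S.Var) (ρ : Matrix (Cfg S) (Cfg S) ℂ) :
    Matrix (Cfg S) (Cfg S) ℂ :=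
  fun x y => if x q = S.zero q ∧ y q = S.zero q then
    ∑' n : S.Basis q, ρ (Function.update x q n) (Function.update y q n) else 0

/-- `ρ ↦ tr_q̄(ρ) ⊗ σ`, with `σ` a state of the register `q̄`. -/
def resetReg {S : QSystem} {ι : Type} (q : ι → S.Var) (σ : Matrix (RCfg q) (RCfg q) ℂ)
    (ρ : Matrix (Cfg S) (Cfg S) ℂ) : Matrix (Cfg S) (Cfg S) ℂ :=
  fun x y => σ (readReg q x) (readReg q y) * ∑' w : RCfg q, ρ (setReg q x w) (setReg q y w)

/-! ### Parameterized quantum while-programs -/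

/-- Syntax of programs with `k` real parameters. The requirements on the operators (unitary,
density operator, measurement, distinct variables in a register) are in `WellFormed`. -/
inductive Prog (S : QSystem) (k : ℕ) : Type 1
  /-- `skip` -/
  | skip : Prog S k
  /-- `q := |0⟩` -/
  | init (q : S.Var) : Prog S k
  /-- `q̄ := σ` -/
  | initState (ι : Type) (q : ι → S.Var) (σ : Matrix (RCfg q) (RCfg q) ℂ) : Prog S k
  /-- `q̄ := U[q̄]` -/
  | unitary (ι : Type) (q : ι → S.Var) (U : Matrix (RCfg q) (RCfg q) ℂ) : Prog S k
  /-- `q̄ := e^{-iθσ}[q̄]`, where `θ` is the `j`-th parameter -/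
  | rot (j : Fin k) (ι : Type) (q : ι → S.Var) (σ : Matrix (RCfg q) (RCfg q) ℂ) : Prog S k
  /-- `P₁; P₂` -/
  | seq (P₁ P₂ : Prog S k) : Prog S k
  /-- `if (□ m · M[q̄] = m → P_m) fi` -/
  | ite (ι : Type) (q : ι → S.Var) (m : ℕ) (M : Fin m → Matrix (RCfg q) (RCfg q) ℂ)
      (P : Fin m → Prog S k) : Prog S k
  /-- `while M[q̄] = 1 do Q od`, with `M = {M₀, M₁}` -/
  | while (ι : Type) (q : ι → S.Var) (M₀ M₁ : Matrix (RCfg q) (RCfg q) ℂ)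
      (Q : Prog S k) : Prog S k

namespace Prog

variable {S : QSystem} {k : ℕ}

/-- The side conditions of the syntax. -/
def WellFormed : Prog S k → Prop
  | skip => True
  | init _ => True
  | initState _ q σ => Function.Injective q ∧ IsDensity σ
  | unitary _ q U => Function.Injective q ∧ IsUnitary U
  | rot _ _ q σ => Function.Injective q ∧ IsDensity σ
  | seq P₁ P₂ => P₁.WellFormed ∧ P₂.WellFormed
  | ite _ q _ M P => Function.Injective q ∧ (∑ m, imul (M m)ᴴ (M m)) = iid (RCfg q) ∧
      ∀ m, (P m).WellFormed
  | .while _ q M₀ M₁ Q => Function.Injective q ∧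
      imul M₀ᴴ M₀ + imul M₁ᴴ M₁ = iid (RCfg q) ∧ Q.WellFormed

/-- Denotational semantics at the parameter `θ`. The semantics of a loop is the least upper bound
of the increasing sequence `∑_{n ≤ N} E₀ ∘ (⟦Q⟧ ∘ E₁)ⁿ(ρ)` of partial density operators, that is,
the sum of the series. -/
def sem (θ : Fin k → ℝ) : Prog S k → Matrix (Cfg S) (Cfg S) ℂ → Matrix (Cfg S) (Cfg S) ℂ
  | skip => fun ρ => ρ
  | init q => resetVar q
  | initState _ q σ => resetReg q σ
  | unitary _ q U => conj (lift q U)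
  | rot j _ q σ => conj (lift q (iexp ((-(Complex.I * (θ j : ℂ))) • σ)))
  | seq P₁ P₂ => fun ρ => P₂.sem θ (P₁.sem θ ρ)
  | ite _ q _ M P => fun ρ => ∑ m, (P m).sem θ (conj (lift q (M m)) ρ)
  | .while _ q M₀ M₁ Q => fun ρ x y =>
      ∑' n : ℕ, conj (lift q M₀) ((fun τ => Q.sem θ (conj (lift q M₁) τ))^[n] ρ) x y

/-- Running count of the `j`-th parameter. -/
def RC (j : Fin k) : Prog S k → ℕ
  | skip => 0
  | init _ => 0
  | initState _ _ _ => 0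
  | unitary _ _ _ => 0
  | rot j' _ _ _ => if j' = j then 1 else 0
  | seq P₁ P₂ => P₁.RC j + P₂.RC j
  | ite _ _ _ _ P => Finset.univ.sup fun m => (P m).RC j
  | .while _ _ _ _ Q => Q.RC j

/-- Loop count. -/
def LC : Prog S k → ℕ
  | skip => 0
  | init _ => 0
  | initState _ _ _ => 0
  | unitary _ _ _ => 0
  | rot _ _ _ _ => 0
  | seq P₁ P₂ => P₁.LC + P₂.LC
  | ite _ _ _ _ P => ∑ m, (P m).LC
  | .while _ _ _ _ Q => Q.LC + 1

/-- `P` terminates almost surely at `θ`. -/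
def TerminatesAS (θ : Fin k → ℝ) (P : Prog S k) : Prop :=
  ∀ ρ : Matrix (Cfg S) (Cfg S) ℂ, IsPartialDensity ρ → itrace (P.sem θ ρ) = itrace ρ

/-- All while-subprograms terminate almost surely at `θ`. -/
def LoopsTerminateAS (θ : Fin k → ℝ) : Prog S k → Prop
  | skip => True
  | init _ => True
  | initState _ _ _ => True
  | unitary _ _ _ => True
  | rot _ _ _ _ => True
  | seq P₁ P₂ => P₁.LoopsTerminateAS θ ∧ P₂.LoopsTerminateAS θ
  | ite _ _ _ _ P => ∀ m, (P m).LoopsTerminateAS θ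
  | .while ι q M₀ M₁ Q =>
      (Prog.while ι q M₀ M₁ Q).TerminatesAS θ ∧ Q.LoopsTerminateAS θ

/-- For every while-subprogram, the probability of leaving the loop after exactly `n` iterations
is at most `ε ^ ⌊n / N⌋`: `tr (E₀ ∘ (⟦Q⟧ ∘ E₁)ⁿ(ρ)) ≤ ε ^ ⌊n / N⌋ tr ρ`. -/
def LoopsDecay (θ : Fin k → ℝ) (ε : ℝ) (N : ℕ) : Prog S k → Prop
  | skip => True
  | init _ => True
  | initState _ _ _ => True
  | unitary _ _ _ => True
  | rot _ _ _ _ => True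
  | seq P₁ P₂ => P₁.LoopsDecay θ ε N ∧ P₂.LoopsDecay θ ε N
  | ite _ _ _ _ P => ∀ m, (P m).LoopsDecay θ ε N
  | .while _ q M₀ M₁ Q =>
      (∀ (n : ℕ) (ρ : Matrix (Cfg S) (Cfg S) ℂ), IsPartialDensity ρ →
        (itrace (conj (lift q M₀) ((fun τ => Q.sem θ (conj (lift q M₁) τ))^[n] ρ))).re
          ≤ ε ^ (n / N) * (itrace ρ).re) ∧ Q.LoopsDecay θ ε N

end Prog

/-! ### The differential program -/

/-- The variables of the differential program: those of the program, a copy `q'` of each of them,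
two qubits `q₁`, `q₂` and the counter `q_c`. -/
inductive DVar (V : Type) : Type
  | orig (q : V) : DVar V
  | copy (q : V) : DVar V
  | q₁ : DVar V
  | q₂ : DVar V
  | qc : DVar V

/-- The extended system; `H_{q_c}` has the basis `|n⟩`, `n ∈ ℤ`. -/
def ext (S : QSystem) : QSystem where
  Var := DVar S.Var
  Basis
    | .orig q => S.Basis q
    | .copy q => S.Basis q
    | .q₁ => Fin 2
    | .q₂ => Fin 2
    | .qc => ℤ
  zero
    | .orig q => S.zero q
    | .copy q => S.zero q
    | .q₁ => (0 : Fin 2)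
    | .q₂ => (0 : Fin 2)
    | .qc => (0 : ℤ)

section Differential

variable (S : QSystem)

/-- The register consisting of one variable. -/
def reg1 (a : DVar S.Var) : Unit → (ext S).Var := fun _ => a

/-- The register `a, b`. -/
def reg2 (a b : DVar S.Var) : Unit ⊕ Unit → (ext S).Var := Sum.elim (fun _ => a) (fun _ => b)

/-- The register `q_c, q₁, q₂`. -/
def reg3 : Unit ⊕ Unit ⊕ Unit → (ext S).Var :=
  Sum.elim (fun _ => DVar.qc) (Sum.elim (fun _ => DVar.q₁) (fun _ => DVar.q₂))

/-- A register of the program, inside the extended system. -/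
def regOrig {ι : Type} (q : ι → S.Var) : ι → (ext S).Var := fun i => DVar.orig (q i)

/-- The copy `q̄'` of a register of the program. -/
def regCopy {ι : Type} (q : ι → S.Var) : ι → (ext S).Var := fun i => DVar.copy (q i)

/-- The register `q₂, q̄, q̄'`. -/
def regSwap {ι : Type} (q : ι → S.Var) : Unit ⊕ ι ⊕ ι → (ext S).Var :=
  Sum.elim (fun _ => DVar.q₂) (Sum.elim (fun i => DVar.orig (q i)) (fun i => DVar.copy (q i)))

/-- The register `q̄, q̄'`. -/
def regPair {ι : Type} (q : ι → S.Var) : ι ⊕ ι → (ext S).Var :=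
  Sum.elim (fun i => DVar.orig (q i)) (fun i => DVar.copy (q i))

/-- Right translation `C = ∑_{j ≥ 0} |j+1⟩⟨j|` on `q_c`. -/
def opC : Matrix (RCfg (reg1 S .qc)) (RCfg (reg1 S .qc)) ℂ := fun x y =>
  let i : ℤ := x ()
  let j : ℤ := y ()
  if 0 ≤ j ∧ i = j + 1 then 1 else 0

/-- Rotation `R_y(φ)` of a qubit. -/
def Ry (φ : ℝ) : Matrix (Fin 2) (Fin 2) ℂ :=
  !![(Real.cos (φ / 2) : ℂ), -(Real.sin (φ / 2) : ℂ);
     (Real.sin (φ / 2) : ℂ), (Real.cos (φ / 2) : ℂ)]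

/-- `b_j = μ(j) / (1 - ∑_{1 ≤ k < j} μ(k))`. -/
def bCoeff (μ : ℕ → ℝ) (j : ℕ) : ℝ := μ j / (1 - ∑ l ∈ Finset.Ico 1 j, μ l)

/-- `GP = ∑_{j ≥ 1} |j⟩⟨j| ⊗ R_y(2 arcsin √b_j)` on `q_c, q₂`. -/
def opGP (μ : ℕ → ℝ) : Matrix (RCfg (reg2 S .qc .q₂)) (RCfg (reg2 S .qc .q₂)) ℂ := fun x y =>
  let i : ℤ := x (Sum.inl ())
  let j : ℤ := y (Sum.inl ())
  let a : Fin 2 := x (Sum.inr ())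
  let b : Fin 2 := y (Sum.inr ())
  if i = j ∧ 1 ≤ j then Ry (2 * Real.arcsin (Real.sqrt (bCoeff μ j.toNat))) a b else 0

/-- Pauli `X` on `q₁`. -/
def opX : Matrix (RCfg (reg1 S .q₁)) (RCfg (reg1 S .q₁)) ℂ := fun x y =>
  let a : Fin 2 := x ()
  let b : Fin 2 := y ()
  if a ≠ b then 1 else 0

/-- The maximally mixed state `I/2` of `q₂`. -/
def halfId : Matrix (RCfg (reg1 S .q₂)) (RCfg (reg1 S .q₂)) ℂ := fun x y =>
  let a : Fin 2 := x ()
  let b : Fin 2 := y ()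
  if a = b then 1 / 2 else 0

/-- The measurement `M₀ = |00⟩⟨00|`, `M₁ = |01⟩⟨01|`, `M₂ = |10⟩⟨10| + |11⟩⟨11|` of `q₁, q₂`. -/
def opM : Fin 3 → Matrix (RCfg (reg2 S .q₁ .q₂)) (RCfg (reg2 S .q₁ .q₂)) ℂ := fun m x y =>
  let a : Fin 2 := x (Sum.inl ())
  let b : Fin 2 := x (Sum.inr ())
  let a' : Fin 2 := y (Sum.inl ())
  let b' : Fin 2 := y (Sum.inr ())
  if (a = a' ∧ b = b') ∧
    ((m = 0 ∧ a = 0 ∧ b = 0) ∨ (m = 1 ∧ a = 0 ∧ b = 1) ∨ (m = 2 ∧ a = 1)) then 1 else 0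

open Classical in
/-- The SWAP operator of `q̄` and `q̄'`. -/
def opSwap {ι : Type} (q : ι → S.Var) : Matrix (RCfg (regPair S q)) (RCfg (regPair S q)) ℂ :=
  fun x y =>
    let u : ∀ i, S.Basis (q i) := fun i => x (Sum.inl i)
    let u' : ∀ i, S.Basis (q i) := fun i => x (Sum.inr i)
    let v : ∀ i, S.Basis (q i) := fun i => y (Sum.inl i)
    let v' : ∀ i, S.Basis (q i) := fun i => y (Sum.inr i)
    if u = v' ∧ u' = v then 1 else 0

/-- The part of a label of `q₂, q̄, q̄'` that belongs to `q̄, q̄'`. -/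
def pairPart {ι : Type} (q : ι → S.Var) (x : RCfg (regSwap S q)) : RCfg (regPair S q)
  | Sum.inl i => x (Sum.inr (Sum.inl i))
  | Sum.inr i => x (Sum.inr (Sum.inr i))

/-- `AS = |0⟩⟨0| ⊗ e^{-i(π/4)SWAP} + |1⟩⟨1| ⊗ e^{i(π/4)SWAP}` on `q₂, q̄, q̄'`. -/
def opAS {ι : Type} (q : ι → S.Var) : Matrix (RCfg (regSwap S q)) (RCfg (regSwap S q)) ℂ :=
  fun x y =>
    let a : Fin 2 := x (Sum.inl ())
    let b : Fin 2 := y (Sum.inl ())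
    if a = b then
      (if a = 0 then
        iexp ((-(Complex.I * ((Real.pi / 4 : ℝ) : ℂ))) • opSwap S q) (pairPart S q x) (pairPart S q y)
      else
        iexp ((Complex.I * ((Real.pi / 4 : ℝ) : ℂ)) • opSwap S q) (pairPart S q x) (pairPart S q y))
    else 0

/-- `O_d = ∑_{j ≥ 1} (2/μ(j)) |j⟩⟨j| ⊗ |1⟩⟨1| ⊗ Z` on `q_c, q₁, q₂`. -/
def opOd (μ : ℕ → ℝ) : Matrix (RCfg (reg3 S)) (RCfg (reg3 S)) ℂ := fun x y =>
  let i : ℤ := x (Sum.inl ())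
  let j : ℤ := y (Sum.inl ())
  let a : Fin 2 := x (Sum.inr (Sum.inl ()))
  let a' : Fin 2 := y (Sum.inr (Sum.inl ()))
  let b : Fin 2 := x (Sum.inr (Sum.inr ()))
  let b' : Fin 2 := y (Sum.inr (Sum.inr ()))
  if (i = j ∧ a = a' ∧ b = b') ∧ 1 ≤ i ∧ a = 1 then
    ((2 / μ i.toNat : ℝ) : ℂ) * (if b = 0 then 1 else -1)
  else 0

end Differential

namespace Prog

variable {S : QSystem} {k : ℕ}

/-- The code transformation `T_θ` for the `j`-th parameter. -/
def trans (μ : ℕ → ℝ) (j : Fin k) : Prog S k → Prog (ext S) k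
  | skip => skip
  | init q => init (S := ext S) (DVar.orig q)
  | initState ι q σ => initState ι (regOrig S q) σ
  | unitary ι q U => unitary ι (regOrig S q) U
  | rot j' ι q σ =>
      if j' = j then
        seq
          (ite _ (reg2 S .q₁ .q₂) 3 (opM S)
            ![seq (unitary _ (reg1 S .qc) (opC S)) (unitary _ (reg2 S .qc .q₂) (opGP S μ)),
              seq (unitary _ (reg1 S .q₁) (opX S))
                (seq (initState _ (reg1 S .q₂) (halfId S))
                  (seq (initState ι (regCopy S q) σ)
                    (unitary _ (regSwap S q) (opAS S q)))),
              skip])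
          (rot j' ι (regOrig S q) σ)
      else rot j' ι (regOrig S q) σ
  | seq P₁ P₂ => seq (P₁.trans μ j) (P₂.trans μ j)
  | ite ι q m M P => ite ι (regOrig S q) m M fun i => (P i).trans μ j
  | .while ι q M₀ M₁ Q => .while ι (regOrig S q) M₀ M₁ (Q.trans μ j)

/-- The differential program: initialise `q₁, q₂, q_c`, apply `C` and `GP`, run `T_θ(P)`. -/
def diff (μ : ℕ → ℝ) (j : Fin k) (P : Prog S k) : Prog (ext S) k :=
  seq (init (S := ext S) DVar.q₁) <| seq (init (S := ext S) DVar.q₂) <|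
    seq (init (S := ext S) DVar.qc) <| seq (unitary _ (reg1 S .qc) (opC S)) <|
      seq (unitary _ (reg2 S .qc .q₂) (opGP S μ)) (P.trans μ j)

end Prog

/-- The operator `O_d² ⊗ O²` (tensored with the identity on the copies `q'`). -/
def secondMomentOp (S : QSystem) (μ : ℕ → ℝ) (O : Matrix (Cfg S) (Cfg S) ℂ) :
    Matrix (Cfg (ext S)) (Cfg (ext S)) ℂ :=
  imul (lift (reg3 S) (imul (opOd S μ) (opOd S μ))) (lift (regOrig S (fun v => v)) (imul O O))

/-- The diagonal entries of `(O_d² ⊗ O²) ⟦∂P⟧(ρ)`; their sum is `⟨O_d² ⊗ O²⟩`. -/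
def secondMomentTerm {S : QSystem} {k : ℕ} (μ : ℕ → ℝ) (θ : Fin k → ℝ) (j : Fin k) (P : Prog S k)
    (O : Matrix (Cfg S) (Cfg S) ℂ) (ρ : Matrix (Cfg (ext S)) (Cfg (ext S)) ℂ) (x : Cfg (ext S)) : ℂ :=
  imul (secondMomentOp S μ O) ((P.diff μ j).sem θ ρ) x x

/-- `⟨O_d² ⊗ O²⟩ = tr ((O_d² ⊗ O²) ⟦∂P⟧(ρ))` is a convergent trace, with a real value at most
`B`. -/
def SecondMomentLE {S : QSystem} {k : ℕ} (μ : ℕ → ℝ) (θ : Fin k → ℝ) (j : Fin k) (P : Prog S k)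
    (O : Matrix (Cfg S) (Cfg S) ℂ) (ρ : Matrix (Cfg (ext S)) (Cfg (ext S)) ℂ) (B : ℝ) : Prop :=
  ∃ v : ℝ, HasSum (secondMomentTerm μ θ j P O ρ) (v : ℂ) ∧ v ≤ B

/-- Probability distributions on the positive integers, with all weights positive (the value at
`0` is irrelevant). -/
def IsPosDistribution (μ : ℕ → ℝ) : Prop :=
  (∀ n, 1 ≤ n → 0 < μ n) ∧ HasSum (fun n : ℕ => μ (n + 1)) 1

/-- `μ(n) ∝ 1 / (n ln^{1+s}(n + e))`. -/
def IsLogDistribution (s : ℝ) (μ : ℕ → ℝ) : Prop :=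
  IsPosDistribution μ ∧
    ∃ c : ℝ, ∀ n : ℕ, 1 ≤ n → μ n = c * (1 / (n * Real.log (n + Real.exp 1) ^ (1 + s)))

open Classical in
/-- The largest eigenvalue of `|O|`, i.e. the operator norm. -/
def opNorm {I : Type} [Fintype I] (O : Matrix I I ℂ) : ℝ :=
  ‖Matrix.toEuclideanCLM (n := I) (𝕜 := ℂ) O‖

end QWhile

end

set_option linter.unusedSectionVars false

noncomputable section

namespace QWhile

open scoped ComplexOrder

/-! ### Positive semidefinite matrices -/

section PSD

variable {X : Type}

/-! Think of a run of `P` and count the rotations by `θ` that it passes. In `∂P` the qubit `q₁`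
stays `|0⟩` while the run is undecided; after `n` rotations the counter is `n + 1`, and `GP` makes
the weights of `q₂ = |0⟩` and `q₂ = |1⟩` proportional to `tail μ (n + 2)` and `μ (n + 1)`. So the
final state with `q₁ = |1⟩` and counter `j` has mass `μ j` times the probability of passing at least
`j` rotations. There `O_d²` equals `4 / μ(j)²`, hence the second moment is at most `‖O‖² ∑ⱼ (4 / μ
j) Pr(count ≥ j)`. What the controlled swap does is irrelevant, as long as it preserves the trace.

The tail of the count is estimated by a Markov inequality, `Pr(count ≥ j) ≤ ζ⁻ʲ E[ζ^count]` with `ζ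
≥ 1`. The generating function is the trace of `wsem`, the semantics of `P` on the finite-dimensional
space in which every rotation by `θ` is multiplied by `ζ`. Two results carry the argument.

The comparison is `Prog.sim_trans`. It follows the extended state `σ` alongside a weighted state
`Z`. The operator `psi` restores `∑_{n ≤ J} ζⁿ · (runs with n rotations)` from the undecided blocks,
and the first two terms of `slack` amount to `E[ζ^min(count, J+1)]`. Two properties persist: `psi ≤
Z` as operators, and `slack` does not increase. Trace-preserving operations on the program variables
treat all terms alike; the statements inserted before a rotation change `slack` by `-(ζ - 1)(tr Z -
tr psi)` (`sim_gadget`); loops are handled by a limit (`Sim.loop`). Starting from `Z = psi` this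
gives `Prog.rtr_beta_diff_le`.

The trace bound is `exists_wsem_bound`: `tr wsem ≤ ζ^RC (1 + δ)^LC tr` whenever `ζ^RC ≤ 1 + l`,
where `l` depends only on `ε`, `N`, `δ` and a bound on the number of loops. The weighted body of a
loop is a small perturbation of a trace-preserving map. If the unweighted loop retains at most a
quarter of the mass after `n₀` rounds, the weighted one still retains at most half, and its total
output exceeds its input by a factor of at most `1 + δ` (`loop_perturbation`). The proof is by
induction on the number of loops.

Decay is automatic in finite dimension: every positive `A` lies below a multiple of `tr A` times the
identity, so it is enough that the mass inside the loop dies out for the identity as input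
(`Prog.exists_loopsDecay`). For boundedness, one fixed `ζ > 1` beats the subexponential growth of `1
/ μ`. For the rate, `ζ = (1 + l)^(1/RC)` leaves `∑ n ln^{1+s}(n+e) ζ⁻ⁿ`, of order `RC^{3+s}`.
Without loops every `ζ` is allowed, and `ζ → ∞` cuts the sum off at `RC`, which produces the first
term. -/

theorem posSemidef_of_finset {M : Matrix X X ℂ}
    (h : ∀ s : Finset X, (M.submatrix (fun x : s => (x : X)) (fun x : s => (x : X))).PosSemidef) :
    M.PosSemidef := by
  classical
  refine ⟨?_, fun v => ?_⟩
  · ext x y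
    have := (h {x, y}).1.apply ⟨x, by simp⟩ ⟨y, by simp⟩
    simpa using this
  · have := (h v.support).dotProduct_mulVec_nonneg (fun x => v x)
    simp only [dotProduct, Matrix.mulVec, Matrix.submatrix_apply, Pi.star_apply] at this
    rw [Finsupp.sum, ← Finset.sum_coe_sort]
    convert this using 2 with x hx
    rw [Finsupp.sum, ← Finset.sum_coe_sort, Finset.mul_sum]
    refine Finset.sum_congr rfl fun y _ => ?_
    ring

/-- Test vectors have finite support, so each value of the quadratic form is a finite combination of
entries; entrywise convergence suffices even for infinite `X`. -/
theorem posSemidef_of_hasSum {κ : Type} {M : κ → Matrix X X ℂ} {A : Matrix X X ℂ}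
    (hM : ∀ n, (M n).PosSemidef) (h : ∀ x y, HasSum (fun n => M n x y) (A x y)) :
    A.PosSemidef := by
  refine ⟨?_, fun v => ?_⟩
  · ext x y
    have hs : HasSum (fun n => star (M n y x)) (star (A y x)) := (h y x).star
    simp only [fun n => (hM n).1.apply x y] at hs
    exact hs.unique (h x y)
  · have hs : HasSum (fun n => v.sum fun x vx => v.sum fun y vy => star vx * M n x y * vy)
        (v.sum fun x vx => v.sum fun y vy => star vx * A x y * vy) :=
      hasSum_sum fun x _ => hasSum_sum fun y _ => ((h x y).mul_left _).mul_right _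
    exact hs.nonneg fun n => (hM n).2 v

theorem PSD.diag_re_nonneg {M : Matrix X X ℂ} (h : M.PosSemidef) (x : X) : 0 ≤ (M x x).re :=
  (Complex.le_def.1 (h.diag_nonneg (i := x))).1

theorem PSD.diag_eq {M : Matrix X X ℂ} (h : M.PosSemidef) (x : X) :
    M x x = ((M x x).re : ℂ) := by
  have := (Complex.le_def.1 (h.diag_nonneg (i := x))).2
  apply Complex.ext <;> simp_all

theorem PSD.quad {M : Matrix X X ℂ} (h : M.PosSemidef) (x y : X) (a b : ℂ) :
    0 ≤ (star a * M x x * a + star a * M x y * b + star b * M y x * a + star b * M y y * b).re := by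
  have h2 := (h.submatrix ![x, y]).dotProduct_mulVec_nonneg ![a, b]
  have h3 := (Complex.le_def.1 h2).1
  simp only [dotProduct, Matrix.mulVec, Fin.sum_univ_two, Matrix.submatrix_apply, Pi.star_apply,
    Matrix.cons_val_zero, Matrix.cons_val_one, Complex.zero_re] at h3
  refine h3.trans_eq ?_
  congr 1
  ring

/-- Test the form on `(-M x y, ‖M x y‖)`. A sum of diagonal entries is a convenient majorant: a
series of positive operators whose diagonals are summable then converges absolutely in every entry.
-/
theorem PSD.norm_le {M : Matrix X X ℂ} (h : M.PosSemidef) (x y : X) :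
    ‖M x y‖ ≤ (M x x).re + (M y y).re := by
  by_cases h0 : M x y = 0
  · simpa [h0] using add_nonneg (PSD.diag_re_nonneg h x) (PSD.diag_re_nonneg h y)
  have hq := PSD.quad h x y (-(M x y)) (‖M x y‖ : ℂ)
  have hyx : M y x = star (M x y) := (h.1.apply y x).symm
  have hx := PSD.diag_eq h x
  have hy := PSD.diag_eq h y
  set z := M x y
  have hz : star z * z = ((‖z‖ ^ 2 : ℝ) : ℂ) := by
    rw [Complex.star_def, Complex.conj_mul']; push_cast; rfl
  have e : star (-z) * M x x * (-z) + star (-z) * z * (‖z‖ : ℂ) + star (‖z‖ : ℂ) * M y x * (-z)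
      + star (‖z‖ : ℂ) * M y y * (‖z‖ : ℂ)
      = ((‖z‖ ^ 2 * ((M x x).re + (M y y).re - 2 * ‖z‖) : ℝ) : ℂ) := by
    rw [hyx, hx, hy]
    have hs : star (‖z‖ : ℂ) = (‖z‖ : ℂ) := by simp
    rw [hs, star_neg]
    have : (-star z * ((M x x).re : ℂ) * (-z) + -star z * z * (‖z‖ : ℂ) + (‖z‖ : ℂ) * star z * (-z)
      + (‖z‖ : ℂ) * ((M y y).re : ℂ) * (‖z‖ : ℂ)) = (star z * z) * ((M x x).re - 2 * ‖z‖) +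
        (‖z‖ : ℂ) ^ 2 * ((M y y).re : ℂ) := by ring
    rw [this, hz]
    push_cast
    simp only [Complex.ofReal_re]
    ring
  rw [e, Complex.ofReal_re] at hq
  have hpos : 0 < ‖z‖ := norm_pos_iff.2 h0
  have := nonneg_of_mul_nonneg_right hq (by positivity)
  linarith

theorem PSD.eq_zero_of_diag {M : Matrix X X ℂ} (h : M.PosSemidef) (x y : X)
    (h0 : (M x x).re = 0) : M x y = 0 := by
  by_contra hne
  have hyx : M y x = star (M x y) := (h.1.apply y x).symm
  have hx : M x x = 0 := by rw [PSD.diag_eq h x, h0]; simp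
  have hy := PSD.diag_eq h y
  have hy0 := PSD.diag_re_nonneg h y
  set z := M x y
  have hpos : 0 < ‖z‖ := norm_pos_iff.2 hne
  -- The coefficient is chosen so that the cross terms add up to `-2 (M y y + 1)`, which outweighs
  -- the only other surviving term `M y y`.
  have hq := PSD.quad h x y (-((((M y y).re + 1) / ‖z‖ ^ 2 : ℝ) : ℂ) * z) 1
  have e : star (-((((M y y).re + 1) / ‖z‖ ^ 2 : ℝ) : ℂ) * z) * M x x *
      (-((((M y y).re + 1) / ‖z‖ ^ 2 : ℝ) : ℂ) * z)
      + star (-((((M y y).re + 1) / ‖z‖ ^ 2 : ℝ) : ℂ) * z) * z * 1 +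
      star (1 : ℂ) * M y x * (-((((M y y).re + 1) / ‖z‖ ^ 2 : ℝ) : ℂ) * z) + star (1 : ℂ) * M y y * 1
      = (((M y y).re - 2 * ((M y y).re + 1) : ℝ) : ℂ) := by
    rw [hx, hyx, hy]
    have hs : ∀ r : ℝ, star (r : ℂ) = (r : ℂ) := by simp
    rw [star_mul', star_neg, hs, star_one]
    have : star z * z = (‖z‖ : ℂ) ^ 2 := by rw [Complex.star_def, Complex.conj_mul']
    have hn : (‖z‖ : ℂ) ^ 2 ≠ 0 := by exact_mod_cast (by positivity : ‖z‖ ^ 2 ≠ 0)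
    push_cast
    simp only [Complex.ofReal_re]
    have h3 : ∀ c : ℂ, -(c / (‖z‖ : ℂ) ^ 2) * star z * 0 * (-(c / (‖z‖ : ℂ) ^ 2) * z)
        + -(c / (‖z‖ : ℂ) ^ 2) * star z * z * 1
        + 1 * star z * (-(c / (‖z‖ : ℂ) ^ 2) * z) = - 2 * c * ((star z * z) / (‖z‖ : ℂ) ^ 2) := by
      intro c; ring
    rw [h3, this, div_self hn]
    ring
  rw [e, Complex.ofReal_re] at hq
  linarith

end PSD

/-! ### Operators with finitely many branches -/

section Branch

variable {X κ : Type} [Fintype κ]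

open Classical in
/-- `L` maps `⟨x|` to `∑ₖ gₖ(x) ⟨fₖ(x)|`. -/
def IsBranch (L : Matrix X X ℂ) (f : κ → X → X) (g : κ → X → ℂ) : Prop :=
  ∀ x z, L x z = ∑ k, if z = f k x then g k x else 0

open Classical in
theorem tsum_branch (f : κ → X) (g : κ → ℂ) (h : X → ℂ) :
    ∑' z, (∑ k, if z = f k then g k else 0) * h z = ∑ k, g k * h (f k) := by
  have : ∀ k, HasSum (fun z => (if z = f k then g k else 0) * h z) (g k * h (f k)) := by
    intro k
    convert hasSum_ite_eq (f k) (g k * h (f k)) using 2 with z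
    split_ifs with hz <;> simp [hz]
  rw [← (hasSum_sum fun k (_ : k ∈ Finset.univ) => this k).tsum_eq]
  simp_rw [Finset.sum_mul]

/-- Rows of `L` have finite support, so the unconditional sums in `conj` collapse to finite ones
with no convergence condition on `ρ`. This keeps the infinite counter harmless. -/
theorem conj_apply {L : Matrix X X ℂ} {f : κ → X → X} {g : κ → X → ℂ} (hL : IsBranch L f g)
    (ρ : Matrix X X ℂ) (x y : X) :
    conj L ρ x y = ∑ k, ∑ k', g k x * ρ (f k x) (f k' y) * star (g k' y) := by
  classical
  unfold conj imul
  have h1 : ∀ z, ∑' w, L x w * ρ w z = ∑ k, g k x * ρ (f k x) z := fun z => by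
    simp_rw [hL x]
    convert tsum_branch (fun k => f k x) (fun k => g k x) (fun w => ρ w z)
  simp_rw [h1]
  have h2 : ∀ z, (Lᴴ) z y = ∑ k, if z = f k y then star (g k y) else 0 := fun z => by
    rw [Matrix.conjTranspose_apply, hL y z, star_sum]
    refine Finset.sum_congr rfl fun k _ => ?_
    split_ifs <;> simp
  simp_rw [h2, mul_comm _ (∑ k, if _ = f k y then star (g k y) else 0)]
  have := tsum_branch (fun k => f k y) (fun k => star (g k y))
    (fun z => ∑ k, g k x * ρ (f k x) z)
  rw [Finset.sum_comm]
  convert this using 2 with k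
  rw [Finset.mul_sum]
  refine Finset.sum_congr rfl fun k' _ => ?_
  ring

/-- A finite corner of `L ρ L†` sees only the entries of `ρ` at the finitely many labels `f k x`,
where it is an ordinary product `G N G†` of finite matrices. -/
theorem conj_posSemidef {L : Matrix X X ℂ} {f : κ → X → X} {g : κ → X → ℂ} (hL : IsBranch L f g)
    {ρ : Matrix X X ℂ} (hρ : ρ.PosSemidef) : (conj L ρ).PosSemidef := by
  classical
  refine posSemidef_of_finset fun s => ?_
  let G : Matrix s (κ × s) ℂ := fun x kx => if x = kx.2 then g kx.1 x else 0
  have hG : ∀ x kx, G x kx = if x = kx.2 then g kx.1 x else 0 := fun _ _ => rfl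
  have := (hρ.submatrix (fun kx : κ × s => f kx.1 kx.2)).mul_mul_conjTranspose_same G
  convert this using 1
  ext x y
  rw [Matrix.submatrix_apply, conj_apply hL]
  simp only [Matrix.mul_apply, Fintype.sum_prod_type, hG, Matrix.submatrix_apply,
    Matrix.conjTranspose_apply, ite_mul, zero_mul, Finset.sum_ite_eq, Finset.mem_univ, if_true,
    apply_ite (star : ℂ → ℂ), star_zero, mul_ite, mul_zero]
  simp_rw [Finset.sum_mul]
  rw [Finset.sum_comm]

end Branch

/-! ### Operators of a finite register -/

section Register

variable {S : QSystem} {ι : Type} {q : ι → S.Var}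

theorem readReg_setReg (hq : Function.Injective q) (x : Cfg S) (w : RCfg q) :
    readReg q (setReg q x w) = w := by
  funext i
  exact setReg_apply q hq x w i

theorem setReg_ext (hq : Function.Injective q) {x z : Cfg S} {w : RCfg q}
    (h1 : readReg q z = w) (h2 : ∀ v, (∀ i, q i ≠ v) → z v = x v) : z = setReg q x w := by
  funext v
  by_cases hv : ∃ i, q i = v
  · obtain ⟨i, rfl⟩ := hv
    rw [setReg_apply q hq, ← h1]
    rfl
  · push Not at hv
    rw [setReg_of_notMem q x w v hv, h2 v hv]

theorem setReg_readReg (hq : Function.Injective q) (x : Cfg S) : setReg q x (readReg q x) = x :=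
  (setReg_ext hq rfl fun _ _ => rfl).symm

theorem setReg_setReg (hq : Function.Injective q) (x : Cfg S) (w w' : RCfg q) :
    setReg q (setReg q x w) w' = setReg q x w' := by
  refine setReg_ext hq (readReg_setReg hq _ _) fun v hv => ?_
  rw [setReg_of_notMem q _ _ v hv, setReg_of_notMem q _ _ v hv]

theorem eq_setReg_iff (hq : Function.Injective q) (x z : Cfg S) :
    (∀ v, (∀ i, q i ≠ v) → x v = z v) ↔ z = setReg q x (readReg q z) := by
  constructor
  · intro h
    exact setReg_ext hq rfl fun v hv => (h v hv).symm
  · intro h v hv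
    rw [h, setReg_of_notMem q x _ v hv]

variable [Fintype (RCfg q)]

theorem lift_isBranch (hq : Function.Injective q) (A : Matrix (RCfg q) (RCfg q) ℂ) :
    IsBranch (lift q A) (fun w x => setReg q x w) (fun w x => A (readReg q x) w) := by
  classical
  intro x z
  unfold lift
  by_cases h : ∀ v, (∀ i, q i ≠ v) → x v = z v
  · rw [if_pos h, Finset.sum_eq_single (readReg q z)]
    · rw [if_pos ((eq_setReg_iff hq x z).1 h)]
    · intro w _ hw
      rw [if_neg]
      rintro rfl
      exact hw (readReg_setReg hq x w).symm
    · simp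
  · rw [if_neg h, Finset.sum_eq_zero]
    intro w _
    rw [if_neg]
    rintro rfl
    exact h fun v hv => (setReg_of_notMem q x w v hv).symm

theorem conj_lift_apply (hq : Function.Injective q) (A : Matrix (RCfg q) (RCfg q) ℂ)
    (ρ : Matrix (Cfg S) (Cfg S) ℂ) (x y : Cfg S) :
    conj (lift q A) ρ x y = ∑ w, ∑ w', A (readReg q x) w * ρ (setReg q x w) (setReg q y w') *
      star (A (readReg q y) w') :=
  conj_apply (lift_isBranch hq A) ρ x y

theorem conj_lift_posSemidef (hq : Function.Injective q) (A : Matrix (RCfg q) (RCfg q) ℂ)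
    {ρ : Matrix (Cfg S) (Cfg S) ℂ} (hρ : ρ.PosSemidef) : (conj (lift q A) ρ).PosSemidef :=
  conj_posSemidef (lift_isBranch hq A) hρ

/-- A finite family of labels closed under changes of the register. -/
def RegClosed {D : Type} (q : ι → S.Var) (m : D → Cfg S) : Prop :=
  Function.Injective m ∧ ∀ d w, ∃ d', m d' = setReg q (m d) w

/-- Exchanging the register part of a label with `w` is an involution of the index set, since the
family is closed under overwriting the register. -/
theorem sum_regClosed {D : Type} [Fintype D] (hq : Function.Injective q) {m : D → Cfg S}
    (hm : RegClosed q m) (F : Cfg S → RCfg q → ℂ) :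
    ∑ d, ∑ w, F (setReg q (m d) w) (readReg q (m d)) = ∑ d, ∑ w, F (m d) w := by
  choose st hst using hm.2
  rw [← Fintype.sum_prod_type', ← Fintype.sum_prod_type']
  have hinv : Function.Involutive
      (fun p : D × RCfg q => ((st p.1 p.2, readReg q (m p.1)) : D × RCfg q)) := by
    rintro ⟨d, w⟩
    refine Prod.ext (hm.1 ?_) ?_
    · simp only [hst, setReg_setReg hq, setReg_readReg hq]
    · simp only [hst, readReg_setReg hq]
  refine Fintype.sum_equiv hinv.toPerm _ _ ?_
  rintro ⟨d, w⟩
  simp [Function.Involutive.toPerm, hst]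

-- A local form of trace preservation: operators of a register move weight only inside a family
-- closed under overwriting that register. Taken over all labels it concerns the trace; taken over
-- labels with fixed `q₁` and counter, it allows the controlled swap and the resets to be discarded
-- on the infinite-dimensional space.
open Classical in
theorem sum_conj_lift {D κ : Type} [Fintype D] [Fintype κ] (hq : Function.Injective q)
    {m : D → Cfg S} (hm : RegClosed q m) (A : κ → Matrix (RCfg q) (RCfg q) ℂ)
    (hA : ∑ k, (A k)ᴴ * A k = 1) (ρ : Matrix (Cfg S) (Cfg S) ℂ) :
    ∑ k, ∑ d, conj (lift q (A k)) ρ (m d) (m d) = ∑ d, ρ (m d) (m d) := by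
  have h1 : ∀ k, ∑ d, conj (lift q (A k)) ρ (m d) (m d) =
      ∑ d, ∑ w', ρ (m d) (setReg q (m d) w') * ((A k)ᴴ * A k) w' (readReg q (m d)) := by
    intro k
    simp_rw [conj_lift_apply hq]
    have := sum_regClosed hq hm (fun z v => ∑ w', A k v (readReg q z) * ρ z (setReg q z w') *
      star (A k v w'))
    simp only [readReg_setReg hq, setReg_setReg hq] at this
    rw [this]
    refine Finset.sum_congr rfl fun d _ => ?_
    rw [Finset.sum_comm]
    refine Finset.sum_congr rfl fun w' _ => ?_
    rw [Matrix.mul_apply, Finset.mul_sum]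
    refine Finset.sum_congr rfl fun v _ => ?_
    rw [Matrix.conjTranspose_apply]
    ring
  simp_rw [h1]
  rw [Finset.sum_comm]
  refine Finset.sum_congr rfl fun d _ => ?_
  rw [Finset.sum_comm]
  simp_rw [← Finset.mul_sum, ← Matrix.sum_apply, hA, Matrix.one_apply, mul_ite, mul_one, mul_zero]
  rw [Finset.sum_ite_eq' Finset.univ]
  simp [setReg_readReg hq]

open Classical in
/-- The Kraus operators of `ρ ↦ tr_q̄(ρ) ⊗ σ` for `σ = B†B`. -/
def resetKraus (q : ι → S.Var) (B : Matrix (RCfg q) (RCfg q) ℂ) (p : RCfg q × RCfg q) :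
    Matrix (RCfg q) (RCfg q) ℂ :=
  fun u v => if v = p.2 then star (B p.1 u) else 0

open Classical in
theorem resetKraus_apply (B : Matrix (RCfg q) (RCfg q) ℂ) (p : RCfg q × RCfg q) (u v : RCfg q) :
    resetKraus q B p u v = if v = p.2 then star (B p.1 u) else 0 := rfl

theorem resetReg_eq_sum (hq : Function.Injective q) (B : Matrix (RCfg q) (RCfg q) ℂ)
    (ρ : Matrix (Cfg S) (Cfg S) ℂ) :
    resetReg q (Bᴴ * B) ρ = ∑ p, conj (lift q (resetKraus q B p)) ρ := by
  classical
  ext x y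
  have h1 : resetReg q (Bᴴ * B) ρ x y =
      (∑ u, star (B u (readReg q x)) * B u (readReg q y)) *
        ∑ w, ρ (setReg q x w) (setReg q y w) := by
    rw [resetReg, tsum_fintype, Matrix.mul_apply]
    rfl
  rw [h1, Matrix.sum_apply, Finset.sum_mul]
  simp only [conj_lift_apply hq, Fintype.sum_prod_type, resetKraus_apply, apply_ite (star : ℂ → ℂ),
    star_zero, star_star, ite_mul, mul_ite, zero_mul, mul_zero, Finset.sum_ite_eq',
    Finset.mem_univ, if_true]
  refine Finset.sum_congr rfl fun u _ => ?_
  rw [Finset.mul_sum]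
  refine Finset.sum_congr rfl fun w _ => ?_
  ring

open Classical in
theorem sum_resetKraus (B : Matrix (RCfg q) (RCfg q) ℂ) (hB : (Bᴴ * B).trace = 1) :
    ∑ p, (resetKraus q B p)ᴴ * resetKraus q B p = 1 := by
  ext v v'
  rw [Matrix.sum_apply]
  simp only [Matrix.mul_apply, Matrix.conjTranspose_apply, Fintype.sum_prod_type, resetKraus_apply,
    apply_ite (star : ℂ → ℂ), star_zero, star_star, ite_mul, mul_ite, zero_mul, mul_zero]
  rw [Matrix.one_apply]
  split_ifs with h
  · subst h
    rw [← hB, Matrix.trace, Finset.sum_comm' (t' := Finset.univ) (s' := fun _ => Finset.univ) (by simp)]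
    simp only [Matrix.diag, Matrix.mul_apply, Matrix.conjTranspose_apply]
    rw [Finset.sum_eq_single v]
    · rw [Finset.sum_comm]
      simp [mul_comm]
    · intro w _ hw
      simp [hw.symm]
    · simp
  · refine Finset.sum_eq_zero fun u _ => Finset.sum_eq_zero fun w _ => Finset.sum_eq_zero fun z _ => ?_
    by_cases h1 : v = w
    · subst h1; simp [Ne.symm h]
    · simp [h1]

theorem exists_sqrt_of_isDensity {σ : Matrix (RCfg q) (RCfg q) ℂ} (hσ : IsDensity σ) :
    ∃ B : Matrix (RCfg q) (RCfg q) ℂ, σ = Bᴴ * B ∧ (Bᴴ * B).trace = 1 := by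
  classical
  open scoped MatrixOrder in
  obtain ⟨B, hB⟩ := CStarAlgebra.nonneg_iff_eq_star_mul_self.mp hσ.1.nonneg
  refine ⟨B, hB, ?_⟩
  rw [Matrix.star_eq_conjTranspose] at hB
  rw [← hB]
  exact (hasSum_fintype _).unique hσ.2

theorem resetReg_posSemidef (hq : Function.Injective q) {σ : Matrix (RCfg q) (RCfg q) ℂ}
    (hσ : IsDensity σ) {ρ : Matrix (Cfg S) (Cfg S) ℂ} (hρ : ρ.PosSemidef) :
    (resetReg q σ ρ).PosSemidef := by
  obtain ⟨B, rfl, -⟩ := exists_sqrt_of_isDensity hσ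
  rw [resetReg_eq_sum hq]
  exact Matrix.posSemidef_sum _ fun p _ => conj_lift_posSemidef hq _ hρ

theorem sum_resetReg {D : Type} [Fintype D] (hq : Function.Injective q)
    {m : D → Cfg S} (hm : RegClosed q m) {σ : Matrix (RCfg q) (RCfg q) ℂ}
    (hσ : IsDensity σ) (ρ : Matrix (Cfg S) (Cfg S) ℂ) :
    ∑ d, resetReg q σ ρ (m d) (m d) = ∑ d, ρ (m d) (m d) := by
  obtain ⟨B, rfl, hB⟩ := exists_sqrt_of_isDensity hσ
  rw [resetReg_eq_sum hq, ← sum_conj_lift hq hm _ (sum_resetKraus B hB) ρ, Finset.sum_comm]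
  refine Finset.sum_congr rfl fun d _ => ?_
  rw [Matrix.sum_apply]

end Register

theorem resetVar_eq_resetReg {S : QSystem} (q : S.Var) (ρ : Matrix (Cfg S) (Cfg S) ℂ) :
    resetVar q ρ = resetReg (fun _ : Unit => q)
      (Matrix.of (open Classical in fun u v => if u () = S.zero q ∧ v () = S.zero q then 1 else 0)) ρ := by
  classical
  have hset : ∀ (x : Cfg S) (n : S.Basis q),
      setReg (fun _ : Unit => q) x (fun _ => n) = Function.update x q n := by
    intro x n
    refine (setReg_ext (fun _ _ _ => rfl) ?_ ?_).symm
    · funext i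
      simp [readReg]
    · intro v hv
      exact Function.update_of_ne (hv ()).symm _ _
  ext x y
  unfold resetVar resetReg
  have : ∑' w : RCfg (fun _ : Unit => q), ρ (setReg (fun _ : Unit => q) x w)
      (setReg (fun _ : Unit => q) y w) =
      ∑' n : S.Basis q, ρ (Function.update x q n) (Function.update y q n) := by
    rw [← (Equiv.funUnique Unit (S.Basis q)).symm.tsum_eq]
    refine tsum_congr fun n => ?_
    exact congrArg₂ ρ (hset x n) (hset y n)
  rw [this, Matrix.of_apply]
  by_cases h : x q = S.zero q ∧ y q = S.zero q
  · rw [if_pos h, if_pos (show readReg (fun _ : Unit => q) x () = S.zero q ∧ readReg (fun _ : Unit => q) y () = S.zero q from h), one_mul]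
  · rw [if_neg h, if_neg (show ¬ (readReg (fun _ : Unit => q) x () = S.zero q ∧ readReg (fun _ : Unit => q) y () = S.zero q) from h), zero_mul]

theorem isDensity_zero {S : QSystem} (q : S.Var) :
    IsDensity (Matrix.of (open Classical in fun u v : RCfg (fun _ : Unit => q) =>
      if u () = S.zero q ∧ v () = S.zero q then (1 : ℂ) else 0)) := by
  classical
  constructor
  · refine posSemidef_of_finset fun s => ?_
    convert Matrix.posSemidef_vecMulVec_self_star
      (fun u : s => if u.1 () = S.zero q then (1 : ℂ) else 0) using 1
    ext u v
    simp only [Matrix.submatrix_apply, Matrix.of_apply, Matrix.vecMulVec_apply, Pi.star_apply]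
    by_cases h1 : u.1 () = S.zero q <;> by_cases h2 : v.1 () = S.zero q <;> simp [h1, h2]
  · convert hasSum_ite_eq (fun _ => S.zero q : RCfg (fun _ : Unit => q)) (1 : ℂ) using 2 with u
    simp only [Matrix.of_apply, and_self]
    congr 1
    refine propext ⟨fun h => funext fun _ => h, fun h => by rw [h]⟩

/-! ### Positive maps -/

section PosMap

variable {I : Type} [Fintype I]

/-- The real part of the trace. -/
def rtr (A : Matrix I I ℂ) : ℝ := A.trace.re

theorem rtr_add (A B : Matrix I I ℂ) : rtr (A + B) = rtr A + rtr B := by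
  simp [rtr, Matrix.trace_add]

theorem rtr_sub (A B : Matrix I I ℂ) : rtr (A - B) = rtr A - rtr B := by
  simp [rtr, Matrix.trace_sub]

theorem rtr_smul (c : ℝ) (A : Matrix I I ℂ) : rtr ((c : ℂ) • A) = c * rtr A := by
  simp [rtr, Matrix.trace_smul]

theorem rtr_zero : rtr (0 : Matrix I I ℂ) = 0 := by simp [rtr]

theorem rtr_sum {κ : Type} (s : Finset κ) (A : κ → Matrix I I ℂ) :
    rtr (∑ k ∈ s, A k) = ∑ k ∈ s, rtr (A k) := by
  simp [rtr, Matrix.trace_sum]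

theorem rtr_eq_sum (A : Matrix I I ℂ) : rtr A = ∑ x, (A x x).re := by
  simp [rtr, Matrix.trace]

theorem rtr_nonneg {A : Matrix I I ℂ} (hA : A.PosSemidef) : 0 ≤ rtr A := by
  rw [rtr_eq_sum]
  exact Finset.sum_nonneg fun x _ => PSD.diag_re_nonneg hA x

theorem PSD.diag_le_rtr {A : Matrix I I ℂ} (hA : A.PosSemidef) (x : I) : (A x x).re ≤ rtr A := by
  rw [rtr_eq_sum]
  exact Finset.single_le_sum (f := fun x => (A x x).re)
    (fun y _ => PSD.diag_re_nonneg hA y) (Finset.mem_univ x)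

theorem PSD.norm_le_rtr {A : Matrix I I ℂ} (hA : A.PosSemidef) (x y : I) :
    ‖A x y‖ ≤ 2 * rtr A := by
  have := PSD.norm_le hA x y
  have := PSD.diag_le_rtr hA x
  have := PSD.diag_le_rtr hA y
  linarith

theorem PSD.eq_zero_of_rtr {A : Matrix I I ℂ} (hA : A.PosSemidef) (h : rtr A = 0) : A = 0 := by
  ext x y
  have := PSD.norm_le_rtr hA x y
  rw [h, mul_zero] at this
  exact norm_le_zero_iff.1 this

theorem rtr_mono {A B : Matrix I I ℂ} (h : (B - A).PosSemidef) : rtr A ≤ rtr B := by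
  have := rtr_nonneg h
  rw [rtr_sub] at this
  linarith

theorem PSD.smul {X : Type} {A : Matrix X X ℂ} (hA : A.PosSemidef) {c : ℝ} (hc : 0 ≤ c) :
    ((c : ℂ) • A).PosSemidef :=
  Matrix.PosSemidef.smul hA (by exact_mod_cast hc)

theorem hasSum_rtr {M : ℕ → Matrix I I ℂ} {A : Matrix I I ℂ}
    (h : ∀ x y, HasSum (fun n => M n x y) (A x y)) : HasSum (fun n => rtr (M n)) (rtr A) := by
  simp_rw [rtr_eq_sum]
  exact hasSum_sum fun x _ => Complex.hasSum_re (h x x)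

/-- Maps that are additive, positive and positively homogeneous on positive semidefinite
matrices. -/
structure PosMap (F : Matrix I I ℂ → Matrix I I ℂ) : Prop where
  pos : ∀ A, A.PosSemidef → (F A).PosSemidef
  add : ∀ A B, A.PosSemidef → B.PosSemidef → F (A + B) = F A + F B
  smul : ∀ (c : ℝ) A, 0 ≤ c → A.PosSemidef → F ((c : ℂ) • A) = (c : ℂ) • F A

/-- Trace-preserving maps. -/
def TP (F : Matrix I I ℂ → Matrix I I ℂ) : Prop := ∀ A, A.PosSemidef → rtr (F A) = rtr A

/-- Domination of maps on positive semidefinite matrices. -/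
def LeMap (F G : Matrix I I ℂ → Matrix I I ℂ) : Prop := ∀ A, A.PosSemidef → (G A - F A).PosSemidef

variable {F G : Matrix I I ℂ → Matrix I I ℂ}

theorem PosMap.id : PosMap (fun A : Matrix I I ℂ => A) := ⟨fun _ h => h, fun _ _ _ _ => rfl, fun _ _ _ _ => rfl⟩

theorem PosMap.comp (hG : PosMap G) (hF : PosMap F) : PosMap (fun A => G (F A)) where
  pos A hA := hG.pos _ (hF.pos A hA)
  add A B hA hB := by rw [hF.add A B hA hB, hG.add _ _ (hF.pos A hA) (hF.pos B hB)]
  smul c A hc hA := by rw [hF.smul c A hc hA, hG.smul c _ hc (hF.pos A hA)]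

theorem PosMap.iterate (hF : PosMap F) (n : ℕ) : PosMap (F^[n]) := by
  induction n with
  | zero => exact PosMap.id
  | succ n ih => rw [Function.iterate_succ']; exact hF.comp ih

theorem PosMap.map_zero (hF : PosMap F) : F 0 = 0 := by
  have := hF.smul 0 0 le_rfl Matrix.PosSemidef.zero
  simpa using this

theorem PosMap.sum {κ : Type} (s : Finset κ) {F : κ → Matrix I I ℂ → Matrix I I ℂ}
    (hF : ∀ k, PosMap (F k)) : PosMap (fun A => ∑ k ∈ s, F k A) where
  pos A hA := Matrix.posSemidef_sum _ fun k _ => (hF k).pos A hA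
  add A B hA hB := by simp_rw [(hF _).add A B hA hB, Finset.sum_add_distrib]
  smul c A hc hA := by simp_rw [(hF _).smul c A hc hA, Finset.smul_sum]

theorem PosMap.const_smul (hF : PosMap F) {a : ℝ} (ha : 0 ≤ a) : PosMap (fun A => (a : ℂ) • F A) where
  pos A hA := PSD.smul (hF.pos A hA) ha
  add A B hA hB := by rw [hF.add A B hA hB, smul_add]
  smul c A hc hA := by rw [hF.smul c A hc hA, smul_comm]

theorem PosMap.map_sum (hF : PosMap F) {κ : Type} (s : Finset κ) {A : κ → Matrix I I ℂ}
    (hA : ∀ k ∈ s, (A k).PosSemidef) : F (∑ k ∈ s, A k) = ∑ k ∈ s, F (A k) := by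
  classical
  induction s using Finset.induction_on with
  | empty => simpa using hF.map_zero
  | insert k s hk ih =>
    rw [Finset.sum_insert hk, Finset.sum_insert hk, hF.add _ _ (hA k (by simp))
      (Matrix.posSemidef_sum _ fun l hl => hA l (by simp [hl])), ih fun l hl => hA l (by simp [hl])]

theorem PosMap.map_sub (hF : PosMap F) {A B : Matrix I I ℂ} (hB : B.PosSemidef)
    (h : (A - B).PosSemidef) : F A - F B = F (A - B) := by
  have := hF.add (A - B) B h hB
  rw [sub_add_cancel] at this
  rw [this, add_sub_cancel_right]

theorem PosMap.mono (hF : PosMap F) {A B : Matrix I I ℂ} (hB : B.PosSemidef)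
    (h : (A - B).PosSemidef) : (F A - F B).PosSemidef := by
  rw [hF.map_sub hB h]
  exact hF.pos _ h

theorem LeMap.comp {F' G' : Matrix I I ℂ → Matrix I I ℂ} (hF : PosMap F) (hG' : PosMap G')
    (h : LeMap F F') (h' : LeMap G G') :
    LeMap (fun A => G (F A)) (fun A => G' (F' A)) := by
  intro A hA
  have h1 := hG'.mono (hF.pos A hA) (h A hA)
  have h2 := h' (F A) (hF.pos A hA)
  have := h1.add h2
  rwa [sub_add_sub_cancel] at this

theorem LeMap.iterate (hF : PosMap F) (hG : PosMap G) (h : LeMap F G) (n : ℕ) :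
    LeMap (F^[n]) (G^[n]) := by
  induction n with
  | zero => intro A _; simpa using Matrix.PosSemidef.zero
  | succ n ih =>
    rw [Function.iterate_succ', Function.iterate_succ']
    exact LeMap.comp (F := F^[n]) (F' := G^[n]) (hF.iterate n) hG ih h

/-! ### Loops -/

/-- `∑ₙ E₀ ∘ Tⁿ`, entrywise. -/
def loopMap (E₀ T : Matrix I I ℂ → Matrix I I ℂ) (A : Matrix I I ℂ) : Matrix I I ℂ :=
  fun x y => ∑' n : ℕ, E₀ (T^[n] A) x y

variable {E₀ E₁ T Q Q' : Matrix I I ℂ → Matrix I I ℂ}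

/-- Entries of a positive matrix are at most twice its trace, so summable exit probabilities give
convergence in each entry. -/
theorem hasSum_loopMap (h0 : PosMap E₀) (hT : PosMap T) {A : Matrix I I ℂ} (hA : A.PosSemidef)
    (hs : Summable fun n => rtr (E₀ (T^[n] A))) (x y : I) :
    HasSum (fun n => E₀ (T^[n] A) x y) (loopMap E₀ T A x y) := by
  refine Summable.hasSum (Summable.of_norm_bounded (hs.mul_left 2) fun n => ?_)
  exact PSD.norm_le_rtr (h0.pos _ ((hT.iterate n).pos A hA)) x y

theorem PosMap.loopMap (h0 : PosMap E₀) (hT : PosMap T)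
    (hs : ∀ A, A.PosSemidef → Summable fun n => rtr (E₀ (T^[n] A))) : PosMap (loopMap E₀ T) where
  pos A hA := posSemidef_of_hasSum (fun n => h0.pos _ ((hT.iterate n).pos A hA))
    (hasSum_loopMap h0 hT hA (hs A hA))
  add A B hA hB := by
    ext x y
    refine (hasSum_loopMap h0 hT (hA.add hB) (hs _ (hA.add hB)) x y).unique ?_
    have := (hasSum_loopMap h0 hT hA (hs A hA) x y).add (hasSum_loopMap h0 hT hB (hs B hB) x y)
    have e : (fun n => E₀ (T^[n] (A + B)) x y) =
        fun n => E₀ (T^[n] A) x y + E₀ (T^[n] B) x y := funext fun n => by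
      rw [(h0.comp (hT.iterate n)).add A B hA hB, Matrix.add_apply]
    rw [e]
    exact this
  smul c A hc hA := by
    ext x y
    refine (hasSum_loopMap h0 hT (PSD.smul hA hc) (hs _ (PSD.smul hA hc)) x y).unique ?_
    have := (hasSum_loopMap h0 hT hA (hs A hA) x y).mul_left (c : ℂ)
    have e : (fun n => E₀ (T^[n] ((c : ℂ) • A)) x y) =
        fun n => (c : ℂ) * E₀ (T^[n] A) x y := funext fun n => by
      rw [(h0.comp (hT.iterate n)).smul c A hc hA, Matrix.smul_apply, smul_eq_mul]
    rw [e]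
    exact this

theorem LeMap.loopMap {T' : Matrix I I ℂ → Matrix I I ℂ} (h0 : PosMap E₀) (hT : PosMap T)
    (hT' : PosMap T') (h : LeMap T T')
    (hs : ∀ A, A.PosSemidef → Summable fun n => rtr (E₀ (T^[n] A)))
    (hs' : ∀ A, A.PosSemidef → Summable fun n => rtr (E₀ (T'^[n] A))) :
    LeMap (QWhile.loopMap E₀ T) (QWhile.loopMap E₀ T') := by
  intro A hA
  refine posSemidef_of_hasSum (M := fun n => E₀ (T'^[n] A) - E₀ (T^[n] A)) (fun n => ?_) ?_
  · exact h0.mono ((hT.iterate n).pos A hA) (h.iterate hT hT' n A hA)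
  · intro x y
    exact (hasSum_loopMap h0 hT' hA (hs' A hA) x y).sub (hasSum_loopMap h0 hT hA (hs A hA) x y)

/-- A two-outcome measurement. -/
structure MeasPair (E₀ E₁ : Matrix I I ℂ → Matrix I I ℂ) : Prop where
  pos₀ : PosMap E₀
  pos₁ : PosMap E₁
  tr : ∀ A, A.PosSemidef → rtr (E₀ A) + rtr (E₁ A) = rtr A

/-- Conservation of mass: with a trace-preserving body, the input is divided between what has left
the loop and what is still inside. -/
theorem MeasPair.sum_rtr (hE : MeasPair E₀ E₁) (hQ : PosMap Q) (hTP : TP Q) {A : Matrix I I ℂ}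
    (hA : A.PosSemidef) (K : ℕ) :
    ∑ n ∈ Finset.range K, rtr (E₀ ((fun B => Q (E₁ B))^[n] A)) + rtr ((fun B => Q (E₁ B))^[K] A) =
      rtr A := by
  have hT : PosMap (fun B => Q (E₁ B)) := hQ.comp hE.pos₁
  induction K with
  | zero => simp
  | succ K ih =>
    have hp := (hT.iterate K).pos A hA
    rw [Finset.sum_range_succ, Function.iterate_succ_apply', hTP _ (hE.pos₁.pos _ hp)]
    have := hE.tr _ hp
    linarith

theorem MeasPair.summable (hE : MeasPair E₀ E₁) (hQ : PosMap Q) (hTP : TP Q) {A : Matrix I I ℂ}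
    (hA : A.PosSemidef) : Summable fun n => rtr (E₀ ((fun B => Q (E₁ B))^[n] A)) := by
  have hT : PosMap (fun B => Q (E₁ B)) := hQ.comp hE.pos₁
  refine summable_of_sum_range_le (c := rtr A) (fun n => ?_) fun K => ?_
  · exact rtr_nonneg (hE.pos₀.pos _ ((hT.iterate n).pos A hA))
  · have := hE.sum_rtr hQ hTP hA K
    have := rtr_nonneg ((hT.iterate K).pos A hA)
    linarith

/-- The exit probabilities exhaust the trace, so by conservation of mass nothing stays inside in the
limit. -/
theorem MeasPair.tendsto (hE : MeasPair E₀ E₁) (hQ : PosMap Q) (hTP : TP Q) {A : Matrix I I ℂ}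
    (hA : A.PosSemidef) (hl : rtr (QWhile.loopMap E₀ (fun B => Q (E₁ B)) A) = rtr A) :
    Filter.Tendsto (fun n => rtr ((fun B => Q (E₁ B))^[n] A)) Filter.atTop (nhds 0) := by
  have hT : PosMap (fun B => Q (E₁ B)) := hQ.comp hE.pos₁
  have h1 := (hasSum_rtr (hasSum_loopMap hE.pos₀ hT hA (hE.summable hQ hTP hA))).tendsto_sum_nat
  rw [hl] at h1
  have h2 := h1.const_sub (rtr A)
  rw [sub_self] at h2
  refine h2.congr fun K => ?_
  have := hE.sum_rtr hQ hTP hA K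
  linarith

/-- The probability of at least `n` iterations is the tail of the exit probabilities. -/
theorem MeasPair.rtr_iterate_le (hE : MeasPair E₀ E₁) (hQ : PosMap Q) (hTP : TP Q)
    {A : Matrix I I ℂ} (hA : A.PosSemidef)
    (hl : rtr (QWhile.loopMap E₀ (fun B => Q (E₁ B)) A) = rtr A) {u : ℕ → ℝ} (hu : Summable u)
    (h : ∀ n, rtr (E₀ ((fun B => Q (E₁ B))^[n] A)) ≤ u n * rtr A) (n : ℕ) :
    rtr ((fun B => Q (E₁ B))^[n] A) ≤ (∑' m, u (m + n)) * rtr A := by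
  have hs := hE.summable hQ hTP hA
  have hT : PosMap (fun B => Q (E₁ B)) := hQ.comp hE.pos₁
  have h1 := (hasSum_rtr (hasSum_loopMap hE.pos₀ hT hA hs)).tsum_eq
  have h2 := hs.sum_add_tsum_nat_add n
  have h3 := hE.sum_rtr hQ hTP hA n
  have h4 : rtr ((fun B => Q (E₁ B))^[n] A) =
      ∑' m, rtr (E₀ ((fun B => Q (E₁ B))^[m + n] A)) := by linarith
  rw [h4, ← tsum_mul_right]
  exact Summable.tsum_le_tsum (fun m => h (m + n)) ((summable_nat_add_iff n).2 hs)
    (((summable_nat_add_iff n).2 hu).mul_right _)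

/-- By domination the excess of the perturbed iterate over the original one is positive, so `hb`
applies to it. In each round the excess grows by a factor of at most `1 + η`, and the unperturbed
part contributes at most `η tr A` more. -/
theorem rtr_iterate_sub_le (hQ : PosMap Q) (hQ' : PosMap Q') (hle : LeMap Q Q') (hE : MeasPair E₀ E₁)
    (hTP : TP Q) {η : ℝ} (hη : 0 ≤ η)
    (hb : ∀ A, A.PosSemidef → rtr (Q' A) ≤ (1 + η) * rtr A) {A : Matrix I I ℂ} (hA : A.PosSemidef)
    (n : ℕ) : rtr ((fun B => Q' (E₁ B))^[n] A) - rtr ((fun B => Q (E₁ B))^[n] A) ≤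
      ((1 + η) ^ n - 1) * rtr A ∧ rtr ((fun B => Q (E₁ B))^[n] A) ≤ rtr A := by
  have hT : PosMap (fun B => Q (E₁ B)) := hQ.comp hE.pos₁
  have hT' : PosMap (fun B => Q' (E₁ B)) := hQ'.comp hE.pos₁
  have hE1 : LeMap E₁ E₁ := fun A _ => by rw [sub_self]; exact Matrix.PosSemidef.zero
  have hleT : LeMap (fun B => Q (E₁ B)) (fun B => Q' (E₁ B)) := LeMap.comp hE.pos₁ hQ' hE1 hle
  have hE1' : ∀ B : Matrix I I ℂ, B.PosSemidef → rtr (E₁ B) ≤ rtr B := fun B hB => by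
    have := hE.tr B hB
    have := rtr_nonneg (hE.pos₀.pos B hB)
    linarith
  have hbT : ∀ B : Matrix I I ℂ, B.PosSemidef → rtr (Q' (E₁ B)) ≤ (1 + η) * rtr B := fun B hB =>
    (hb _ (hE.pos₁.pos B hB)).trans (mul_le_mul_of_nonneg_left (hE1' B hB) (by linarith))
  induction n with
  | zero => simp
  | succ n ih =>
    set X := (fun B => Q (E₁ B))^[n] A with hX
    set Y := (fun B => Q' (E₁ B))^[n] A with hY
    have hXp : X.PosSemidef := (hT.iterate n).pos A hA
    have hD : (Y - X).PosSemidef := hleT.iterate hT hT' n A hA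
    rw [Function.iterate_succ_apply', Function.iterate_succ_apply', ← hX, ← hY]
    have h1 := hT'.map_sub hXp hD
    have h2 := hbT _ hD
    rw [← h1, rtr_sub, rtr_sub] at h2
    have h3 := hb _ (hE.pos₁.pos X hXp)
    have h4 := hE1' X hXp
    have h5 := hTP _ (hE.pos₁.pos X hXp)
    have h6 : η * rtr (E₁ X) ≤ η * rtr A := mul_le_mul_of_nonneg_left (h4.trans ih.2) hη
    have h7 := mul_le_mul_of_nonneg_left ih.1 (by linarith : (0 : ℝ) ≤ 1 + η)
    refine ⟨?_, by linarith [ih.2]⟩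
    rw [pow_succ]
    beta_reduce at *
    nlinarith

/-- Stability of a loop under a small perturbation of its body. -/
theorem loop_perturbation (hQ : PosMap Q) (hQ' : PosMap Q') (hle : LeMap Q Q')
    (hE : MeasPair E₀ E₁) (hTP : TP Q) {η δ : ℝ} (hη : 0 ≤ η) (hη1 : η ≤ 1)
    (hb : ∀ A, A.PosSemidef → rtr (Q' A) ≤ (1 + η) * rtr A) {n₀ : ℕ}
    (hn : ∀ A, A.PosSemidef → rtr ((fun B => Q (E₁ B))^[n₀] A) ≤ 1 / 4 * rtr A)
    (hη2 : (1 + η) ^ n₀ ≤ 5 / 4) (hδ : 5 / 2 * n₀ * η ≤ δ) {A : Matrix I I ℂ} (hA : A.PosSemidef) :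
    Summable (fun n => rtr ((fun B => Q' (E₁ B))^[n] A)) ∧
    (Summable fun n => rtr (E₀ ((fun B => Q' (E₁ B))^[n] A))) ∧
    ∑' n, rtr (E₀ ((fun B => Q' (E₁ B))^[n] A)) ≤ (1 + δ) * rtr A := by
  set T' := (fun B => Q' (E₁ B)) with hT'def
  have hT' : PosMap T' := hQ'.comp hE.pos₁
  set t : ℕ → ℝ := fun n => rtr (T'^[n] A) with ht
  have hp : ∀ n, (T'^[n] A).PosSemidef := fun n => (hT'.iterate n).pos A hA
  have ht0 : ∀ n, 0 ≤ t n := fun n => rtr_nonneg (hp n)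
  have hA0 := rtr_nonneg hA
  have hstep : ∀ n, t (n + n₀) ≤ 1 / 2 * t n := by
    intro n
    have h1 := (rtr_iterate_sub_le hQ hQ' hle hE hTP hη hb (hp n) n₀).1
    have h2 := hn _ (hp n)
    have h3 : ((1 + η) ^ n₀ - 1) * t n ≤ 1 / 4 * t n :=
      mul_le_mul_of_nonneg_right (by linarith) (ht0 n)
    have h4 : t (n + n₀) = rtr (T'^[n₀] (T'^[n] A)) := by
      simp only [ht]
      rw [add_comm, Function.iterate_add_apply]
    rw [h4]
    have h5 : rtr (T'^[n] A) = t n := rfl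
    rw [h5] at h1 h2
    linarith
  have hle1 : ∀ n, n < n₀ → t n ≤ 5 / 4 * rtr A := by
    intro n hnn
    have h1 := rtr_iterate_sub_le hQ hQ' hle hE hTP hη hb hA n
    have h2 : (1 + η) ^ n ≤ 5 / 4 := (pow_le_pow_right₀ (by linarith) hnn.le).trans hη2
    have h3 : ((1 + η) ^ n - 1) * rtr A ≤ 1 / 4 * rtr A :=
      mul_le_mul_of_nonneg_right (by linarith) hA0
    have : t n = rtr (T'^[n] A) := rfl
    linarith [h1.1, h1.2]
  -- The first `n₀` terms are at most `5/4 tr A` each and shifting by `n₀` halves the sum, so the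
  -- sum is at most twice `n₀ · 5/4 tr A`.
  have hS : ∀ K, ∑ n ∈ Finset.range K, t n ≤ 5 / 2 * n₀ * rtr A := by
    intro K
    have h1 : ∑ n ∈ Finset.range (n₀ + K), t n =
        ∑ n ∈ Finset.range n₀, t n + ∑ n ∈ Finset.range K, t (n₀ + n) :=
      Finset.sum_range_add _ _ _
    have h2 : ∑ n ∈ Finset.range n₀, t n ≤ n₀ * (5 / 4 * rtr A) := by
      have := Finset.sum_le_card_nsmul (Finset.range n₀) t (5 / 4 * rtr A)
        fun n hn' => hle1 n (Finset.mem_range.1 hn')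
      simpa using this
    have h3 : ∑ n ∈ Finset.range K, t (n₀ + n) ≤ 1 / 2 * ∑ n ∈ Finset.range K, t n := by
      rw [Finset.mul_sum]
      exact Finset.sum_le_sum fun n _ => by rw [add_comm]; exact hstep n
    have h4 : ∑ n ∈ Finset.range K, t n ≤ ∑ n ∈ Finset.range (n₀ + K), t n :=
      Finset.sum_le_sum_of_subset_of_nonneg (Finset.range_mono (by omega)) fun n _ _ => ht0 n
    linarith
  have hsum : Summable t := summable_of_sum_range_le ht0 hS
  -- Since `(1 - η)(1 + η) ≤ 1`, the growth bound on the body yields `(1 - η) t (n + 1) ≤ tr E₁(T'ⁿ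
  -- A)`.
  have hle2 : ∀ n, rtr (E₀ (T'^[n] A)) ≤ t n - (1 - η) * t (n + 1) := by
    intro n
    have h1 := hE.tr _ (hp n)
    have h2 := hb _ (hE.pos₁.pos _ (hp n))
    have h3 : t (n + 1) = rtr (Q' (E₁ (T'^[n] A))) := by
      simp only [ht, Function.iterate_succ_apply', hT'def]
    have h4 : rtr (T'^[n] A) = t n := rfl
    have h5 := mul_le_mul_of_nonneg_left h2 (by linarith : (0 : ℝ) ≤ 1 - η)
    have h6 := rtr_nonneg (hE.pos₁.pos _ (hp n))
    rw [h3]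
    nlinarith [mul_nonneg (mul_nonneg hη hη) h6]
  -- Telescoping leaves `tr A` plus `η` times the total time spent in the loop, and `hδ` bounds the
  -- latter contribution by `δ tr A`.
  have hbd : ∀ K, ∑ n ∈ Finset.range K, rtr (E₀ (T'^[n] A)) ≤ (1 + δ) * rtr A := by
    intro K
    have h1 : ∑ n ∈ Finset.range K, rtr (E₀ (T'^[n] A)) ≤
        ∑ n ∈ Finset.range K, ((t n - t (n + 1)) + η * t (n + 1)) :=
      Finset.sum_le_sum fun n _ => (hle2 n).trans (by linarith)
    rw [Finset.sum_add_distrib, Finset.sum_range_sub', ← Finset.mul_sum] at h1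
    have h2 := hS (K + 1)
    rw [Finset.sum_range_succ'] at h2
    have h3 : ∑ n ∈ Finset.range K, t (n + 1) ≤ 5 / 2 * n₀ * rtr A := by linarith [ht0 0]
    have h4 := mul_le_mul_of_nonneg_left h3 hη
    have h5 := mul_le_mul_of_nonneg_right hδ hA0
    have h6 : t 0 = rtr A := rfl
    have h7 := ht0 K
    nlinarith
  have hE0 : ∀ n, 0 ≤ rtr (E₀ (T'^[n] A)) := fun n => rtr_nonneg (hE.pos₀.pos _ (hp n))
  exact ⟨hsum, summable_of_sum_range_le hE0 hbd, Real.tsum_le_of_sum_range_le hE0 hbd⟩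

end PosMap

/-! ### Operations of a program as positive maps -/

section Basic

variable {S : QSystem} {ι : Type} {q : ι → S.Var}

theorem finite_rcfg [Finite (Cfg S)] (hq : Function.Injective q) : Finite (RCfg q) :=
  Finite.of_surjective (readReg q) fun w => ⟨setReg q (fun v => S.zero v) w, readReg_setReg hq _ w⟩

theorem regClosed_id (q : ι → S.Var) : RegClosed q (fun x : Cfg S => x) :=
  ⟨fun _ _ h => h, fun d w => ⟨setReg q d w, rfl⟩⟩

theorem isUnitary_iexp [Finite (RCfg q)] {A : Matrix (RCfg q) (RCfg q) ℂ} (hA : Aᴴ = -A) :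
    IsUnitary (iexp A) := by
  classical
  have := Fintype.ofFinite (RCfg q)
  have h1 : (iexp A)ᴴ = NormedSpace.exp (-A) := by
    rw [iexp_eq_exp, ← Matrix.exp_conjTranspose, hA]
  have h2 : IsUnit (NormedSpace.exp A).det := (Matrix.isUnit_iff_isUnit_det _).1 (Matrix.isUnit_exp A)
  unfold IsUnitary
  rw [imul_eq_mul, imul_eq_mul, iid_eq_one, h1, iexp_eq_exp, Matrix.exp_neg]
  exact ⟨Matrix.nonsing_inv_mul _ h2, Matrix.mul_nonsing_inv _ h2⟩

theorem isUnitary_rot [Finite (RCfg q)] {σ : Matrix (RCfg q) (RCfg q) ℂ} (hσ : IsDensity σ) (t : ℝ) :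
    IsUnitary (iexp ((-(Complex.I * (t : ℂ))) • σ)) := by
  refine isUnitary_iexp ?_
  rw [Matrix.conjTranspose_smul, hσ.1.1.eq, ← neg_smul]
  congr 1
  simp

variable [Fintype (Cfg S)]

theorem posMap_conj_lift (hq : Function.Injective q) (A : Matrix (RCfg q) (RCfg q) ℂ) :
    PosMap (conj (lift q A)) := by
  have := finite_rcfg hq
  have := Fintype.ofFinite (RCfg q)
  refine ⟨fun ρ hρ => conj_lift_posSemidef hq A hρ, fun ρ τ _ _ => ?_, fun c ρ _ _ => ?_⟩ <;>
    simp only [conj, imul_eq_mul]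
  · rw [mul_add, add_mul]
  · rw [Matrix.mul_smul, Matrix.smul_mul]

theorem sum_rtr_conj_lift {κ : Type} [Fintype κ] (hq : Function.Injective q)
    {A : κ → Matrix (RCfg q) (RCfg q) ℂ} (hA : ∑ k, imul (A k)ᴴ (A k) = iid (RCfg q))
    (ρ : Matrix (Cfg S) (Cfg S) ℂ) : ∑ k, rtr (conj (lift q (A k)) ρ) = rtr ρ := by
  classical
  have := finite_rcfg hq
  have := Fintype.ofFinite (RCfg q)
  simp_rw [imul_eq_mul, iid_eq_one] at hA
  simp_rw [rtr, ← Complex.re_sum, Matrix.trace, Matrix.diag]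
  rw [sum_conj_lift hq (regClosed_id q) A hA ρ]

theorem tp_conj_lift (hq : Function.Injective q) {U : Matrix (RCfg q) (RCfg q) ℂ}
    (hU : IsUnitary U) : TP (conj (lift q U)) := fun ρ _ => by
  simpa using sum_rtr_conj_lift (κ := Unit) hq (A := fun _ => U) (by simpa using hU.1) ρ

theorem measPair_conj_lift (hq : Function.Injective q) {M₀ M₁ : Matrix (RCfg q) (RCfg q) ℂ}
    (hM : imul M₀ᴴ M₀ + imul M₁ᴴ M₁ = iid (RCfg q)) :
    MeasPair (conj (lift q M₀)) (conj (lift q M₁)) := by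
  refine ⟨posMap_conj_lift hq M₀, posMap_conj_lift hq M₁, fun ρ _ => ?_⟩
  simpa using sum_rtr_conj_lift (κ := Fin 2) hq (A := ![M₀, M₁]) (by simpa using hM) ρ

theorem posMap_resetReg (hq : Function.Injective q) {σ : Matrix (RCfg q) (RCfg q) ℂ}
    (hσ : IsDensity σ) : PosMap (resetReg q σ) := by
  have := finite_rcfg hq
  have := Fintype.ofFinite (RCfg q)
  obtain ⟨B, rfl, -⟩ := exists_sqrt_of_isDensity hσ
  rw [funext (resetReg_eq_sum hq B)]
  exact PosMap.sum _ fun p => posMap_conj_lift hq _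

theorem tp_resetReg (hq : Function.Injective q) {σ : Matrix (RCfg q) (RCfg q) ℂ}
    (hσ : IsDensity σ) : TP (resetReg q σ) := fun ρ _ => by
  have := finite_rcfg hq
  have := Fintype.ofFinite (RCfg q)
  have := sum_resetReg hq (regClosed_id q) hσ ρ
  simp_rw [rtr, Matrix.trace, Matrix.diag]
  rw [this]

theorem posMap_resetVar (v : S.Var) : PosMap (resetVar v) := by
  rw [funext (resetVar_eq_resetReg v)]
  exact posMap_resetReg (fun _ _ _ => rfl) (isDensity_zero v)

theorem tp_resetVar (v : S.Var) : TP (resetVar v) := by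
  rw [funext (resetVar_eq_resetReg v)]
  exact tp_resetReg (fun _ _ _ => rfl) (isDensity_zero v)

end Basic

/-! ### Weighted semantics -/

namespace Prog

variable {S : QSystem} {k : ℕ}

/-- Structural induction on programs. -/
@[elab_as_elim]
theorem induction {motive : Prog S k → Prop} (P : Prog S k) (skip : motive skip)
    (init : ∀ q, motive (init q)) (initState : ∀ ι q σ, motive (initState ι q σ))
    (unitary : ∀ ι q U, motive (unitary ι q U)) (rot : ∀ j ι q σ, motive (rot j ι q σ))
    (seq : ∀ P₁ P₂, motive P₁ → motive P₂ → motive (seq P₁ P₂))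
    (ite : ∀ ι q m M P, (∀ i, motive (P i)) → motive (ite ι q m M P))
    (loop : ∀ ι q M₀ M₁ Q, motive Q → motive (.while ι q M₀ M₁ Q)) : motive P :=
  Prog.rec skip init initState unitary rot seq ite loop P

/-- The semantics in which every application of a rotation by the `i`-th parameter is weighted by
the factor `w i`. -/
def wsem (w : Fin k → ℝ) (θ : Fin k → ℝ) :
    Prog S k → Matrix (Cfg S) (Cfg S) ℂ → Matrix (Cfg S) (Cfg S) ℂ
  | skip => fun ρ => ρ
  | init q => resetVar q
  | initState _ q σ => resetReg q σ
  | unitary _ q U => conj (lift q U)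
  | rot j' _ q σ => fun ρ => (w j' : ℂ) •
      conj (lift q (iexp ((-(Complex.I * (θ j' : ℂ))) • σ))) ρ
  | seq P₁ P₂ => fun ρ => P₂.wsem w θ (P₁.wsem w θ ρ)
  | ite _ q _ M P => fun ρ => ∑ m, (P m).wsem w θ (conj (lift q (M m)) ρ)
  | .while _ q M₀ M₁ Q => fun ρ x y =>
      ∑' n : ℕ, conj (lift q M₀) ((fun τ => Q.wsem w θ (conj (lift q M₁) τ))^[n] ρ) x y

theorem wsem_one (θ : Fin k → ℝ) (P : Prog S k) : P.wsem 1 θ = P.sem θ := by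
  induction P using Prog.induction with
  | rot j' ι q σ => funext ρ; simp [wsem, sem]
  | seq P₁ P₂ h1 h2 => simp only [wsem, sem, h1, h2]
  | ite ι q m M P h => simp only [wsem, sem, h]
  | loop ι q M₀ M₁ Q h => simp only [wsem, sem, h]; rfl
  | _ => rfl

variable [Fintype (Cfg S)]

/-- The weighted semantics of the loops of a program are given by convergent series. -/
def Tame (w : Fin k → ℝ) (θ : Fin k → ℝ) : Prog S k → Prop
  | skip => True
  | init _ => True
  | initState _ _ _ => True
  | unitary _ _ _ => True
  | rot _ _ _ _ => True
  | seq P₁ P₂ => P₁.Tame w θ ∧ P₂.Tame w θ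
  | ite _ _ _ _ P => ∀ m, (P m).Tame w θ
  | .while _ q M₀ M₁ Q => (∀ Z : Matrix (Cfg S) (Cfg S) ℂ, Z.PosSemidef →
      (Summable fun n => rtr (conj (lift q M₀)
        ((fun τ => Q.wsem w θ (conj (lift q M₁) τ))^[n] Z))) ∧
      Filter.Tendsto (fun n => rtr ((fun τ => Q.wsem w θ (conj (lift q M₁) τ))^[n] Z))
        Filter.atTop (nhds 0)) ∧ Q.Tame w θ

theorem wsem_while (w : Fin k → ℝ) (θ : Fin k → ℝ) {ι : Type} (q : ι → S.Var)
    (M₀ M₁ : Matrix (RCfg q) (RCfg q) ℂ) (Q : Prog S k) :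
    (Prog.while ι q M₀ M₁ Q).wsem w θ =
      loopMap (conj (lift q M₀)) (fun τ => Q.wsem w θ (conj (lift q M₁) τ)) := rfl

theorem posMap_wsem {w : Fin k → ℝ} (hw : 0 ≤ w) {θ : Fin k → ℝ} {P : Prog S k}
    (hP : P.WellFormed) (hT : P.Tame w θ) : PosMap (P.wsem w θ) := by
  induction P using Prog.induction with
  | skip => exact PosMap.id
  | init q => exact posMap_resetVar q
  | initState ι q σ => exact posMap_resetReg hP.1 hP.2
  | unitary ι q U => exact posMap_conj_lift hP.1 U
  | rot j' ι q σ =>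
    exact (posMap_conj_lift hP.1 _).const_smul (hw j')
  | seq P₁ P₂ h1 h2 => exact (h2 hP.2 hT.2).comp (h1 hP.1 hT.1)
  | ite ι q m M P h =>
    exact PosMap.sum _ fun i => (h i (hP.2.2 i) (hT i)).comp (posMap_conj_lift hP.1 _)
  | loop ι q M₀ M₁ Q h =>
    have hE := measPair_conj_lift hP.1 hP.2.1
    exact PosMap.loopMap hE.pos₀ ((h hP.2.2 hT.2).comp hE.pos₁) fun Z hZ => (hT.1 Z hZ).1

/-- A weight of at least `1` enlarges a positive map, and all constructors are monotone for `LeMap`.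
This exhibits the weighted body of a loop as an upper perturbation of the trace-preserving one. -/
theorem leMap_wsem {w : Fin k → ℝ} (hw : 1 ≤ w) {θ : Fin k → ℝ} {P : Prog S k}
    (hP : P.WellFormed) (hT1 : P.Tame 1 θ) (hT : P.Tame w θ) :
    LeMap (P.wsem 1 θ) (P.wsem w θ) := by
  have hid : ∀ F : Matrix (Cfg S) (Cfg S) ℂ → Matrix (Cfg S) (Cfg S) ℂ, LeMap F F := fun F A _ => by
    rw [sub_self]; exact Matrix.PosSemidef.zero
  have h0 : 0 ≤ w := zero_le_one.trans hw
  induction P using Prog.induction with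
  | rot j' ι q σ =>
    intro A hA
    simp only [wsem]
    rw [← sub_smul, ← Complex.ofReal_sub]
    refine PSD.smul ((posMap_conj_lift hP.1 _).pos A hA) (sub_nonneg.2 (hw j'))
  | seq P₁ P₂ h1 h2 =>
    exact LeMap.comp (F := P₁.wsem 1 θ) (F' := P₁.wsem w θ) (G := P₂.wsem 1 θ)
      (G' := P₂.wsem w θ) (posMap_wsem zero_le_one hP.1 hT1.1) (posMap_wsem h0 hP.2 hT.2)
      (h1 hP.1 hT1.1 hT.1) (h2 hP.2 hT1.2 hT.2)
  | ite ι q m M P h =>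
    intro A hA
    simp only [wsem]
    rw [← Finset.sum_sub_distrib]
    exact Matrix.posSemidef_sum _ fun i _ =>
      h i (hP.2.2 i) (hT1 i) (hT i) _ ((posMap_conj_lift hP.1 _).pos A hA)
  | loop ι q M₀ M₁ Q h =>
    have hE := measPair_conj_lift hP.1 hP.2.1
    have hp1 := (posMap_wsem zero_le_one hP.2.2 hT1.2).comp hE.pos₁
    have hp := (posMap_wsem h0 hP.2.2 hT.2).comp hE.pos₁
    exact LeMap.loopMap hE.pos₀ hp1 hp
      (LeMap.comp hE.pos₁ (posMap_wsem h0 hP.2.2 hT.2) (hid _) (h hP.2.2 hT1.2 hT.2))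
      (fun Z hZ => (hT1.1 Z hZ).1) (fun Z hZ => (hT.1 Z hZ).1)
  | _ => exact hid _

theorem itrace_eq_trace {I : Type} [Fintype I] (A : Matrix I I ℂ) : itrace A = A.trace := by
  rw [itrace, tsum_fintype, Matrix.trace]
  rfl

/-- The summand `1` avoids division by a vanishing trace. By homogeneity, hypotheses about partial
density operators extend to all positive matrices. -/
theorem isPartialDensity_smul {I : Type} [Fintype I] {A : Matrix I I ℂ} (hA : A.PosSemidef) :
    IsPartialDensity ((((rtr A + 1)⁻¹ : ℝ) : ℂ) • A) := by
  have h0 := rtr_nonneg hA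
  refine ⟨PSD.smul hA (by positivity), (hasSum_fintype _).summable, ?_⟩
  rw [itrace_eq_trace]
  change rtr _ ≤ 1
  rw [rtr_smul, inv_mul_le_one₀ (by linarith)]
  linarith

/-- Both claims must be proved together: a trace-preserving body makes the exit series converge, and
only then does almost sure termination give trace preservation of the loop and the decay of the mass
inside. -/
theorem tame_one {θ : Fin k → ℝ} {P : Prog S k}
    (hP : P.WellFormed) (hT : P.LoopsTerminateAS θ) :
    P.Tame 1 θ ∧ TP (P.wsem 1 θ) := by
  induction P using Prog.induction with
  | skip => exact ⟨trivial, fun _ _ => rfl⟩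
  | init q => exact ⟨trivial, tp_resetVar q⟩
  | initState ι q σ => exact ⟨trivial, tp_resetReg hP.1 hP.2⟩
  | unitary ι q U => exact ⟨trivial, tp_conj_lift hP.1 hP.2⟩
  | rot j' ι q σ =>
    have := finite_rcfg hP.1
    refine ⟨trivial, fun A hA => ?_⟩
    have := tp_conj_lift hP.1 (isUnitary_rot hP.2 (θ j')) A hA
    simpa [wsem] using this
  | seq P₁ P₂ h1 h2 =>
    have h1 := h1 hP.1 hT.1
    have h2 := h2 hP.2 hT.2
    refine ⟨⟨h1.1, h2.1⟩, fun A hA => ?_⟩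
    exact (h2.2 _ ((posMap_wsem zero_le_one hP.1 h1.1).pos A hA)).trans (h1.2 A hA)
  | ite ι q m M P h =>
    have h := fun i => h i (hP.2.2 i) (hT i)
    refine ⟨fun i => (h i).1, fun A hA => ?_⟩
    simp only [wsem]
    rw [rtr_sum, ← sum_rtr_conj_lift hP.1 hP.2.1 A]
    exact Finset.sum_congr rfl fun i _ => (h i).2 _ ((posMap_conj_lift hP.1 _).pos A hA)
  | loop ι q M₀ M₁ Q h =>
    have h := h hP.2.2 hT.2
    have hE := measPair_conj_lift hP.1 hP.2.1
    have hQ := posMap_wsem zero_le_one hP.2.2 h.1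
    have hs := fun A hA => hE.summable hQ h.2 (A := A) hA
    have hl := PosMap.loopMap hE.pos₀ (hQ.comp hE.pos₁) hs
    have htp : TP ((Prog.while ι q M₀ M₁ Q).wsem 1 θ) := by
      intro A hA
      have h0 := rtr_nonneg hA
      have h1 := hT.1 _ (isPartialDensity_smul hA)
      rw [← wsem_one, itrace_eq_trace, itrace_eq_trace, wsem_while,
        hl.smul _ A (by positivity) hA, Matrix.trace_smul, Matrix.trace_smul] at h1
      have h2 : (((rtr A + 1)⁻¹ : ℝ) : ℂ) ≠ 0 := by
        exact_mod_cast (by positivity : (rtr A + 1)⁻¹ ≠ 0)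
      exact congrArg Complex.re (smul_right_injective ℂ h2 h1)
    exact ⟨⟨fun Z hZ => ⟨hs Z hZ, hE.tendsto hQ h.2 hZ (htp Z hZ)⟩, h.1⟩, htp⟩

theorem loopsDecay_wsem {θ : Fin k → ℝ} {ι : Type} {q : ι → S.Var}
    {M₀ M₁ : Matrix (RCfg q) (RCfg q) ℂ} {Q : Prog S k} {ε : ℝ} {N : ℕ}
    (hP : (Prog.while ι q M₀ M₁ Q).WellFormed) (hQ : PosMap (Q.wsem 1 θ))
    (hD : (Prog.while ι q M₀ M₁ Q).LoopsDecay θ ε N) (n : ℕ) (A : Matrix (Cfg S) (Cfg S) ℂ)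
    (hA : A.PosSemidef) :
    rtr (conj (lift q M₀) ((fun τ => Q.wsem 1 θ (conj (lift q M₁) τ))^[n] A)) ≤
      ε ^ (n / N) * rtr A := by
  have hE := measPair_conj_lift hP.1 hP.2.1
  have hmap := hE.pos₀.comp ((hQ.comp hE.pos₁).iterate n)
  have h0 := rtr_nonneg hA
  have h1 := hD.1 n _ (isPartialDensity_smul hA)
  rw [← wsem_one, itrace_eq_trace, itrace_eq_trace, hmap.smul _ A (by positivity) hA] at h1
  change rtr _ ≤ _ * rtr _ at h1
  rw [rtr_smul, rtr_smul, mul_left_comm] at h1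
  exact le_of_mul_le_mul_left h1 (by positivity)

end Prog

/-! ### Choice of constants and the uniform bound on the weighted trace -/

theorem summable_pow_div {ε : ℝ} (hε : 0 < ε) (hε1 : ε < 1) {N : ℕ} (hN : 1 ≤ N) :
    Summable fun n : ℕ => ε ^ (n / N) := by
  have hN0 : (0 : ℝ) < N := by exact_mod_cast hN
  have hr : ε ^ ((1 : ℝ) / N) < 1 := Real.rpow_lt_one hε.le hε1 (by positivity)
  refine Summable.of_nonneg_of_le (fun n => by positivity) (fun n => ?_)
    ((summable_geometric_of_lt_one (by positivity) hr).mul_left ε⁻¹)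
  -- Rounding down costs at most one, `⌊n / N⌋ ≥ n / N - 1`; this is the factor `ε⁻¹` in front of
  -- the geometric series of ratio `ε^(1/N)`.
  rw [← Real.rpow_natCast, ← Real.rpow_natCast, ← Real.rpow_mul hε.le, ← Real.rpow_neg_one ε,
    ← Real.rpow_add hε]
  refine Real.rpow_le_rpow_of_exponent_ge hε hε1.le ?_
  have := Nat.lt_div_mul_add (a := n) (b := N) (by omega)
  have h2 : (n : ℝ) < (n / N : ℕ) * N + N := by exact_mod_cast this
  have h3 : (n : ℝ) / N < (n / N : ℕ) + 1 := by
    rw [div_lt_iff₀ hN0]; linarith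
  have : -1 + 1 / (N : ℝ) * n = n / N - 1 := by ring
  linarith

theorem exists_tail_le (ε : ℝ) (N : ℕ) :
    ∃ n₀ : ℕ, 1 ≤ n₀ ∧ ∑' m : ℕ, ε ^ ((m + n₀) / N) ≤ 1 / 4 := by
  have h := tendsto_sum_nat_add fun n : ℕ => ε ^ (n / N)
  have := (h.eventually (ge_mem_nhds (by norm_num : (0 : ℝ) < 1 / 4))).and
    (Filter.eventually_ge_atTop 1)
  obtain ⟨n, h1, h2⟩ := this.exists
  exact ⟨n, h2, h1⟩

/-- The smallness that `loop_perturbation` demands: `η ≤ 1 / (8 n₀)` bounds the power by `exp (1/8)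
≤ 8/7`, and `η ≤ δ / (3 n₀)` bounds the last product by `5/6 δ`. -/
theorem exists_small {δ : ℝ} (hδ : 0 < δ) {n₀ : ℕ} (hn : 1 ≤ n₀) :
    ∃ η : ℝ, 0 < η ∧ η ≤ 1 ∧ (1 + η) ^ n₀ ≤ 5 / 4 ∧ 5 / 2 * n₀ * η ≤ δ := by
  have hn0 : (1 : ℝ) ≤ n₀ := by exact_mod_cast hn
  have hn0' : (0 : ℝ) < n₀ := by linarith
  refine ⟨min (δ / (3 * n₀)) (1 / (8 * n₀)), by positivity, ?_, ?_, ?_⟩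
  · refine (min_le_right _ _).trans ?_
    rw [div_le_one (by positivity)]
    linarith
  · set η := min (δ / (3 * n₀)) (1 / (8 * n₀)) with hη
    have hη0 : 0 < η := by positivity
    have h1 : n₀ * η ≤ 1 / 8 := by
      calc n₀ * η ≤ n₀ * (1 / (8 * n₀)) := mul_le_mul_of_nonneg_left (min_le_right _ _) hn0'.le
        _ = 1 / 8 := by field_simp
    calc (1 + η) ^ n₀ ≤ Real.exp η ^ n₀ := by
          refine pow_le_pow_left₀ (by positivity) ?_ _
          rw [add_comm]; exact Real.add_one_le_exp η
      _ = Real.exp (n₀ * η) := (Real.exp_nat_mul _ _).symm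
      _ ≤ Real.exp (1 / 8) := Real.exp_le_exp.2 h1
      _ ≤ 1 / (1 - 1 / 8) := Real.exp_bound_div_one_sub_of_interval (by norm_num) (by norm_num)
      _ ≤ 5 / 4 := by norm_num
  · calc 5 / 2 * n₀ * min (δ / (3 * n₀)) (1 / (8 * n₀)) ≤ 5 / 2 * n₀ * (δ / (3 * n₀)) :=
          mul_le_mul_of_nonneg_left (min_le_left _ _) (by positivity)
      _ = 5 / 6 * δ := by field_simp; ring
      _ ≤ δ := by linarith

theorem exists_pow_le {a : ℝ} (ha : 0 < a) (m : ℕ) : ∃ δ : ℝ, 0 < δ ∧ (1 + δ) ^ m ≤ 1 + a := by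
  have hl : 0 < Real.log (1 + a) := Real.log_pos (by linarith)
  refine ⟨Real.log (1 + a) / (m + 1), by positivity, ?_⟩
  have h1 : (m : ℝ) * (Real.log (1 + a) / (m + 1)) ≤ Real.log (1 + a) := by
    rw [mul_div_assoc', div_le_iff₀ (by positivity)]
    nlinarith
  calc (1 + Real.log (1 + a) / (m + 1)) ^ m ≤ Real.exp (Real.log (1 + a) / (m + 1)) ^ m := by
        refine pow_le_pow_left₀ (by positivity) ?_ _
        rw [add_comm]; exact Real.add_one_le_exp _
    _ = Real.exp (m * (Real.log (1 + a) / (m + 1))) := (Real.exp_nat_mul _ _).symm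
    _ ≤ Real.exp (Real.log (1 + a)) := Real.exp_le_exp.2 h1
    _ = 1 + a := Real.exp_log (by linarith)

/-- The weight `ζ` for the `j`-th parameter, and `1` for the others. -/
def weight {k : ℕ} (j : Fin k) (ζ : ℝ) : Fin k → ℝ := fun i => if i = j then ζ else 1

theorem one_le_weight {k : ℕ} (j : Fin k) {ζ : ℝ} (hζ : 1 ≤ ζ) : 1 ≤ weight j ζ := by
  intro i
  simp only [weight, Pi.one_apply]
  split_ifs <;> linarith

open Prog in
theorem wsem_bound_of_loops {S : QSystem} [Fintype (Cfg S)] {k : ℕ} {θ : Fin k → ℝ} {j : Fin k}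
    {ζ l δ ε : ℝ} {m N : ℕ} (hδ : 0 < δ) (hζ : 1 ≤ ζ)
    (hloop : ∀ (ι : Type) (q : ι → S.Var) (M₀ M₁ : Matrix (RCfg q) (RCfg q) ℂ) (Q : Prog S k),
      (Prog.while ι q M₀ M₁ Q).WellFormed → (Prog.while ι q M₀ M₁ Q).LoopsTerminateAS θ →
      (Prog.while ι q M₀ M₁ Q).LoopsDecay θ ε N → Q.LC + 1 ≤ m → ζ ^ Q.RC j ≤ 1 + l →
      (Prog.while ι q M₀ M₁ Q).Tame (weight j ζ) θ ∧ ∀ Z : Matrix (Cfg S) (Cfg S) ℂ, Z.PosSemidef →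
        rtr ((Prog.while ι q M₀ M₁ Q).wsem (weight j ζ) θ Z) ≤ (1 + δ) * rtr Z)
    (P : Prog S k) (hP : P.WellFormed) (hT : P.LoopsTerminateAS θ) (hD : P.LoopsDecay θ ε N)
    (hm : P.LC ≤ m) (hl : P.LC ≠ 0 → ζ ^ P.RC j ≤ 1 + l) :
    P.Tame (weight j ζ) θ ∧ ∀ Z : Matrix (Cfg S) (Cfg S) ℂ, Z.PosSemidef →
        rtr (P.wsem (weight j ζ) θ Z) ≤ ζ ^ P.RC j * (1 + δ) ^ P.LC * rtr Z := by
  have h0 : 0 ≤ weight j ζ := zero_le_one.trans (one_le_weight j hζ)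
  have h0' : 0 ≤ ζ := by linarith
  induction P using Prog.induction with
  | skip => exact ⟨trivial, fun Z _ => by simp [RC, LC, wsem]⟩
  | init q => exact ⟨trivial, fun Z hZ => by simpa [RC, LC, wsem] using (tp_resetVar q Z hZ).le⟩
  | initState ι q σ =>
    exact ⟨trivial, fun Z hZ => by simpa [RC, LC, wsem] using (tp_resetReg hP.1 hP.2 Z hZ).le⟩
  | unitary ι q U =>
    exact ⟨trivial, fun Z hZ => by simpa [RC, LC, wsem] using (tp_conj_lift hP.1 hP.2 Z hZ).le⟩
  | rot j' ι q σ =>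
    have := finite_rcfg hP.1
    refine ⟨trivial, fun Z hZ => ?_⟩
    simp only [wsem, RC, LC]
    rw [rtr_smul, tp_conj_lift hP.1 (isUnitary_rot hP.2 (θ j')) Z hZ]
    refine le_of_eq ?_
    simp only [weight]
    split_ifs <;> simp
  | seq P₁ P₂ h1 h2 =>
    simp only [LC, RC] at hm hl ⊢
    have hle1 : ζ ^ P₁.RC j ≤ ζ ^ (P₁.RC j + P₂.RC j) := pow_le_pow_right₀ hζ (by omega)
    have hle2 : ζ ^ P₂.RC j ≤ ζ ^ (P₁.RC j + P₂.RC j) := pow_le_pow_right₀ hζ (by omega)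
    have h1 := h1 hP.1 hT.1 hD.1 (by omega) fun h => hle1.trans (hl (by omega))
    have h2 := h2 hP.2 hT.2 hD.2 (by omega) fun h => hle2.trans (hl (by omega))
    refine ⟨⟨h1.1, h2.1⟩, fun Z hZ => ?_⟩
    have h3 := h2.2 _ ((posMap_wsem h0 hP.1 h1.1).pos Z hZ)
    refine h3.trans ?_
    calc ζ ^ P₂.RC j * (1 + δ) ^ P₂.LC * rtr (P₁.wsem (weight j ζ) θ Z)
        ≤ ζ ^ P₂.RC j * (1 + δ) ^ P₂.LC * (ζ ^ P₁.RC j * (1 + δ) ^ P₁.LC * rtr Z) :=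
          mul_le_mul_of_nonneg_left (h1.2 Z hZ) (by positivity)
      _ = ζ ^ (P₁.RC j + P₂.RC j) * (1 + δ) ^ (P₁.LC + P₂.LC) * rtr Z := by
          rw [pow_add, pow_add]; ring
  | ite ι q n M P h =>
    simp only [LC, RC] at hm hl ⊢
    have hr : ∀ i, (P i).RC j ≤ Finset.univ.sup fun i => (P i).RC j := fun i =>
      Finset.le_sup (f := fun i => (P i).RC j) (Finset.mem_univ i)
    have hc : ∀ i, (P i).LC ≤ ∑ i, (P i).LC := fun i =>
      Finset.single_le_sum (f := fun i => (P i).LC) (fun _ _ => Nat.zero_le _) (Finset.mem_univ i)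
    have hle : ∀ i, ζ ^ (P i).RC j ≤ ζ ^ (Finset.univ.sup fun i => (P i).RC j) := fun i =>
      pow_le_pow_right₀ hζ (hr i)
    have h := fun i => h i (hP.2.2 i) (hT i) (hD i) ((hc i).trans hm) fun h =>
      (hle i).trans (hl (by have := hc i; omega))
    refine ⟨fun i => (h i).1, fun Z hZ => ?_⟩
    simp only [wsem]
    rw [rtr_sum, ← sum_rtr_conj_lift hP.1 hP.2.1 Z, Finset.mul_sum]
    refine Finset.sum_le_sum fun i _ => ?_
    have hp := (posMap_conj_lift hP.1 (M i)).pos Z hZ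
    refine ((h i).2 _ hp).trans (mul_le_mul_of_nonneg_right ?_ (rtr_nonneg hp))
    exact mul_le_mul (hle i) (pow_le_pow_right₀ (by linarith) (hc i)) (by positivity) (by positivity)
  | loop ι q M₀ M₁ Q h =>
    have h := hloop ι q M₀ M₁ Q hP hT hD hm (hl (by simp [LC]))
    refine ⟨h.1, fun Z hZ => (h.2 Z hZ).trans (mul_le_mul_of_nonneg_right ?_ (rtr_nonneg hZ))⟩
    have h1 : (1 : ℝ) ≤ ζ ^ Q.RC j := one_le_pow₀ hζ
    have h2 : 1 + δ ≤ (1 + δ) ^ (Q.LC + 1) := by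
      simpa using pow_le_pow_right₀ (by linarith : 1 ≤ 1 + δ) (Nat.succ_le_succ (Nat.zero_le Q.LC))
    simp only [LC, RC]
    nlinarith

open Prog in
/-- The weighted semantics is almost trace-preserving when the weight is close to `1`, uniformly
in all programs with a bounded number of loops that decay at a given rate. -/
theorem exists_wsem_bound {ε : ℝ} (hε : 0 < ε) (hε1 : ε < 1) {N : ℕ} (hN : 1 ≤ N) (m : ℕ) :
    ∀ δ : ℝ, 0 < δ → ∃ l : ℝ, 0 < l ∧ ∀ (S : QSystem) [Fintype (Cfg S)] (k : ℕ) (P : Prog S k)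
      (θ : Fin k → ℝ) (j : Fin k) (ζ : ℝ), P.WellFormed → P.LoopsTerminateAS θ →
      P.LoopsDecay θ ε N → P.LC ≤ m → 1 ≤ ζ → (P.LC ≠ 0 → ζ ^ P.RC j ≤ 1 + l) →
      P.Tame (weight j ζ) θ ∧ ∀ Z : Matrix (Cfg S) (Cfg S) ℂ, Z.PosSemidef →
        rtr (P.wsem (weight j ζ) θ Z) ≤ ζ ^ P.RC j * (1 + δ) ^ P.LC * rtr Z := by
  induction m with
  | zero =>
    intro δ hδ
    refine ⟨1, one_pos, fun S _ k P θ j ζ hP hT hD hm hζ hl => ?_⟩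
    exact wsem_bound_of_loops hδ hζ (fun _ _ _ _ _ _ _ _ h => by omega) P hP hT hD hm hl
  | succ m ihm =>
    intro δ hδ
    -- The constants are chosen from the outside in: `n₀` from the decay rate, `η` from `n₀` and
    -- `δ`, and the tolerance `δ'` for the at most `m` loops of the body from `η`. None of them
    -- depends on the program, whence the uniformity.
    obtain ⟨n₀, hn₀, htail⟩ := exists_tail_le ε N
    obtain ⟨η, hη, hη1, hη2, hη3⟩ := exists_small hδ hn₀
    obtain ⟨δ', hδ', hpow⟩ := exists_pow_le (a := η / 3) (by positivity) m
    obtain ⟨l', hl', H⟩ := ihm δ' hδ'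
    refine ⟨min l' (η / 3), by positivity, fun S _ k P θ j ζ hP hT hD hm hζ hl => ?_⟩
    refine wsem_bound_of_loops hδ hζ ?_ P hP hT hD hm hl
    intro ι q M₀ M₁ Q hP hT hD hm hl
    have h0 : 0 ≤ weight j ζ := zero_le_one.trans (one_le_weight j hζ)
    have h0' : 0 ≤ ζ := by linarith
    have hQ := H S k Q θ j ζ hP.2.2 hT.2 hD.2 (by omega) hζ fun _ =>
      hl.trans (by linarith [min_le_left l' (η / 3)])
    have hQ1 := tame_one hP.2.2 hT.2
    have hW1 := tame_one hP hT
    have hp1 := posMap_wsem zero_le_one hP.2.2 hQ1.1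
    have hE := measPair_conj_lift hP.1 hP.2.1
    have hb : ∀ A : Matrix (Cfg S) (Cfg S) ℂ, A.PosSemidef →
        rtr (Q.wsem (weight j ζ) θ A) ≤ (1 + η) * rtr A := by
      intro A hA
      refine (hQ.2 A hA).trans (mul_le_mul_of_nonneg_right ?_ (rtr_nonneg hA))
      calc ζ ^ Q.RC j * (1 + δ') ^ Q.LC ≤ (1 + η / 3) * (1 + η / 3) := by
            refine mul_le_mul (hl.trans (by linarith [min_le_right l' (η / 3)])) ?_
              (by positivity) (by positivity)
            exact (pow_le_pow_right₀ (by linarith) (by omega)).trans hpow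
        -- One factor `1 + η / 3` pays for the rotations in the body, the other for its inner loops;
        -- `η ≤ 1` absorbs the quadratic term.
        _ ≤ 1 + η := by nlinarith
    have hn : ∀ A : Matrix (Cfg S) (Cfg S) ℂ, A.PosSemidef →
        rtr ((fun B => Q.wsem 1 θ (conj (lift q M₁) B))^[n₀] A) ≤ 1 / 4 * rtr A := fun A hA =>
      (hE.rtr_iterate_le hp1 hQ1.2 hA (hW1.2 A hA) (summable_pow_div hε hε1 hN)
        (fun n => loopsDecay_wsem hP hp1 hD n A hA) n₀).trans
        (mul_le_mul_of_nonneg_right htail (rtr_nonneg hA))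
    have hp := posMap_wsem h0 hP.2.2 hQ.1
    have key := fun (A : Matrix (Cfg S) (Cfg S) ℂ) (hA : A.PosSemidef) =>
      loop_perturbation hp1 hp (leMap_wsem (one_le_weight j hζ) hP.2.2 hQ1.1 hQ.1) hE hQ1.2
        hη.le hη1 hb hn hη2 hη3 hA
    refine ⟨⟨fun Z hZ => ⟨(key Z hZ).2.1, (key Z hZ).1.tendsto_atTop_zero⟩, hQ.1⟩, fun Z hZ => ?_⟩
    have h1 := hasSum_rtr (hasSum_loopMap hE.pos₀ (hp.comp hE.pos₁) hZ (key Z hZ).2.1)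
    rw [wsem_while, ← h1.tsum_eq]
    exact (key Z hZ).2.2

/-! ### Exponential decay of almost surely terminating loops -/

/-- Entries are at most `2 tr A`, and Cauchy–Schwarz turns `(∑ ‖x i‖)²` into `card I · ∑ ‖x i‖²`.
The constant is not sharp, but any multiple of `tr A` reduces uniform decay to a single input, the
identity. -/
theorem card_smul_one_sub_posSemidef {I : Type} [Fintype I] [DecidableEq I] {A : Matrix I I ℂ}
    (hA : A.PosSemidef) :
    (((2 * Fintype.card I * rtr A : ℝ) : ℂ) • (1 : Matrix I I ℂ) - A).PosSemidef := by
  obtain ⟨c, hc⟩ : ∃ c : ℝ, c = 2 * Fintype.card I * rtr A := ⟨_, rfl⟩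
  rw [← hc]
  have h1 : ((c : ℂ) • (1 : Matrix I I ℂ)).IsHermitian := by
    rw [Matrix.IsHermitian, Matrix.conjTranspose_smul, Matrix.conjTranspose_one]
    simp
  refine Matrix.PosSemidef.of_dotProduct_mulVec_nonneg (h1.sub hA.1) fun x => ?_
  have h2 := Complex.le_def.1 (hA.dotProduct_mulVec_nonneg x)
  set z := star x ⬝ᵥ A *ᵥ x with hz
  have h3 : star x ⬝ᵥ ((c : ℂ) • (1 : Matrix I I ℂ) - A) *ᵥ x =
      ((c * ∑ i, ‖x i‖ ^ 2 - z.re : ℝ) : ℂ) := by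
    have hzr : z = (z.re : ℂ) := Complex.ext (by simp) (by simpa using h2.2.symm)
    rw [Matrix.sub_mulVec, dotProduct_sub, ← hz, Matrix.smul_mulVec, Matrix.one_mulVec,
      dotProduct_smul, Complex.ofReal_sub, ← hzr, dotProduct, smul_eq_mul]
    congr 1
    rw [Complex.ofReal_mul c, Complex.ofReal_sum]
    congr 1
    refine Finset.sum_congr rfl fun i _ => ?_
    rw [Pi.star_apply, Complex.star_def, Complex.conj_mul', Complex.ofReal_pow]
  rw [h3, Complex.zero_le_real, sub_nonneg]
  have h4 : ‖z‖ ≤ 2 * rtr A * (∑ i, ‖x i‖) ^ 2 := by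
    rw [hz, dotProduct]
    refine (norm_sum_le _ _).trans ?_
    rw [pow_two, ← mul_assoc, mul_comm, Finset.sum_mul]
    refine Finset.sum_le_sum fun i _ => ?_
    rw [norm_mul, Pi.star_apply, norm_star, mul_comm (2 * rtr A)]
    refine mul_le_mul_of_nonneg_left ?_ (norm_nonneg _)
    rw [Matrix.mulVec, dotProduct, Finset.sum_mul]
    refine (norm_sum_le _ _).trans (Finset.sum_le_sum fun l _ => ?_)
    rw [norm_mul, mul_comm]
    exact mul_le_mul_of_nonneg_left (PSD.norm_le_rtr hA i l) (norm_nonneg _)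
  have h5 := sq_sum_le_card_mul_sum_sq (s := Finset.univ) (f := fun i => ‖x i‖)
  have h6 := mul_le_mul_of_nonneg_left h5 (by linarith [rtr_nonneg hA] : 0 ≤ 2 * rtr A)
  have h7 := Complex.re_le_norm z
  calc z.re ≤ 2 * rtr A * ((Finset.univ : Finset I).card * ∑ i, ‖x i‖ ^ 2) := by linarith
    _ = c * ∑ i, ‖x i‖ ^ 2 := by rw [hc, Finset.card_univ]; ring

namespace Prog

theorem LoopsDecay.mono {S : QSystem} [Fintype (Cfg S)] {k : ℕ} {θ : Fin k → ℝ} {P : Prog S k}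
    {ε : ℝ} (hε : 0 < ε) (hε1 : ε < 1) {N N' : ℕ} (hN : 1 ≤ N) (hNN : N ≤ N')
    (h : P.LoopsDecay θ ε N) : P.LoopsDecay θ ε N' := by
  induction P using Prog.induction with
  | seq P₁ P₂ h1 h2 => exact ⟨h1 h.1, h2 h.2⟩
  | ite ι q m M P ih => exact fun i => ih i (h i)
  | loop ι q M₀ M₁ Q ih =>
    refine ⟨fun n ρ hρ => (h.1 n ρ hρ).trans (mul_le_mul_of_nonneg_right ?_ ?_), ih h.2⟩
    · exact pow_le_pow_of_le_one hε.le hε1.le (Nat.div_le_div_left hNN hN)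
    · rw [itrace_eq_trace]
      exact rtr_nonneg hρ.1
  | _ => trivial

/-- Almost surely terminating loops on a finite-dimensional space decay exponentially. -/
theorem exists_loopsDecay {S : QSystem} [Fintype (Cfg S)] {k : ℕ} {θ : Fin k → ℝ} {P : Prog S k}
    (hP : P.WellFormed) (hT : P.LoopsTerminateAS θ) {ε : ℝ} (hε : 0 < ε) (hε1 : ε < 1) :
    ∃ N : ℕ, 1 ≤ N ∧ P.LoopsDecay θ ε N := by
  classical
  induction P using Prog.induction with
  | seq P₁ P₂ h1 h2 =>
    obtain ⟨N₁, hN₁, h1⟩ := h1 hP.1 hT.1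
    obtain ⟨N₂, hN₂, h2⟩ := h2 hP.2 hT.2
    exact ⟨max N₁ N₂, by omega, h1.mono hε hε1 hN₁ (le_max_left _ _),
      h2.mono hε hε1 hN₂ (le_max_right _ _)⟩
  | ite ι q m M P ih =>
    choose N hN h using fun i => ih i (hP.2.2 i) (hT i)
    exact ⟨Finset.univ.sup N + 1, by omega, fun i => (h i).mono hε hε1 (hN i)
      ((Finset.le_sup (f := N) (Finset.mem_univ i)).trans (Nat.le_succ _))⟩
  | loop ι q M₀ M₁ Q ih =>
    obtain ⟨N₁, hN₁, h1⟩ := ih hP.2.2 hT.2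
    have hQ1 := tame_one hP.2.2 hT.2
    have hW1 := (tame_one hP hT).1
    have hp1 := posMap_wsem zero_le_one hP.2.2 hQ1.1
    have hE := measPair_conj_lift hP.1 hP.2.1
    set T := fun τ => Q.wsem 1 θ (conj (lift q M₁) τ) with hTdef
    have hTp : PosMap T := hp1.comp hE.pos₁
    have hT1 : ∀ A, A.PosSemidef → rtr (T A) ≤ rtr A := fun A hA => by
      have := hE.tr A hA
      have := rtr_nonneg (hE.pos₀.pos A hA)
      have := hQ1.2 _ (hE.pos₁.pos A hA)
      simp only [hTdef]
      linarith
    set d : ℝ := 2 * Fintype.card (Cfg S) with hd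
    have hd0 : 0 ≤ d := by positivity
    -- For the identity the mass inside the loop tends to zero; the bound `A ≤ d · tr A · 1` then
    -- transfers the contraction to every input. The denominator `d + 1` is positive without further
    -- argument.
    obtain ⟨N₂, hN₂, hlt⟩ : ∃ N₂ : ℕ, 1 ≤ N₂ ∧
        rtr (T^[N₂] (1 : Matrix (Cfg S) (Cfg S) ℂ)) < ε / (d + 1) := by
      have := ((hW1.1 1 Matrix.PosSemidef.one).2.eventually
        (gt_mem_nhds (by positivity : 0 < ε / (d + 1)))).and (Filter.eventually_ge_atTop 1)
      obtain ⟨n, h1, h2⟩ := this.exists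
      exact ⟨n, h2, h1⟩
    have hstep : ∀ A, A.PosSemidef → rtr (T^[N₂] A) ≤ ε * rtr A := by
      intro A hA
      have hA0 := rtr_nonneg hA
      have h1 := rtr_mono ((hTp.iterate N₂).mono hA (card_smul_one_sub_posSemidef hA))
      rw [(hTp.iterate N₂).smul _ _ (by positivity) Matrix.PosSemidef.one, rtr_smul] at h1
      have h2 : 0 ≤ rtr (T^[N₂] (1 : Matrix (Cfg S) (Cfg S) ℂ)) :=
        rtr_nonneg ((hTp.iterate N₂).pos _ Matrix.PosSemidef.one)
      rw [lt_div_iff₀ (by positivity)] at hlt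
      rw [← hd] at h1
      have h3 := mul_le_mul_of_nonneg_right hlt.le hA0
      nlinarith [mul_nonneg h2 hA0]
    have hpow : ∀ (n : ℕ) A, A.PosSemidef → rtr ((T^[N₂])^[n] A) ≤ ε ^ n * rtr A := by
      intro n A hA
      induction n with
      | zero => simp
      | succ n ih =>
        rw [Function.iterate_succ_apply', pow_succ']
        refine (hstep _ (((hTp.iterate N₂).iterate n).pos A hA)).trans ?_
        rw [mul_assoc]
        exact mul_le_mul_of_nonneg_left ih hε.le
    have hmono : ∀ (n : ℕ) A, A.PosSemidef → rtr (T^[n] A) ≤ rtr A := by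
      intro n A hA
      induction n with
      | zero => exact le_rfl
      | succ n ih =>
        rw [Function.iterate_succ_apply']
        exact (hT1 _ ((hTp.iterate n).pos A hA)).trans ih
    have hdec : ∀ (n : ℕ) A, A.PosSemidef →
        rtr (conj (lift q M₀) (T^[n] A)) ≤ ε ^ (n / N₂) * rtr A := by
      intro n A hA
      have h1 := hE.tr _ ((hTp.iterate n).pos A hA)
      have h2 := rtr_nonneg (hE.pos₁.pos _ ((hTp.iterate n).pos A hA))
      -- Every full block of `N₂` rounds contracts by `ε`; the remaining rounds do not increase the
      -- trace.
      have h3 : T^[n] A = T^[n % N₂] ((T^[N₂])^[n / N₂] A) := by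
        rw [← Function.iterate_mul, ← Function.iterate_add_apply, Nat.mod_add_div]
      have h4 := hmono (n % N₂) _ (((hTp.iterate N₂).iterate (n / N₂)).pos A hA)
      rw [← h3] at h4
      have h5 := hpow (n / N₂) A hA
      linarith
    refine ⟨max N₁ N₂, by omega, fun n ρ hρ => ?_, h1.mono hε hε1 hN₁ (le_max_left _ _)⟩
    rw [← wsem_one, itrace_eq_trace, itrace_eq_trace]
    refine (hdec n ρ hρ.1).trans (mul_le_mul_of_nonneg_right ?_ (rtr_nonneg hρ.1))
    exact pow_le_pow_of_le_one hε.le hε1.le (Nat.div_le_div_left (le_max_right _ _) hN₂)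
  | _ => exact ⟨1, le_rfl, trivial⟩

end Prog

/-! ### Slices of operators on the extended system -/

section Slices

/-- The labels of the variables of the extended system that are not variables of the program. -/
abbrev Rest (S : QSystem) : Type := Cfg S × Fin 2 × Fin 2 × ℤ

variable {S : QSystem}

/-- The label of the extended system with given parts. -/
def mk (x : Cfg S) (r : Rest S) : Cfg (ext S)
  | .orig v => x v
  | .copy v => r.1 v
  | .q₁ => r.2.1
  | .q₂ => r.2.2.1
  | .qc => r.2.2.2

/-- The decomposition of the labels of the extended system. -/
def mkEquiv (S : QSystem) : Cfg S × Rest S ≃ Cfg (ext S) where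
  toFun p := mk p.1 p.2
  invFun z := (fun v => z (.orig v), fun v => z (.copy v), z .q₁, z .q₂, z .qc)
  left_inv _ := rfl
  right_inv z := by
    funext v
    cases v <;> rfl

theorem exists_mk (z : Cfg (ext S)) : ∃ x r, z = mk x r :=
  ⟨_, _, ((mkEquiv S).right_inv z).symm⟩

/-- The block of an operator between two labels of the additional variables. -/
def sl (σ : Matrix (Cfg (ext S)) (Cfg (ext S)) ℂ) (r r' : Rest S) : Matrix (Cfg S) (Cfg S) ℂ :=
  Matrix.of fun x y => σ (mk x r) (mk y r')

theorem sl_apply (σ : Matrix (Cfg (ext S)) (Cfg (ext S)) ℂ) (r r' : Rest S) (x y : Cfg S) :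
    sl σ r r' x y = σ (mk x r) (mk y r') := rfl

theorem sl_posSemidef {σ : Matrix (Cfg (ext S)) (Cfg (ext S)) ℂ} (hσ : σ.PosSemidef) (r : Rest S) :
    (sl σ r r).PosSemidef :=
  hσ.submatrix (fun x => mk x r)

variable {ι : Type} {q : ι → S.Var}

theorem regOrig_injective (hq : Function.Injective q) : Function.Injective (regOrig S q) := by
  intro i j h
  exact hq (DVar.orig.inj h)

theorem setReg_regOrig (hq : Function.Injective q) (x : Cfg S) (r : Rest S) (w : RCfg q) :
    setReg (regOrig S q) (mk x r) w = mk (setReg q x w) r := by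
  refine (setReg_ext (regOrig_injective hq) ?_ ?_).symm
  · exact readReg_setReg hq x w
  · intro v hv
    cases v with
    | orig v => exact setReg_of_notMem q x w v fun i hi => hv i (congrArg DVar.orig hi)
    | _ => rfl

/-- A register of the program leaves the additional labels untouched, so its operators act on each
block separately. The analysis thereby returns to finite matrices. -/
theorem sl_conj_lift [Finite (RCfg q)] (hq : Function.Injective q) (A : Matrix (RCfg q) (RCfg q) ℂ)
    (σ : Matrix (Cfg (ext S)) (Cfg (ext S)) ℂ) (r r' : Rest S) :
    sl (conj (lift (regOrig S q) A) σ) r r' = conj (lift q A) (sl σ r r') := by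
  have := Fintype.ofFinite (RCfg q)
  let _ : Fintype (RCfg (regOrig S q)) := this
  ext x y
  rw [conj_lift_apply hq]
  refine (conj_lift_apply (regOrig_injective hq) A σ (mk x r) (mk y r')).trans ?_
  refine Finset.sum_congr (ι := RCfg q) rfl fun w _ => Finset.sum_congr (ι := RCfg q) rfl fun w' _ => ?_
  exact congrArg (fun t => A (readReg q x) w * t * star (A (readReg q y) w'))
    (congrArg₂ σ (setReg_regOrig hq x r w) (setReg_regOrig hq y r' w'))

theorem sl_resetReg (hq : Function.Injective q) (τ : Matrix (RCfg q) (RCfg q) ℂ)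
    (σ : Matrix (Cfg (ext S)) (Cfg (ext S)) ℂ) (r r' : Rest S) :
    sl (resetReg (regOrig S q) τ σ) r r' = resetReg q τ (sl σ r r') := by
  ext x y
  rw [sl_apply]
  unfold resetReg
  congr 1
  refine tsum_congr fun w => ?_
  exact congrArg₂ σ (setReg_regOrig hq x r w) (setReg_regOrig hq y r' w)

theorem sl_resetVar (v : S.Var) (σ : Matrix (Cfg (ext S)) (Cfg (ext S)) ℂ) (r r' : Rest S) :
    sl (resetVar (S := ext S) (DVar.orig v) σ) r r' = resetVar v (sl σ r r') := by
  rw [resetVar_eq_resetReg v, ← sl_resetReg (fun _ _ _ => rfl)]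
  exact congrArg (fun τ => sl τ r r') (resetVar_eq_resetReg (S := ext S) (DVar.orig v) σ)

theorem conj_lift_posSemidef' [Finite (RCfg q)] (hq : Function.Injective q)
    (A : Matrix (RCfg q) (RCfg q) ℂ) {ρ : Matrix (Cfg S) (Cfg S) ℂ} (hρ : ρ.PosSemidef) :
    (conj (lift q A) ρ).PosSemidef := by
  have := Fintype.ofFinite (RCfg q)
  exact conj_lift_posSemidef hq A hρ

theorem resetReg_posSemidef' [Finite (RCfg q)] (hq : Function.Injective q)
    {σ : Matrix (RCfg q) (RCfg q) ℂ} (hσ : IsDensity σ) {ρ : Matrix (Cfg S) (Cfg S) ℂ}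
    (hρ : ρ.PosSemidef) : (resetReg q σ ρ).PosSemidef := by
  have := Fintype.ofFinite (RCfg q)
  exact resetReg_posSemidef hq hσ hρ

theorem resetVar_posSemidef {v : S.Var} [Finite (S.Basis v)] {ρ : Matrix (Cfg S) (Cfg S) ℂ}
    (hρ : ρ.PosSemidef) : (resetVar v ρ).PosSemidef := by
  rw [resetVar_eq_resetReg]
  have : Finite (RCfg fun _ : Unit => v) := Pi.finite
  exact resetReg_posSemidef' (fun _ _ _ => rfl) (isDensity_zero v) hρ

variable [Fintype (Cfg S)]

/-- The partial trace over the copies of a diagonal block. -/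
def blk (σ : Matrix (Cfg (ext S)) (Cfg (ext S)) ℂ) (a b : Fin 2) (i : ℤ) :
    Matrix (Cfg S) (Cfg S) ℂ :=
  ∑ c : Cfg S, sl σ (c, a, b, i) (c, a, b, i)

theorem blk_posSemidef {σ : Matrix (Cfg (ext S)) (Cfg (ext S)) ℂ} (hσ : σ.PosSemidef)
    (a b : Fin 2) (i : ℤ) : (blk σ a b i).PosSemidef :=
  Matrix.posSemidef_sum _ fun _ _ => sl_posSemidef hσ _

theorem sl_sum {κ : Type} (s : Finset κ) (σ : κ → Matrix (Cfg (ext S)) (Cfg (ext S)) ℂ)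
    (r r' : Rest S) : sl (∑ k ∈ s, σ k) r r' = ∑ k ∈ s, sl (σ k) r r' := by
  ext x y
  rw [sl_apply, Matrix.sum_apply, Matrix.sum_apply]
  rfl

theorem blk_sum {κ : Type} (s : Finset κ) (σ : κ → Matrix (Cfg (ext S)) (Cfg (ext S)) ℂ)
    (a b : Fin 2) (i : ℤ) : blk (∑ k ∈ s, σ k) a b i = ∑ k ∈ s, blk (σ k) a b i := by
  simp_rw [blk, sl_sum]
  exact Finset.sum_comm

theorem hasSum_blk {σ : ℕ → Matrix (Cfg (ext S)) (Cfg (ext S)) ℂ}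
    {τ : Matrix (Cfg (ext S)) (Cfg (ext S)) ℂ} (h : ∀ z z', HasSum (fun n => σ n z z') (τ z z'))
    (a b : Fin 2) (i : ℤ) (x y : Cfg S) : HasSum (fun n => blk (σ n) a b i x y) (blk τ a b i x y) := by
  simp_rw [blk, Matrix.sum_apply]
  exact hasSum_sum fun c _ => h _ _

theorem diag_le_rtr_blk {σ : Matrix (Cfg (ext S)) (Cfg (ext S)) ℂ} (hσ : σ.PosSemidef)
    (x c : Cfg S) (a b : Fin 2) (i : ℤ) :
    (σ (mk x (c, a, b, i)) (mk x (c, a, b, i))).re ≤ rtr (blk σ a b i) := by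
  rw [blk, rtr_sum]
  exact (PSD.diag_le_rtr (sl_posSemidef hσ (c, a, b, i)) x).trans
    (Finset.single_le_sum (f := fun c => rtr (sl σ (c, a, b, i) (c, a, b, i)))
      (fun c _ => rtr_nonneg (sl_posSemidef hσ _)) (Finset.mem_univ c))

/-- `G` acts on the diagonal blocks of positive semidefinite operators by `F`. -/
structure SliceMap (G : Matrix (Cfg (ext S)) (Cfg (ext S)) ℂ → Matrix (Cfg (ext S)) (Cfg (ext S)) ℂ)
    (F : Matrix (Cfg S) (Cfg S) ℂ → Matrix (Cfg S) (Cfg S) ℂ) : Prop where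
  psd : ∀ σ, σ.PosSemidef → (G σ).PosSemidef
  posMap : PosMap F
  sl : ∀ σ r, sl (G σ) r r = F (sl σ r r)

theorem sliceMap_conj_lift (hq : Function.Injective q) (A : Matrix (RCfg q) (RCfg q) ℂ) :
    SliceMap (conj (lift (regOrig S q) A)) (conj (lift q A)) := by
  have := finite_rcfg hq
  have : Finite (RCfg (regOrig S q)) := this
  exact ⟨fun σ hσ => conj_lift_posSemidef' (regOrig_injective hq) A hσ, posMap_conj_lift hq A,
    fun σ r => sl_conj_lift hq A σ r r⟩

theorem sliceMap_resetReg (hq : Function.Injective q) {τ : Matrix (RCfg q) (RCfg q) ℂ}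
    (hτ : IsDensity τ) : SliceMap (resetReg (regOrig S q) τ) (resetReg q τ) := by
  have := finite_rcfg hq
  have : Finite (RCfg (regOrig S q)) := this
  exact ⟨fun σ hσ => resetReg_posSemidef' (regOrig_injective hq) hτ hσ, posMap_resetReg hq hτ,
    fun σ r => sl_resetReg hq τ σ r r⟩

theorem sliceMap_resetVar (v : S.Var) :
    SliceMap (resetVar (S := ext S) (DVar.orig v)) (resetVar v) := by
  have : Finite (S.Basis v) := by
    have := finite_rcfg (S := S) (q := fun _ : Unit => v) (fun _ _ _ => rfl)
    exact Finite.of_surjective (fun w : RCfg fun _ : Unit => v => w ()) fun n => ⟨fun _ => n, rfl⟩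
  have : Finite ((ext S).Basis (DVar.orig v)) := this
  exact ⟨fun σ hσ => resetVar_posSemidef hσ, posMap_resetVar v, fun σ r => sl_resetVar v σ r r⟩

theorem SliceMap.blk {G : Matrix (Cfg (ext S)) (Cfg (ext S)) ℂ → Matrix (Cfg (ext S)) (Cfg (ext S)) ℂ}
    {F : Matrix (Cfg S) (Cfg S) ℂ → Matrix (Cfg S) (Cfg S) ℂ} (h : SliceMap G F)
    {σ : Matrix (Cfg (ext S)) (Cfg (ext S)) ℂ} (hσ : σ.PosSemidef) (a b : Fin 2) (i : ℤ) :
    QWhile.blk (G σ) a b i = F (QWhile.blk σ a b i) := by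
  simp_rw [QWhile.blk, h.sl]
  exact (h.posMap.map_sum _ fun c _ => sl_posSemidef hσ _).symm

/-! ### Invariants of the differential program -/

/-- The weight of `{j, j + 1, …}`. -/
def tail (μ : ℕ → ℝ) (j : ℕ) : ℝ := 1 - ∑ l ∈ Finset.Ico 1 j, μ l

theorem tail_succ (μ : ℕ → ℝ) (n : ℕ) : tail μ (n + 2) = tail μ (n + 1) - μ (n + 1) := by
  rw [tail, tail, Finset.sum_Ico_succ_top (by omega)]
  ring

theorem tail_pos {μ : ℕ → ℝ} (hμ : IsPosDistribution μ) (n : ℕ) : 0 < tail μ (n + 1) := by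
  have h1 : ∑ l ∈ Finset.Ico 1 (n + 1), μ l = ∑ l ∈ Finset.range n, μ (l + 1) := by
    rw [Finset.sum_Ico_eq_sum_range]
    simp [add_comm]
  have h2 := sum_le_hasSum (Finset.range (n + 1)) (fun l _ => (hμ.1 (l + 1) (by omega)).le) hμ.2
  rw [Finset.sum_range_succ] at h2
  have := hμ.1 (n + 1) (by omega)
  rw [tail, h1]
  linarith

/-- The invariants of the states that occur in the differential program: the counter is positive,
and while `q₁` is in the state `|0⟩`, the state of `q₂` is determined by the counter. -/
structure Good (μ : ℕ → ℝ) (σ : Matrix (Cfg (ext S)) (Cfg (ext S)) ℂ) : Prop where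
  psd : σ.PosSemidef
  neg : ∀ x (r : Rest S), r.2.2.2 ≤ 0 → σ (mk x r) (mk x r) = 0
  pure : ∀ n : ℕ, (tail μ (n + 2) : ℂ) • blk σ 0 1 (n + 1) = (μ (n + 1) : ℂ) • blk σ 0 0 (n + 1)

/-- The part of the state with `q₁` in the state `|1⟩` and counter `i`. -/
def beta (σ : Matrix (Cfg (ext S)) (Cfg (ext S)) ℂ) (i : ℤ) : Matrix (Cfg S) (Cfg S) ℂ :=
  blk σ 1 0 i + blk σ 1 1 i

/-- The weighted sum of the parts of the state with `q₁` in the state `|0⟩` and counter `≤ J`. -/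
def psi (μ : ℕ → ℝ) (ζ : ℝ) (J : ℕ) (σ : Matrix (Cfg (ext S)) (Cfg (ext S)) ℂ) :
    Matrix (Cfg S) (Cfg S) ℂ :=
  ∑ n ∈ Finset.range J, ((ζ ^ n / tail μ (n + 2) : ℝ) : ℂ) • blk σ 0 0 (n + 1)

/-- The potential that does not increase along the differential program. -/
def slack (μ : ℕ → ℝ) (ζ : ℝ) (J : ℕ) (σ : Matrix (Cfg (ext S)) (Cfg (ext S)) ℂ)
    (Z : Matrix (Cfg S) (Cfg S) ℂ) : ℝ :=
  ζ ^ (J + 1) / μ (J + 1) * rtr (beta σ (J + 1)) + rtr (psi μ ζ (J + 1) σ) - rtr Z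

/-- `W` simulates `G`. -/
def Sim (μ : ℕ → ℝ) (ζ : ℝ)
    (G : Matrix (Cfg (ext S)) (Cfg (ext S)) ℂ → Matrix (Cfg (ext S)) (Cfg (ext S)) ℂ)
    (W : Matrix (Cfg S) (Cfg S) ℂ → Matrix (Cfg S) (Cfg S) ℂ) : Prop :=
  ∀ σ, Good μ σ → Good μ (G σ) ∧ ∀ J Z, (Z - psi μ ζ (J + 1) σ).PosSemidef →
    (W Z - psi μ ζ (J + 1) (G σ)).PosSemidef ∧ slack μ ζ J (G σ) (W Z) ≤ slack μ ζ J σ Z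

variable {μ : ℕ → ℝ} {ζ : ℝ}
  {G : Matrix (Cfg (ext S)) (Cfg (ext S)) ℂ → Matrix (Cfg (ext S)) (Cfg (ext S)) ℂ}
  {F : Matrix (Cfg S) (Cfg S) ℂ → Matrix (Cfg S) (Cfg S) ℂ}
  {σ : Matrix (Cfg (ext S)) (Cfg (ext S)) ℂ}

theorem beta_posSemidef (hσ : σ.PosSemidef) (i : ℤ) : (beta σ i).PosSemidef :=
  (blk_posSemidef hσ _ _ _).add (blk_posSemidef hσ _ _ _)

theorem psi_coeff_pos (hμ : IsPosDistribution μ) (hζ : 0 < ζ) (n : ℕ) :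
    0 < ζ ^ n / tail μ (n + 2) :=
  div_pos (pow_pos hζ n) (tail_pos hμ (n + 1))

theorem psi_posSemidef (hμ : IsPosDistribution μ) (hζ : 0 < ζ) (hσ : σ.PosSemidef) (J : ℕ) :
    (psi μ ζ J σ).PosSemidef :=
  Matrix.posSemidef_sum _ fun n _ => PSD.smul (blk_posSemidef hσ _ _ _) (psi_coeff_pos hμ hζ n).le

theorem beta_sum {κ : Type} (s : Finset κ) (σ : κ → Matrix (Cfg (ext S)) (Cfg (ext S)) ℂ) (i : ℤ) :
    beta (∑ k ∈ s, σ k) i = ∑ k ∈ s, beta (σ k) i := by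
  simp_rw [beta, blk_sum, Finset.sum_add_distrib]

theorem psi_sum {κ : Type} (s : Finset κ) (σ : κ → Matrix (Cfg (ext S)) (Cfg (ext S)) ℂ) (J : ℕ) :
    psi μ ζ J (∑ k ∈ s, σ k) = ∑ k ∈ s, psi μ ζ J (σ k) := by
  simp_rw [psi, blk_sum, Finset.smul_sum]
  exact Finset.sum_comm

theorem slack_sum {κ : Type} (s : Finset κ) (σ : κ → Matrix (Cfg (ext S)) (Cfg (ext S)) ℂ) (J : ℕ)
    (Z : κ → Matrix (Cfg S) (Cfg S) ℂ) :
    slack μ ζ J (∑ k ∈ s, σ k) (∑ k ∈ s, Z k) = ∑ k ∈ s, slack μ ζ J (σ k) (Z k) := by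
  simp_rw [slack, beta_sum, psi_sum, rtr_sum, Finset.sum_sub_distrib, Finset.sum_add_distrib,
    Finset.mul_sum]

theorem SliceMap.beta (h : SliceMap G F) (hσ : σ.PosSemidef) (i : ℤ) :
    QWhile.beta (G σ) i = F (QWhile.beta σ i) := by
  rw [QWhile.beta, h.blk hσ, h.blk hσ, ← h.posMap.add _ _ (blk_posSemidef hσ _ _ _)
    (blk_posSemidef hσ _ _ _)]
  rfl

theorem SliceMap.psi (h : SliceMap G F) (hμ : IsPosDistribution μ) (hζ : 0 < ζ)
    (hσ : σ.PosSemidef) (J : ℕ) : QWhile.psi μ ζ J (G σ) = F (QWhile.psi μ ζ J σ) := by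
  have h0 := fun n : ℕ => blk_posSemidef hσ 0 0 ((n : ℤ) + 1)
  rw [QWhile.psi, QWhile.psi, h.posMap.map_sum _ fun n _ => PSD.smul (h0 n) (psi_coeff_pos hμ hζ n).le]
  refine Finset.sum_congr rfl fun n _ => ?_
  rw [h.blk hσ, h.posMap.smul _ _ (psi_coeff_pos hμ hζ n).le (h0 n)]

theorem SliceMap.good (h : SliceMap G F) (hμ : IsPosDistribution μ) (hσ : Good μ σ) :
    Good μ (G σ) where
  psd := h.psd σ hσ.psd
  neg x r hr := by
    have h1 : QWhile.sl σ r r = 0 := by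
      ext x y
      refine PSD.eq_zero_of_diag (sl_posSemidef hσ.psd r) x y ?_
      rw [sl_apply, hσ.neg x r hr, Complex.zero_re]
    rw [← sl_apply (G σ), h.sl, h1, h.posMap.map_zero]
    rfl
  pure n := by
    have h0 := fun b => blk_posSemidef hσ.psd 0 b ((n : ℤ) + 1)
    rw [h.blk hσ.psd, h.blk hσ.psd, ← h.posMap.smul _ _ (tail_pos hμ (n + 1)).le (h0 1), hσ.pure n,
      h.posMap.smul _ _ (hμ.1 (n + 1) (by omega)).le (h0 0)]

theorem SliceMap.sub_psi (h : SliceMap G F) (hμ : IsPosDistribution μ) (hζ : 0 < ζ)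
    (hσ : σ.PosSemidef) {J : ℕ} {Z : Matrix (Cfg S) (Cfg S) ℂ}
    (hZ : (Z - QWhile.psi μ ζ J σ).PosSemidef) : (F Z - QWhile.psi μ ζ J (G σ)).PosSemidef := by
  rw [h.psi hμ hζ hσ]
  exact h.posMap.mono (psi_posSemidef hμ hζ hσ J) hZ

theorem Sim.id : Sim (S := S) μ ζ (fun σ => σ) (fun Z => Z) :=
  fun _ hσ => ⟨hσ, fun _ _ hZ => ⟨hZ, le_rfl⟩⟩

theorem Sim.comp {G' : Matrix (Cfg (ext S)) (Cfg (ext S)) ℂ → Matrix (Cfg (ext S)) (Cfg (ext S)) ℂ}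
    {W W' : Matrix (Cfg S) (Cfg S) ℂ → Matrix (Cfg S) (Cfg S) ℂ}
    (h' : Sim μ ζ G' W') (h : Sim μ ζ G W) : Sim μ ζ (fun σ => G' (G σ)) (fun Z => W' (W Z)) := by
  intro σ hσ
  have h1 := h σ hσ
  have h2 := h' _ h1.1
  refine ⟨h2.1, fun J Z hZ => ?_⟩
  have h3 := h1.2 J Z hZ
  have h4 := h2.2 J _ h3.1
  exact ⟨h4.1, h4.2.trans h3.2⟩

theorem PSD.of_sub {I : Type} [Fintype I] {A B : Matrix I I ℂ} (h : (A - B).PosSemidef)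
    (hB : B.PosSemidef) : A.PosSemidef := by
  simpa using h.add hB

/-- `F` acts on `beta`, `psi` and `Z` alike and preserves their traces, so the potential is
unchanged. -/
theorem SliceMap.sim (h : SliceMap G F) (hμ : IsPosDistribution μ) (hζ : 0 < ζ) (hF : TP F) :
    Sim μ ζ G F := by
  intro σ hσ
  refine ⟨h.good hμ hσ, fun J Z hZ => ⟨h.sub_psi hμ hζ hσ.psd hZ, le_of_eq ?_⟩⟩
  have hp := psi_posSemidef hμ hζ hσ.psd (J + 1)
  rw [slack, slack, h.beta hσ.psd, h.psi hμ hζ hσ.psd, hF _ (beta_posSemidef hσ.psd _), hF _ hp,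
    hF _ (PSD.of_sub hZ hp)]

theorem Good.sum {κ : Type} (s : Finset κ) {σ : κ → Matrix (Cfg (ext S)) (Cfg (ext S)) ℂ}
    (h : ∀ k ∈ s, Good μ (σ k)) : Good μ (∑ k ∈ s, σ k) where
  psd := Matrix.posSemidef_sum _ fun k hk => (h k hk).psd
  neg x r hr := by
    rw [Matrix.sum_apply]
    exact Finset.sum_eq_zero fun k hk => (h k hk).neg x r hr
  pure n := by
    rw [blk_sum, blk_sum, Finset.smul_sum, Finset.smul_sum]
    exact Finset.sum_congr rfl fun k hk => (h k hk).pure n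

/-- The change of the potential under a measurement. -/
theorem sum_slack_sliceMap {κ : Type} [Fintype κ]
    {N : κ → Matrix (Cfg (ext S)) (Cfg (ext S)) ℂ → Matrix (Cfg (ext S)) (Cfg (ext S)) ℂ}
    {E : κ → Matrix (Cfg S) (Cfg S) ℂ → Matrix (Cfg S) (Cfg S) ℂ}
    (hN : ∀ k, SliceMap (N k) (E k)) (hE : ∀ A, A.PosSemidef → ∑ k, rtr (E k A) = rtr A)
    (hμ : IsPosDistribution μ) (hζ : 0 < ζ) (hσ : σ.PosSemidef) {J : ℕ}
    {Z : Matrix (Cfg S) (Cfg S) ℂ} (hZ : (Z - psi μ ζ (J + 1) σ).PosSemidef) :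
    ∑ k, slack μ ζ J (N k σ) (E k Z) = slack μ ζ J σ Z := by
  have hp := psi_posSemidef hμ hζ hσ (J + 1)
  simp_rw [slack, (hN _).beta hσ, (hN _).psi hμ hζ hσ, Finset.sum_sub_distrib,
    Finset.sum_add_distrib, ← Finset.mul_sum]
  rw [hE _ (beta_posSemidef hσ _), hE _ hp, hE _ (PSD.of_sub hZ hp)]

/-- The outcome probabilities add up to the trace, so the potential splits exactly over the branches
and the decreases within the branches add up. -/
theorem Sim.measure {κ : Type} [Fintype κ]
    {N G : κ → Matrix (Cfg (ext S)) (Cfg (ext S)) ℂ → Matrix (Cfg (ext S)) (Cfg (ext S)) ℂ}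
    {E W : κ → Matrix (Cfg S) (Cfg S) ℂ → Matrix (Cfg S) (Cfg S) ℂ}
    (hN : ∀ k, SliceMap (N k) (E k)) (hE : ∀ A, A.PosSemidef → ∑ k, rtr (E k A) = rtr A)
    (hμ : IsPosDistribution μ) (hζ : 0 < ζ) (h : ∀ k, Sim μ ζ (G k) (W k)) :
    Sim μ ζ (fun σ => ∑ k, G k (N k σ)) (fun Z => ∑ k, W k (E k Z)) := by
  intro σ hσ
  have h1 := fun k => h k _ ((hN k).good hμ hσ)
  refine ⟨Good.sum _ fun k _ => (h1 k).1, fun J Z hZ => ?_⟩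
  have h2 := fun k => (h1 k).2 J _ ((hN k).sub_psi hμ hζ hσ.psd hZ)
  constructor
  · rw [psi_sum, ← Finset.sum_sub_distrib]
    exact Matrix.posSemidef_sum _ fun k _ => (h2 k).1
  · rw [slack_sum, ← sum_slack_sliceMap hN hE hμ hζ hσ.psd hZ]
    exact Finset.sum_le_sum fun k _ => (h2 k).2

end Slices

/-! ### Simulation of loops -/

section SimLoop

variable {S : QSystem} [Fintype (Cfg S)] {μ : ℕ → ℝ} {ζ : ℝ}
  {σ : Matrix (Cfg (ext S)) (Cfg (ext S)) ℂ}

/-- Used for an unfinished loop: its potential is at worst minus the mass of the weighted state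
still inside, which tends to zero. -/
theorem neg_rtr_le_slack (hμ : IsPosDistribution μ) (hζ : 0 < ζ) (hσ : σ.PosSemidef) (J : ℕ)
    (Z : Matrix (Cfg S) (Cfg S) ℂ) : 0 ≤ slack μ ζ J σ Z + rtr Z := by
  have h1 := rtr_nonneg (beta_posSemidef hσ (J + 1))
  have h2 := rtr_nonneg (psi_posSemidef hμ hζ hσ (J + 1))
  have h3 : 0 < ζ ^ (J + 1) / μ (J + 1) := div_pos (pow_pos hζ _) (hμ.1 _ (by omega))
  rw [slack]
  nlinarith [mul_nonneg h3.le h1]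

theorem rtr_beta_le_slack (hμ : IsPosDistribution μ) (hζ : 0 < ζ) (hσ : σ.PosSemidef) (J : ℕ)
    (Z : Matrix (Cfg S) (Cfg S) ℂ) :
    ζ ^ (J + 1) / μ (J + 1) * rtr (beta σ (J + 1)) ≤ slack μ ζ J σ Z + rtr Z := by
  have h2 := rtr_nonneg (psi_posSemidef hμ hζ hσ (J + 1))
  rw [slack]
  linarith

/-- Diagonal entries are controlled by the functionals that occur in the potential. -/
theorem exists_diag_le (hμ : IsPosDistribution μ) (hζ : 0 < ζ) (n : ℕ) :
    ∃ C : ℝ, 0 ≤ C ∧ ∀ σ : Matrix (Cfg (ext S)) (Cfg (ext S)) ℂ, Good μ σ → ∀ (x c : Cfg S)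
      (a b : Fin 2), (σ (mk x (c, a, b, (n : ℤ) + 1)) (mk x (c, a, b, (n : ℤ) + 1))).re ≤
        C * rtr (psi μ ζ (n + 1) σ) + rtr (beta σ (n + 1)) := by
  set t := ζ ^ n / tail μ (n + 2) with ht
  have ht0 : 0 < t := psi_coeff_pos hμ hζ n
  set u := μ (n + 1) / tail μ (n + 2) with hu
  have hu0 : 0 < u := div_pos (hμ.1 _ (by omega)) (tail_pos hμ (n + 1))
  refine ⟨(1 + u) / t, by positivity, fun σ hσ x c a b => ?_⟩
  have hA : rtr (blk σ 0 0 ((n : ℤ) + 1)) ≤ 1 / t * rtr (psi μ ζ (n + 1) σ) := by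
    have h1 : t * rtr (blk σ 0 0 ((n : ℤ) + 1)) ≤ rtr (psi μ ζ (n + 1) σ) := by
      rw [psi, Finset.sum_range_succ, rtr_add, rtr_smul]
      have := rtr_nonneg (psi_posSemidef hμ hζ hσ.psd n)
      rw [psi] at this
      linarith
    rw [div_mul_eq_mul_div, one_mul, le_div_iff₀ ht0]
    linarith
  have hB : rtr (blk σ 0 1 ((n : ℤ) + 1)) = u * rtr (blk σ 0 0 ((n : ℤ) + 1)) := by
    have h1 := congrArg rtr (hσ.pure n)
    rw [rtr_smul, rtr_smul] at h1
    rw [hu, div_mul_eq_mul_div, eq_div_iff (tail_pos hμ (n + 1)).ne']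
    linarith
  have h0 := rtr_nonneg (blk_posSemidef hσ.psd 0 0 ((n : ℤ) + 1))
  have h1 := rtr_nonneg (blk_posSemidef hσ.psd 1 0 ((n : ℤ) + 1))
  have h2 := rtr_nonneg (blk_posSemidef hσ.psd 1 1 ((n : ℤ) + 1))
  have h3 := rtr_nonneg (psi_posSemidef hμ hζ hσ.psd (n + 1))
  have hbeta : rtr (beta σ (n + 1)) = rtr (blk σ 1 0 ((n : ℤ) + 1)) + rtr (blk σ 1 1 ((n : ℤ) + 1)) :=
    rtr_add _ _
  refine (diag_le_rtr_blk hσ.psd x c a b _).trans ?_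
  have h4 : (1 + u) / t * rtr (psi μ ζ (n + 1) σ) =
      1 / t * rtr (psi μ ζ (n + 1) σ) + u * (1 / t * rtr (psi μ ζ (n + 1) σ)) := by ring
  have h5 := mul_le_mul_of_nonneg_left hA hu0.le
  have h6 : 0 ≤ 1 / t * rtr (psi μ ζ (n + 1) σ) := by positivity
  have h7 : 0 ≤ u * (1 / t * rtr (psi μ ζ (n + 1) σ)) := by positivity
  rw [h4, hbeta]
  fin_cases a <;> fin_cases b <;> simp only [Fin.zero_eta, Fin.mk_one, Fin.isValue] <;> linarith

variable {N₀ N₁ G : Matrix (Cfg (ext S)) (Cfg (ext S)) ℂ → Matrix (Cfg (ext S)) (Cfg (ext S)) ℂ}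
  {E₀ E₁ W : Matrix (Cfg S) (Cfg S) ℂ → Matrix (Cfg S) (Cfg S) ℂ}

/-- The measurement divides the potential exactly between leaving and continuing, and the body does
not increase the continuing part. -/
theorem Sim.iterate (hN₀ : SliceMap N₀ E₀) (hN₁ : SliceMap N₁ E₁) (hE : MeasPair E₀ E₁)
    (hμ : IsPosDistribution μ) (hζ : 0 < ζ) (h : Sim μ ζ G W) (hσ : Good μ σ) (n : ℕ) :
    Good μ ((fun τ => G (N₁ τ))^[n] σ) ∧ ∀ J Z, (Z - psi μ ζ (J + 1) σ).PosSemidef →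
      ((fun B => W (E₁ B))^[n] Z - psi μ ζ (J + 1) ((fun τ => G (N₁ τ))^[n] σ)).PosSemidef ∧
      ∑ m ∈ Finset.range n, slack μ ζ J (N₀ ((fun τ => G (N₁ τ))^[m] σ))
          (E₀ ((fun B => W (E₁ B))^[m] Z)) +
        slack μ ζ J ((fun τ => G (N₁ τ))^[n] σ) ((fun B => W (E₁ B))^[n] Z) ≤ slack μ ζ J σ Z := by
  induction n with
  | zero => exact ⟨hσ, fun J Z hZ => ⟨hZ, by simp⟩⟩
  | succ n ih =>
    simp only [Function.iterate_succ_apply', Finset.sum_range_succ]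
    set τ := (fun τ => G (N₁ τ))^[n] σ
    have h1 := h _ (hN₁.good hμ ih.1)
    refine ⟨h1.1, fun J Z hZ => ?_⟩
    set Y := (fun B => W (E₁ B))^[n] Z
    have h2 := ih.2 J Z hZ
    have h3 := h1.2 J _ (hN₁.sub_psi hμ hζ ih.1.psd h2.1)
    have h4 := sum_slack_sliceMap (N := ![N₀, N₁]) (E := ![E₀, E₁])
      (fun k => by fin_cases k <;> assumption)
      (fun A hA => by simpa using hE.tr A hA) hμ hζ ih.1.psd h2.1
    simp only [Fin.sum_univ_two, Matrix.cons_val_zero, Matrix.cons_val_one] at h4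
    exact ⟨h3.1, by linarith [h3.2, h2.2]⟩

/-- By `hpart`, unrolling `K` rounds decreases the potential up to the mass `tr (T^K Z)` still
inside, which vanishes in the limit. The convergence of the loop series on the infinite-dimensional
space must be proved first; it comes from the same inequality, via control of the diagonal. -/
theorem Sim.loop (hN₀ : SliceMap N₀ E₀) (hN₁ : SliceMap N₁ E₁) (hE : MeasPair E₀ E₁)
    (hμ : IsPosDistribution μ) (hζ : 0 < ζ) (h : Sim μ ζ G W) (hW : PosMap W)
    (hT : ∀ Z, Z.PosSemidef → (Summable fun n => rtr (E₀ ((fun B => W (E₁ B))^[n] Z))) ∧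
      Filter.Tendsto (fun n => rtr ((fun B => W (E₁ B))^[n] Z)) Filter.atTop (nhds 0)) :
    Sim μ ζ (fun σ x y => ∑' n : ℕ, N₀ ((fun τ => G (N₁ τ))^[n] σ) x y)
      (loopMap E₀ (fun B => W (E₁ B))) := by
  intro σ hσ
  set T := (fun B => W (E₁ B)) with hTdef
  set U := (fun τ => G (N₁ τ)) with hU
  have hTp : PosMap T := hW.comp hE.pos₁
  have hit := fun n => Sim.iterate hN₀ hN₁ hE hμ hζ h hσ n
  have hgood : ∀ n, Good μ (N₀ (U^[n] σ)) := fun n => hN₀.good hμ (hit n).1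
  have hsub : ∀ n J Z, (Z - psi μ ζ (J + 1) σ).PosSemidef →
      (E₀ (T^[n] Z) - psi μ ζ (J + 1) (N₀ (U^[n] σ))).PosSemidef := fun n J Z hZ =>
    hN₀.sub_psi hμ hζ (hit n).1.psd ((hit n).2 J Z hZ).1
  have hpart : ∀ K J Z, (Z - psi μ ζ (J + 1) σ).PosSemidef →
      ∑ m ∈ Finset.range K, slack μ ζ J (N₀ (U^[m] σ)) (E₀ (T^[m] Z)) ≤
        slack μ ζ J σ Z + rtr (T^[K] Z) := fun K J Z hZ => by
    have h1 := ((hit K).2 J Z hZ).2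
    have h2 := neg_rtr_le_slack hμ hζ (hit K).1.psd J (T^[K] Z)
    linarith
  have hdiag : ∀ z : Cfg (ext S), Summable fun n => (N₀ (U^[n] σ) z z).re := by
    intro z
    obtain ⟨x, ⟨c, a, b, i⟩, rfl⟩ := exists_mk z
    by_cases hi : i ≤ 0
    · have : (fun n => (N₀ (U^[n] σ) (mk x (c, a, b, i)) (mk x (c, a, b, i))).re) = fun _ => 0 :=
        funext fun n => by rw [(hgood n).neg x _ hi, Complex.zero_re]
      rw [this]
      exact summable_zero
    · obtain ⟨J, rfl⟩ : ∃ J : ℕ, i = (J : ℤ) + 1 := ⟨(i - 1).toNat, by omega⟩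
      obtain ⟨C, hC, hle⟩ := exists_diag_le (S := S) hμ hζ J
      -- The smallest admissible companion: `psi` dominates itself, so `hpart` is available before
      -- any `Z` is given.
      set Z := psi μ ζ (J + 1) σ with hZdef
      have hZ : (Z - psi μ ζ (J + 1) σ).PosSemidef := by
        rw [sub_self]; exact Matrix.PosSemidef.zero
      have hZp : Z.PosSemidef := psi_posSemidef hμ hζ hσ.psd _
      have hs := (hT Z hZp).1
      have hE0 : ∀ n, 0 ≤ rtr (E₀ (T^[n] Z)) := fun n =>
        rtr_nonneg (hE.pos₀.pos _ ((hTp.iterate n).pos Z hZp))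
      obtain ⟨M, hM⟩ := (hT Z hZp).2.bddAbove_range
      have hs1 : Summable fun n => rtr (psi μ ζ (J + 1) (N₀ (U^[n] σ))) :=
        Summable.of_nonneg_of_le (fun n => rtr_nonneg (psi_posSemidef hμ hζ (hgood n).psd _))
          (fun n => rtr_mono (hsub n J Z hZ)) hs
      have hk : 0 < ζ ^ (J + 1) / μ (J + 1) := div_pos (pow_pos hζ _) (hμ.1 _ (by omega))
      -- Each term is at most the potential plus the trace of the companion. The former have bounded
      -- partial sums by `hpart`, with `M` bounding the mass inside, and the latter are summable.
      have hs2 : Summable fun n => ζ ^ (J + 1) / μ (J + 1) * rtr (beta (N₀ (U^[n] σ)) (J + 1)) := by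
        refine summable_of_sum_range_le (c := slack μ ζ J σ Z + M + ∑' n, rtr (E₀ (T^[n] Z)))
          (fun n => mul_nonneg hk.le (rtr_nonneg (beta_posSemidef (hgood n).psd _))) fun K => ?_
        have h1 := hpart K J Z hZ
        have h2 : rtr (T^[K] Z) ≤ M := hM ⟨K, rfl⟩
        have h3 := hs.sum_le_tsum (Finset.range K) fun n _ => hE0 n
        have h4 := Finset.sum_le_sum fun n (_ : n ∈ Finset.range K) =>
          rtr_beta_le_slack hμ hζ (hgood n).psd J (E₀ (T^[n] Z))
        rw [Finset.sum_add_distrib] at h4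
        linarith
      rw [summable_mul_left_iff hk.ne'] at hs2
      exact Summable.of_nonneg_of_le (fun n => PSD.diag_re_nonneg (hgood n).psd _)
        (fun n => hle _ (hgood n) x c a b) ((hs1.mul_left C).add hs2)
  have hsum : ∀ z z', HasSum (fun n => N₀ (U^[n] σ) z z') (∑' n, N₀ (U^[n] σ) z z') := fun z z' =>
    (Summable.of_norm_bounded ((hdiag z).add (hdiag z')) fun n =>
      PSD.norm_le (hgood n).psd z z').hasSum
  set τ : Matrix (Cfg (ext S)) (Cfg (ext S)) ℂ := fun x y => ∑' n : ℕ, N₀ (U^[n] σ) x y with hτ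
  have hblk := hasSum_blk (τ := τ) hsum
  have hpsi : ∀ J x y, HasSum (fun n => psi μ ζ J (N₀ (U^[n] σ)) x y) (psi μ ζ J τ x y) := by
    intro J x y
    simp_rw [psi, Matrix.sum_apply, Matrix.smul_apply, smul_eq_mul]
    exact hasSum_sum fun n _ => (hblk 0 0 _ x y).mul_left _
  have hbeta : ∀ i x y, HasSum (fun n => beta (N₀ (U^[n] σ)) i x y) (beta τ i x y) := fun i x y =>
    (hblk 1 0 i x y).add (hblk 1 1 i x y)
  refine ⟨⟨posSemidef_of_hasSum (fun n => (hgood n).psd) hsum, fun x r hr => ?_, fun n => ?_⟩, ?_⟩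
  · change ∑' n, N₀ (U^[n] σ) (mk x r) (mk x r) = 0
    simp_rw [(hgood _).neg x r hr, tsum_zero]
  · ext x y
    have h1 := (hblk 0 1 (n + 1) x y).mul_left (tail μ (n + 2) : ℂ)
    have h2 := (hblk 0 0 (n + 1) x y).mul_left (μ (n + 1) : ℂ)
    have h3 : (fun m => (tail μ (n + 2) : ℂ) * blk (N₀ (U^[m] σ)) 0 1 (n + 1) x y) =
        fun m => (μ (n + 1) : ℂ) * blk (N₀ (U^[m] σ)) 0 0 (n + 1) x y :=
      funext fun m => congrFun (congrFun ((hgood m).pure n) x) y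
    rw [h3] at h1
    exact h1.unique h2
  · intro J Z hZ
    have hZp := PSD.of_sub hZ (psi_posSemidef hμ hζ hσ.psd (J + 1))
    have hZs := hasSum_loopMap hE.pos₀ hTp hZp (hT Z hZp).1
    constructor
    · exact posSemidef_of_hasSum (fun n => hsub n J Z hZ) fun x y =>
        (hZs x y).sub (hpsi (J + 1) x y)
    · have hsl : HasSum (fun n => slack μ ζ J (N₀ (U^[n] σ)) (E₀ (T^[n] Z)))
          (slack μ ζ J τ (loopMap E₀ T Z)) :=
        (((hasSum_rtr (hbeta _)).mul_left _).add (hasSum_rtr (hpsi _))).sub (hasSum_rtr hZs)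
      have hlim := (hT Z hZp).2.const_add (slack μ ζ J σ Z)
      rw [add_zero] at hlim
      exact le_of_tendsto_of_tendsto' hsl.tendsto_sum_nat hlim fun K => hpart K J Z hZ

end SimLoop

/-! ### The operations on the additional variables -/

section Ops

variable {S : QSystem}

theorem mk_inj {x z : Cfg S} {r r' : Rest S} : mk x r = mk z r' ↔ x = z ∧ r = r' := by
  constructor
  · intro h
    have := (mkEquiv S).injective (a₁ := (x, r)) (a₂ := (z, r')) h
    exact Prod.mk.inj this
  · rintro ⟨rfl, rfl⟩
    rfl

/-- The label of `q₁`. -/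
def bit₁ (z : Cfg (ext S)) : Fin 2 := z .q₁

/-- The label of `q₂`. -/
def bit₂ (z : Cfg (ext S)) : Fin 2 := z .q₂

/-- The label of the counter. -/
def counter (z : Cfg (ext S)) : ℤ := z .qc

/-- Overwrite the labels of `q₁`, `q₂`, `q_c`. -/
def upd (z : Cfg (ext S)) (a b : Fin 2) (i : ℤ) : Cfg (ext S) :=
  mk (fun v => z (.orig v)) (fun v => z (.copy v), a, b, i)

theorem agree_qc (x z : Cfg S) (r r' : Rest S) :
    (∀ v, (∀ i, reg1 S .qc i ≠ v) → mk x r v = mk z r' v) ↔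
      x = z ∧ r.1 = r'.1 ∧ r.2.1 = r'.2.1 ∧ r.2.2.1 = r'.2.2.1 := by
  constructor
  · intro h
    exact ⟨funext fun v => h (.orig v) (fun i e => by cases i; cases e), funext fun v => h (.copy v) (fun i e => by cases i; cases e),
      h .q₁ (fun i e => by cases i; cases e), h .q₂ (fun i e => by cases i; cases e)⟩
  · rintro ⟨h1, h2, h3, h4⟩ v hv
    cases v with
    | orig v => exact congrFun h1 v
    | copy v => exact congrFun h2 v
    | q₁ => exact h3
    | q₂ => exact h4
    | qc => exact absurd rfl (hv ())

theorem agree_q₁ (x z : Cfg S) (r r' : Rest S) :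
    (∀ v, (∀ i, reg1 S .q₁ i ≠ v) → mk x r v = mk z r' v) ↔
      x = z ∧ r.1 = r'.1 ∧ r.2.2.1 = r'.2.2.1 ∧ r.2.2.2 = r'.2.2.2 := by
  constructor
  · intro h
    exact ⟨funext fun v => h (.orig v) (fun i e => by cases i; cases e), funext fun v => h (.copy v) (fun i e => by cases i; cases e),
      h .q₂ (fun i e => by cases i; cases e), h .qc (fun i e => by cases i; cases e)⟩
  · rintro ⟨h1, h2, h3, h4⟩ v hv
    cases v with
    | orig v => exact congrFun h1 v
    | copy v => exact congrFun h2 v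
    | q₁ => exact absurd rfl (hv ())
    | q₂ => exact h3
    | qc => exact h4

theorem agree_qc_q₂ (x z : Cfg S) (r r' : Rest S) :
    (∀ v, (∀ i, reg2 S .qc .q₂ i ≠ v) → mk x r v = mk z r' v) ↔
      x = z ∧ r.1 = r'.1 ∧ r.2.1 = r'.2.1 := by
  constructor
  · intro h
    exact ⟨funext fun v => h (.orig v) (fun i e => by rcases i with _ | _ <;> cases e), funext fun v => h (.copy v) (fun i e => by rcases i with _ | _ <;> cases e),
      h .q₁ (fun i e => by rcases i with _ | _ <;> cases e)⟩
  · rintro ⟨h1, h2, h3⟩ v hv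
    cases v with
    | orig v => exact congrFun h1 v
    | copy v => exact congrFun h2 v
    | q₁ => exact h3
    | q₂ => exact absurd rfl (hv (.inr ()))
    | qc => exact absurd rfl (hv (.inl ()))

theorem agree_q₁_q₂ (x z : Cfg S) (r r' : Rest S) :
    (∀ v, (∀ i, reg2 S .q₁ .q₂ i ≠ v) → mk x r v = mk z r' v) ↔
      x = z ∧ r.1 = r'.1 ∧ r.2.2.2 = r'.2.2.2 := by
  constructor
  · intro h
    exact ⟨funext fun v => h (.orig v) (fun i e => by rcases i with _ | _ <;> cases e), funext fun v => h (.copy v) (fun i e => by rcases i with _ | _ <;> cases e),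
      h .qc (fun i e => by rcases i with _ | _ <;> cases e)⟩
  · rintro ⟨h1, h2, h3⟩ v hv
    cases v with
    | orig v => exact congrFun h1 v
    | copy v => exact congrFun h2 v
    | q₁ => exact absurd rfl (hv (.inl ()))
    | q₂ => exact absurd rfl (hv (.inr ()))
    | qc => exact h3

open Classical in
theorem lift_opC (x z c c' : Cfg S) (a b a' b' : Fin 2) (i i' : ℤ) :
    lift (reg1 S .qc) (opC S) (mk x (c, a, b, i)) (mk z (c', a', b', i')) =
      if (x = z ∧ c = c' ∧ a = a' ∧ b = b') ∧ 0 ≤ i' ∧ i = i' + 1 then 1 else 0 := by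
  unfold lift
  rw [if_congr (agree_qc x z (c, a, b, i) (c', a', b', i')) rfl rfl]
  change (if _ then (if 0 ≤ i' ∧ i = i' + 1 then (1 : ℂ) else 0) else 0) = _
  rw [← ite_and]

/-- A branch records where a row reads from: counter `i` is fed by counter `i - 1`, and only for `1
≤ i`, because `C` annihilates negative counters. -/
theorem isBranch_opC : IsBranch (κ := Unit) (lift (reg1 S .qc) (opC S))
    (fun _ z => upd z (bit₁ z) (bit₂ z) (counter z - 1))
    (fun _ z => if 1 ≤ counter z then 1 else 0) := by
  classical
  intro z z'
  obtain ⟨x, ⟨c, a, b, i⟩, rfl⟩ := exists_mk z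
  obtain ⟨x', ⟨c', a', b', i'⟩, rfl⟩ := exists_mk z'
  rw [lift_opC, Fintype.sum_unique]
  change _ = if mk x' (c', a', b', i') = mk x (c, a, b, i - 1) then (if 1 ≤ i then (1 : ℂ) else 0) else 0
  rw [← ite_and]
  refine if_congr ?_ rfl rfl
  rw [mk_inj]
  simp only [Prod.mk.injEq]
  constructor
  · rintro ⟨⟨rfl, rfl, rfl, rfl⟩, h1, rfl⟩
    exact ⟨⟨rfl, rfl, rfl, rfl, by omega⟩, by omega⟩
  · rintro ⟨⟨rfl, rfl, rfl, rfl, rfl⟩, h⟩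
    exact ⟨⟨rfl, rfl, rfl, rfl⟩, by omega, by omega⟩

/-- The rotation angle for the counter `i`. -/
def gpRy (μ : ℕ → ℝ) (i : ℤ) : Matrix (Fin 2) (Fin 2) ℂ :=
  Ry (2 * Real.arcsin (Real.sqrt (bCoeff μ i.toNat)))

open Classical in
theorem lift_opGP (μ : ℕ → ℝ) (x z c c' : Cfg S) (a b a' b' : Fin 2) (i i' : ℤ) :
    lift (reg2 S .qc .q₂) (opGP S μ) (mk x (c, a, b, i)) (mk z (c', a', b', i')) =
      if (x = z ∧ c = c' ∧ a = a') ∧ i = i' ∧ 1 ≤ i' then gpRy μ i' b b' else 0 := by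
  unfold lift
  rw [if_congr (agree_qc_q₂ x z (c, a, b, i) (c', a', b', i')) rfl rfl]
  change (if _ then (if i = i' ∧ 1 ≤ i' then gpRy μ i' b b' else 0) else 0) = _
  rw [← ite_and]

theorem isBranch_opGP (μ : ℕ → ℝ) : IsBranch (κ := Fin 2) (lift (reg2 S .qc .q₂) (opGP S μ))
    (fun b z => upd z (bit₁ z) b (counter z))
    (fun b z => if 1 ≤ counter z then gpRy μ (counter z) (bit₂ z) b else 0) := by
  classical
  intro z z'
  obtain ⟨x, ⟨c, a, b, i⟩, rfl⟩ := exists_mk z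
  obtain ⟨x', ⟨c', a', b', i'⟩, rfl⟩ := exists_mk z'
  rw [lift_opGP]
  have : ∀ k : Fin 2, (if mk x' (c', a', b', i') = mk x (c, a, k, i) then
      (if 1 ≤ i then gpRy μ i b k else 0) else 0) =
      if b' = k then (if (x = x' ∧ c = c' ∧ a = a') ∧ i = i' ∧ 1 ≤ i' then gpRy μ i' b b' else 0)
        else 0 := by
    intro k
    rw [← ite_and, ← ite_and]
    by_cases h : b' = k
    · subst h
      by_cases h2 : i = i'
      · subst h2
        refine if_congr ?_ rfl rfl
        rw [mk_inj]
        simp only [Prod.mk.injEq, true_and, and_true]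
        constructor
        · rintro ⟨⟨rfl, rfl, rfl⟩, h⟩
          exact ⟨⟨rfl, rfl, rfl⟩, h⟩
        · rintro ⟨⟨rfl, rfl, rfl⟩, h⟩
          exact ⟨⟨rfl, rfl, rfl⟩, h⟩
      · rw [if_neg, if_neg]
        · tauto
        · rw [mk_inj]
          simp only [Prod.mk.injEq]
          rintro ⟨⟨_, _, _, _, h⟩, _⟩
          exact h2 h.symm
    · rw [if_neg, if_neg]
      · tauto
      · rw [mk_inj]
        simp only [Prod.mk.injEq]
        tauto
  refine Eq.trans ?_ (Finset.sum_congr rfl fun k _ => (this k).symm)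
  rw [Finset.sum_ite_eq]
  simp

/-- The outcomes of the measurement of `q₁, q₂`. -/
def outcome (m : Fin 3) (a b : Fin 2) : Prop :=
  (m = 0 ∧ a = 0 ∧ b = 0) ∨ (m = 1 ∧ a = 0 ∧ b = 1) ∨ (m = 2 ∧ a = 1)

open Classical in
theorem lift_opM (m : Fin 3) (x z c c' : Cfg S) (a b a' b' : Fin 2) (i i' : ℤ) :
    lift (reg2 S .q₁ .q₂) (opM S m) (mk x (c, a, b, i)) (mk z (c', a', b', i')) =
      if (x = z ∧ c = c' ∧ i = i') ∧ (a = a' ∧ b = b') ∧ outcome m a b then 1 else 0 := by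
  unfold lift
  rw [if_congr (agree_q₁_q₂ x z (c, a, b, i) (c', a', b', i')) rfl rfl]
  have : opM S m (readReg (reg2 S .q₁ .q₂) (mk x (c, a, b, i)))
      (readReg (reg2 S .q₁ .q₂) (mk z (c', a', b', i'))) =
      if (a = a' ∧ b = b') ∧ outcome m a b then (1 : ℂ) else 0 := by
    change (if (a = a' ∧ b = b') ∧ ((m = 0 ∧ a = 0 ∧ b = 0) ∨ (m = 1 ∧ a = 0 ∧ b = 1) ∨
      (m = 2 ∧ a = 1)) then (1 : ℂ) else 0) = _
    exact if_congr Iff.rfl rfl rfl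
  rw [this]
  rw [← ite_and]

open Classical in
theorem isBranch_opM (m : Fin 3) : IsBranch (κ := Unit) (lift (reg2 S .q₁ .q₂) (opM S m))
    (fun _ z => z) (fun _ z => if outcome m (bit₁ z) (bit₂ z) then 1 else 0) := by
  intro z z'
  obtain ⟨x, ⟨c, a, b, i⟩, rfl⟩ := exists_mk z
  obtain ⟨x', ⟨c', a', b', i'⟩, rfl⟩ := exists_mk z'
  rw [lift_opM, Fintype.sum_unique]
  change _ = if mk x' (c', a', b', i') = mk x (c, a, b, i) then
    (if outcome m a b then (1 : ℂ) else 0) else 0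
  rw [← ite_and]
  refine if_congr ?_ rfl rfl
  rw [mk_inj]
  simp only [Prod.mk.injEq]
  constructor
  · rintro ⟨⟨rfl, rfl, rfl⟩, ⟨rfl, rfl⟩, h⟩
    exact ⟨⟨rfl, rfl, rfl, rfl, rfl⟩, h⟩
  · rintro ⟨⟨rfl, rfl, rfl, rfl, rfl⟩, h⟩
    exact ⟨⟨rfl, rfl, rfl⟩, ⟨rfl, rfl⟩, h⟩

open Classical in
theorem lift_opX (x z c c' : Cfg S) (a b a' b' : Fin 2) (i i' : ℤ) :
    lift (reg1 S .q₁) (opX S) (mk x (c, a, b, i)) (mk z (c', a', b', i')) =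
      if (x = z ∧ c = c' ∧ b = b' ∧ i = i') ∧ a ≠ a' then 1 else 0 := by
  unfold lift
  rw [if_congr (agree_q₁ x z (c, a, b, i) (c', a', b', i')) rfl rfl]
  change (if _ then (if a ≠ a' then (1 : ℂ) else 0) else 0) = _
  rw [← ite_and]

theorem isBranch_opX : IsBranch (κ := Unit) (lift (reg1 S .q₁) (opX S))
    (fun _ z => upd z (1 - bit₁ z) (bit₂ z) (counter z)) (fun _ _ => 1) := by
  classical
  intro z z'
  obtain ⟨x, ⟨c, a, b, i⟩, rfl⟩ := exists_mk z
  obtain ⟨x', ⟨c', a', b', i'⟩, rfl⟩ := exists_mk z'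
  rw [lift_opX, Fintype.sum_unique]
  change _ = if mk x' (c', a', b', i') = mk x (c, 1 - a, b, i) then (1 : ℂ) else 0
  refine if_congr ?_ rfl rfl
  rw [mk_inj]
  simp only [Prod.mk.injEq]
  have ha : a ≠ a' ↔ a' = 1 - a := by
    fin_cases a <;> fin_cases a' <;> simp
  rw [ha]
  constructor
  · rintro ⟨⟨rfl, rfl, rfl, rfl⟩, h⟩
    exact ⟨rfl, rfl, h, rfl, rfl⟩
  · rintro ⟨rfl, rfl, h, rfl, rfl⟩
    exact ⟨⟨rfl, rfl, rfl, rfl⟩, h⟩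

end Ops

section Gadget

variable {S : QSystem}

/-! ### The controlled swap -/

section Swap

variable {ι : Type} {q : ι → S.Var}

theorem finite_rcfg_regPair [Finite (RCfg q)] : Finite (RCfg (regPair S q)) := by
  refine Finite.of_injective (β := RCfg q × RCfg q)
    (fun w => (fun i => w (.inl i), fun i => w (.inr i))) fun w w' h => ?_
  funext k
  rcases k with k | k
  · exact congrFun (Prod.mk.inj h).1 k
  · exact congrFun (Prod.mk.inj h).2 k

theorem regSwap_injective (hq : Function.Injective q) : Function.Injective (regSwap S q) := by
  rintro (⟨⟩ | i | i) (⟨⟩ | j | j) h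
  · rfl
  · cases h
  · cases h
  · cases h
  · exact congrArg (fun k => Sum.inr (Sum.inl k)) (hq (DVar.orig.inj h))
  · cases h
  · cases h
  · cases h
  · exact congrArg (fun k => Sum.inr (Sum.inr k)) (hq (DVar.copy.inj h))

/-- The parts of a label of the register `q₂, q̄, q̄'`. -/
def swapEquiv (q : ι → S.Var) : RCfg (regSwap S q) ≃ Fin 2 × RCfg (regPair S q) where
  toFun w := (w (.inl ()), pairPart S q w)
  invFun p
    | .inl () => p.1
    | .inr (.inl i) => p.2 (.inl i)
    | .inr (.inr i) => p.2 (.inr i)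
  left_inv w := by
    funext k
    rcases k with ⟨⟩ | k | k <;> rfl
  right_inv p := by
    refine Prod.ext rfl ?_
    funext k
    rcases k with k | k <;> rfl

theorem finite_rcfg_regSwap [Finite (RCfg q)] : Finite (RCfg (regSwap S q)) :=
  have := finite_rcfg_regPair (q := q)
  Finite.of_equiv _ (swapEquiv q).symm

theorem opSwap_conjTranspose : (opSwap S q)ᴴ = opSwap S q := by
  classical
  ext x y
  rw [Matrix.conjTranspose_apply]
  unfold opSwap
  simp only [apply_ite (star : ℂ → ℂ), star_one, star_zero]
  congr 1
  exact propext ⟨fun h => ⟨h.2.symm, h.1.symm⟩, fun h => ⟨h.2.symm, h.1.symm⟩⟩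

/-- The two branches of the controlled swap. -/
def swapExp (q : ι → S.Var) (a : Fin 2) : Matrix (RCfg (regPair S q)) (RCfg (regPair S q)) ℂ :=
  if a = 0 then iexp ((-(Complex.I * ((Real.pi / 4 : ℝ) : ℂ))) • opSwap S q)
  else iexp ((Complex.I * ((Real.pi / 4 : ℝ) : ℂ)) • opSwap S q)

theorem isUnitary_swapExp [Finite (RCfg q)] (a : Fin 2) : IsUnitary (swapExp q a) := by
  have := finite_rcfg_regPair (q := q)
  unfold swapExp
  split_ifs <;>
  · refine isUnitary_iexp ?_
    rw [Matrix.conjTranspose_smul, opSwap_conjTranspose, ← neg_smul]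
    congr 1
    simp

theorem opAS_apply (x y : RCfg (regSwap S q)) :
    opAS S q x y = if (swapEquiv q x).1 = (swapEquiv q y).1 then
      swapExp q (swapEquiv q x).1 (swapEquiv q x).2 (swapEquiv q y).2 else 0 := by
  unfold swapExp
  by_cases h : (swapEquiv q x).1 = 0
  · rw [if_pos h]
    change (if (swapEquiv q x).1 = (swapEquiv q y).1 then (if (swapEquiv q x).1 = 0 then _ else _)
      else _) = _
    rw [if_pos h]
    rfl
  · rw [if_neg h]
    change (if (swapEquiv q x).1 = (swapEquiv q y).1 then (if (swapEquiv q x).1 = 0 then _ else _)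
      else _) = _
    rw [if_neg h]
    rfl

-- Block diagonal in `q₂`, with blocks that are exponentials of skew-Hermitian matrices. This
-- isometry property is the only fact about the controlled swap that enters the bounds.
open Classical in
theorem opAS_isometry [Fintype (RCfg (regSwap S q))] [Finite (RCfg q)] :
    (opAS S q)ᴴ * opAS S q = 1 := by
  have := finite_rcfg_regPair (q := q)
  have := Fintype.ofFinite (RCfg (regPair S q))
  ext x y
  rw [Matrix.mul_apply, ← (swapEquiv q).symm.sum_comp, Fintype.sum_prod_type]
  simp only [Matrix.conjTranspose_apply, opAS_apply, Equiv.apply_symm_apply]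
  rw [Matrix.one_apply]
  set a := (swapEquiv q x).1 with ha
  rw [Finset.sum_eq_single a]
  · simp only [if_true]
    have hu := congrFun (congrFun (isUnitary_swapExp (q := q) a).1 (swapEquiv q x).2) (swapEquiv q y).2
    rw [imul_eq_mul, Matrix.mul_apply, iid_eq_one, Matrix.one_apply] at hu
    simp only [Matrix.conjTranspose_apply] at hu
    by_cases h : a = (swapEquiv q y).1
    · simp only [if_pos h]
      rw [hu]
      refine if_congr ?_ rfl rfl
      rw [← (swapEquiv q).apply_eq_iff_eq (x := x) (y := y), Prod.ext_iff]
      exact ⟨fun h' => ⟨h, h'⟩, fun h' => h'.2⟩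
    · simp only [if_neg h, mul_zero, Finset.sum_const_zero]
      rw [if_neg]
      rintro rfl
      exact h rfl
  · intro b _ hb
    exact Finset.sum_eq_zero fun p _ => by rw [if_neg hb, star_zero, zero_mul]
  · simp

end Swap

/-! ### The statements inserted before a rotation -/

/-- The measurement of `q₁, q₂` with outcome `m`. -/
def measQ (m : Fin 3) : Matrix (Cfg (ext S)) (Cfg (ext S)) ℂ → Matrix (Cfg (ext S)) (Cfg (ext S)) ℂ :=
  conj (lift (reg2 S .q₁ .q₂) (opM S m))

/-- `q_c := C[q_c]; q_c, q₂ := GP[q_c, q₂]` -/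
def countStep (μ : ℕ → ℝ) (σ : Matrix (Cfg (ext S)) (Cfg (ext S)) ℂ) :
    Matrix (Cfg (ext S)) (Cfg (ext S)) ℂ :=
  conj (lift (reg2 S .qc .q₂) (opGP S μ)) (conj (lift (reg1 S .qc) (opC S)) σ)

/-- `q₁ := X[q₁]; q₂ := I/2; q̄' := τ; q₂, q̄, q̄' := AS[q₂, q̄, q̄']` -/
def copyStep {ι : Type} (q : ι → S.Var) (τ : Matrix (RCfg q) (RCfg q) ℂ)
    (σ : Matrix (Cfg (ext S)) (Cfg (ext S)) ℂ) : Matrix (Cfg (ext S)) (Cfg (ext S)) ℂ :=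
  conj (lift (regSwap S q) (opAS S q)) (resetReg (regCopy S q) τ
    (resetReg (reg1 S .q₂) (halfId S) (conj (lift (reg1 S .q₁) (opX S)) σ)))

theorem measQ_posSemidef (m : Fin 3) {σ : Matrix (Cfg (ext S)) (Cfg (ext S)) ℂ}
    (hσ : σ.PosSemidef) : (measQ m σ).PosSemidef :=
  conj_posSemidef (isBranch_opM m) hσ

theorem countStep_posSemidef (μ : ℕ → ℝ) {σ : Matrix (Cfg (ext S)) (Cfg (ext S)) ℂ}
    (hσ : σ.PosSemidef) : (countStep μ σ).PosSemidef :=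
  conj_posSemidef (isBranch_opGP μ) (conj_posSemidef isBranch_opC hσ)

open Classical in
theorem measQ_apply (m : Fin 3) (σ : Matrix (Cfg (ext S)) (Cfg (ext S)) ℂ) (z z' : Cfg (ext S)) :
    measQ m σ z z' = if outcome m (bit₁ z) (bit₂ z) ∧ outcome m (bit₁ z') (bit₂ z') then σ z z'
      else 0 := by
  rw [measQ, conj_apply (isBranch_opM m), Fintype.sum_unique, Fintype.sum_unique]
  by_cases h1 : outcome m (bit₁ z) (bit₂ z) <;> by_cases h2 : outcome m (bit₁ z') (bit₂ z') <;>
    simp [h1, h2]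

theorem countStep_apply (μ : ℕ → ℝ) (σ : Matrix (Cfg (ext S)) (Cfg (ext S)) ℂ) (x y c : Cfg S)
    (a b : Fin 2) (i : ℤ) :
    countStep μ σ (mk x (c, a, b, i)) (mk y (c, a, b, i)) = if 1 ≤ i then
      ∑ k, ∑ k', gpRy μ i b k * σ (mk x (c, a, k, i - 1)) (mk y (c, a, k', i - 1)) *
        star (gpRy μ i b k') else 0 := by
  rw [countStep, conj_apply (isBranch_opGP μ)]
  have hc : ∀ z : Cfg S, ∀ k, upd (mk z (c, a, b, i)) (bit₁ (mk z (c, a, b, i))) k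
      (counter (mk z (c, a, b, i))) = mk z (c, a, k, i) := fun _ _ => rfl
  have hb : ∀ z : Cfg S, ∀ k, upd (mk z (c, a, k, i)) (bit₁ (mk z (c, a, k, i)))
      (bit₂ (mk z (c, a, k, i))) (counter (mk z (c, a, k, i)) - 1) = mk z (c, a, k, i - 1) :=
    fun _ _ => rfl
  have hi : ∀ z : Cfg S, ∀ k, counter (mk z (c, a, k, i)) = i := fun _ _ => rfl
  have h2 : ∀ z : Cfg S, bit₂ (mk z (c, a, b, i)) = b := fun _ => rfl
  simp only [hc, conj_apply isBranch_opC, Fintype.sum_unique, hb, h2]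
  simp only [hi]
  split_ifs with h
  · simp
  · simp

/-- After outcome `0` only `q₂ = |0⟩` is populated, so only the first column of the rotation
matters. -/
theorem countStep_measQ (μ : ℕ → ℝ) (σ : Matrix (Cfg (ext S)) (Cfg (ext S)) ℂ) (c : Cfg S)
    (a b : Fin 2) (i : ℤ) :
    sl (countStep μ (measQ 0 σ)) (c, a, b, i) (c, a, b, i) = if a = 0 ∧ 1 ≤ i then
      (gpRy μ i b 0 * star (gpRy μ i b 0)) • sl σ (c, 0, 0, i - 1) (c, 0, 0, i - 1) else 0 := by
  ext x y
  rw [sl_apply, countStep_apply]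
  have ho : ∀ (z : Cfg S) (k : Fin 2), outcome 0 (bit₁ (mk z (c, a, k, i - 1)))
      (bit₂ (mk z (c, a, k, i - 1))) ↔ a = 0 ∧ k = 0 := by
    intro z k
    change outcome 0 a k ↔ _
    simp [outcome]
  simp only [measQ_apply, ho]
  by_cases h1 : 1 ≤ i
  · by_cases ha : a = 0
    · subst ha
      rw [if_pos h1, if_pos ⟨rfl, h1⟩]
      simp [Fin.sum_univ_two, Matrix.smul_apply, sl_apply]
      ring
    · rw [if_pos h1, if_neg (fun h => ha h.1)]
      simp [ha]
  · rw [if_neg h1, if_neg (fun h => h1 h.2)]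
    rfl

variable [Fintype (Cfg S)]

theorem blk_countStep_measQ (μ : ℕ → ℝ) (σ : Matrix (Cfg (ext S)) (Cfg (ext S)) ℂ)
    (a b : Fin 2) (i : ℤ) :
    blk (countStep μ (measQ 0 σ)) a b i = if a = 0 ∧ 1 ≤ i then
      (gpRy μ i b 0 * star (gpRy μ i b 0)) • blk σ 0 0 (i - 1) else 0 := by
  simp_rw [blk, countStep_measQ]
  split_ifs
  · rw [Finset.smul_sum]
  · simp

theorem bCoeff_eq (μ : ℕ → ℝ) (n : ℕ) : bCoeff μ (n + 1) = μ (n + 1) / tail μ (n + 1) := rfl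

/-- `cos² (arcsin √b) = 1 - b`, and for `b = μ(n+1) / tail(n+1)` the complement is a quotient of
consecutive tails: the conditional probability of not stopping at this counter. -/
theorem gpRy_zero {μ : ℕ → ℝ} (hμ : IsPosDistribution μ) (n : ℕ) :
    gpRy μ ((n : ℤ) + 1) 0 0 * star (gpRy μ ((n : ℤ) + 1) 0 0) =
      ((tail μ (n + 2) / tail μ (n + 1) : ℝ) : ℂ) := by
  have h1 := tail_pos hμ n
  have h2 := tail_pos hμ (n + 1)
  have h3 := tail_succ μ n
  have h4 := hμ.1 (n + 1) (by omega)
  have hb0 : 0 ≤ bCoeff μ (n + 1) := by rw [bCoeff_eq]; positivity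
  have hb1 : bCoeff μ (n + 1) ≤ 1 := by rw [bCoeff_eq, div_le_one h1]; linarith
  have hn : ((n : ℤ) + 1).toNat = n + 1 := by omega
  have hr : gpRy μ ((n : ℤ) + 1) 0 0 =
      (Real.cos (Real.arcsin (Real.sqrt (bCoeff μ (n + 1)))) : ℂ) := by
    simp [gpRy, Ry, hn]
  rw [hr, Complex.star_def, Complex.conj_ofReal, ← Complex.ofReal_mul, ← pow_two,
    Real.cos_arcsin, Real.sq_sqrt (by rw [Real.sq_sqrt hb0]; linarith), Real.sq_sqrt hb0, bCoeff_eq, h3]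
  congr 1
  field_simp

theorem gpRy_one {μ : ℕ → ℝ} (hμ : IsPosDistribution μ) (n : ℕ) :
    gpRy μ ((n : ℤ) + 1) 1 0 * star (gpRy μ ((n : ℤ) + 1) 1 0) =
      ((μ (n + 1) / tail μ (n + 1) : ℝ) : ℂ) := by
  have h1 := tail_pos hμ n
  have h2 := tail_pos hμ (n + 1)
  have h3 := tail_succ μ n
  have h4 := hμ.1 (n + 1) (by omega)
  have hb0 : 0 ≤ bCoeff μ (n + 1) := by rw [bCoeff_eq]; positivity
  have hb1 : bCoeff μ (n + 1) ≤ 1 := by rw [bCoeff_eq, div_le_one h1]; linarith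
  have hn : ((n : ℤ) + 1).toNat = n + 1 := by omega
  have hr : gpRy μ ((n : ℤ) + 1) 1 0 =
      (Real.sin (Real.arcsin (Real.sqrt (bCoeff μ (n + 1)))) : ℂ) := by
    simp [gpRy, Ry, hn]
  rw [hr, Complex.star_def, Complex.conj_ofReal, ← Complex.ofReal_mul, ← pow_two,
    Real.sin_arcsin (by linarith [Real.sqrt_nonneg (bCoeff μ (n + 1))])
      (Real.sqrt_le_iff.2 ⟨zero_le_one, by simpa using hb1⟩), Real.sq_sqrt hb0, bCoeff_eq]

/-- Labels with given `q₁` and counter. -/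
def emb (a : Fin 2) (i : ℤ) (d : Cfg S × Cfg S × Fin 2) : Cfg (ext S) := mk d.1 (d.2.1, a, d.2.2, i)

/-- The trace of the part with given `q₁` and counter. -/
def btr (σ : Matrix (Cfg (ext S)) (Cfg (ext S)) ℂ) (a : Fin 2) (i : ℤ) : ℂ :=
  ∑ d, σ (emb a i d) (emb a i d)

theorem regClosed_emb {ι : Type} {q : ι → (ext S).Var} (a : Fin 2) (i : ℤ)
    (h1 : ∀ k, q k ≠ DVar.q₁) (hc : ∀ k, q k ≠ DVar.qc) : RegClosed q (emb (S := S) a i) := by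
  constructor
  · rintro ⟨x, c, b⟩ ⟨x', c', b'⟩ h
    have := mk_inj.1 h
    simp only [Prod.mk.injEq, true_and, and_true] at this
    simp [this.1, this.2.1, this.2.2]
  · rintro ⟨x, c, b⟩ w
    set z := setReg q (emb a i (x, c, b)) w with hz
    refine ⟨(fun v => z (.orig v), fun v => z (.copy v), z .q₂), ?_⟩
    funext v
    cases v with
    | q₁ => exact (setReg_of_notMem q (emb a i (x, c, b)) w DVar.q₁ h1).symm
    | qc => exact (setReg_of_notMem q (emb a i (x, c, b)) w DVar.qc hc).symm
    | _ => rfl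

theorem btr_eq (σ : Matrix (Cfg (ext S)) (Cfg (ext S)) ℂ) (a : Fin 2) (i : ℤ) :
    (btr σ a i).re = rtr (blk σ a 0 i) + rtr (blk σ a 1 i) := by
  simp only [btr, blk, rtr_eq_sum, emb, Fintype.sum_prod_type, Fin.sum_univ_two, Matrix.sum_apply,
    Complex.re_sum, Complex.add_re, Finset.sum_add_distrib]
  rfl

theorem isDensity_halfId : IsDensity (halfId S) := by
  classical
  have e : ∀ x y : RCfg (reg1 S .q₂), halfId S x y = if x = y then 1 / 2 else 0 := by
    intro x y
    have : (x = y) ↔ ((x () : Fin 2) = (y () : Fin 2)) :=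
      ⟨fun h => by rw [h], fun h => funext fun _ => h⟩
    by_cases h : x = y
    · rw [if_pos h]
      exact if_pos (this.1 h)
    · rw [if_neg h]
      exact if_neg fun h' => h (this.2 h')
  constructor
  · have : halfId S = ((1 / 2 : ℝ) : ℂ) • (1 : Matrix (RCfg (reg1 S .q₂)) (RCfg (reg1 S .q₂)) ℂ) := by
      ext x y
      rw [e, Matrix.smul_apply, Matrix.one_apply]
      simp
    rw [this]
    exact PSD.smul Matrix.PosSemidef.one (by norm_num)
  · let eq : RCfg (reg1 S .q₂) ≃ Fin 2 := Equiv.funUnique Unit (Fin 2)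
    rw [← eq.symm.hasSum_iff]
    convert hasSum_fintype (fun _ : Fin 2 => (1 / 2 : ℂ)) using 1
    · funext a
      simp [e]
    · simp

variable {ι : Type} {q : ι → S.Var} {τ : Matrix (RCfg q) (RCfg q) ℂ}

theorem regCopy_injective (hq : Function.Injective q) : Function.Injective (regCopy S q) :=
  fun _ _ h => hq (DVar.copy.inj h)

theorem finite_rcfg_q₂ : Finite (RCfg (reg1 S .q₂)) :=
  inferInstanceAs (Finite (Unit → Fin 2))

theorem copyStep_posSemidef (hq : Function.Injective q) (hτ : IsDensity τ)
    {σ : Matrix (Cfg (ext S)) (Cfg (ext S)) ℂ} (hσ : σ.PosSemidef) : (copyStep q τ σ).PosSemidef := by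
  have hfin : Finite (RCfg q) := finite_rcfg hq
  have : Finite (RCfg (regCopy S q)) := hfin
  have := finite_rcfg_regSwap (q := q)
  have := finite_rcfg_q₂ (S := S)
  refine conj_lift_posSemidef' (regSwap_injective hq) _ ?_
  refine resetReg_posSemidef' (regCopy_injective hq) hτ ?_
  refine resetReg_posSemidef' (fun _ _ _ => rfl) isDensity_halfId ?_
  exact conj_posSemidef isBranch_opX hσ

/-- Only `X` touches `q₁`. The resets and the controlled swap act on registers disjoint from `q₁`
and the counter, so by local trace preservation they do not change this mass. -/
theorem btr_copyStep (hq : Function.Injective q) (hτ : IsDensity τ)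
    (σ : Matrix (Cfg (ext S)) (Cfg (ext S)) ℂ) (a : Fin 2) (i : ℤ) :
    btr (copyStep q τ σ) a i = btr σ (1 - a) i := by
  classical
  have hfin : Finite (RCfg q) := finite_rcfg hq
  have : Finite (RCfg (regCopy S q)) := hfin
  have := finite_rcfg_regSwap (q := q)
  have := finite_rcfg_q₂ (S := S)
  have := Fintype.ofFinite (RCfg (regCopy S q))
  have := Fintype.ofFinite (RCfg (regSwap S q))
  have := Fintype.ofFinite (RCfg (reg1 S .q₂))
  have h1 := sum_conj_lift (κ := Unit) (regSwap_injective hq)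
    (regClosed_emb (S := S) a i (q := regSwap S q) (by rintro (⟨⟩ | k | k) h <;> cases h)
      (by rintro (⟨⟩ | k | k) h <;> cases h)) (fun _ => opAS S q) (by simpa using opAS_isometry)
  have h2 := sum_resetReg (regCopy_injective hq) (regClosed_emb (S := S) a i (q := regCopy S q)
    (by rintro k h; cases h) (by rintro k h; cases h)) hτ
  have h3 := sum_resetReg (fun _ _ _ => rfl) (regClosed_emb (S := S) a i (q := reg1 S .q₂)
    (by rintro k h; cases h) (by rintro k h; cases h)) isDensity_halfId
  simp only [Fintype.sum_unique] at h1
  unfold btr copyStep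
  rw [h1, h2, h3]
  refine Finset.sum_congr rfl fun d _ => ?_
  rw [conj_apply isBranch_opX, Fintype.sum_unique, Fintype.sum_unique, one_mul, star_one, mul_one]
  rfl

theorem blk_add (σ σ' : Matrix (Cfg (ext S)) (Cfg (ext S)) ℂ) (a b : Fin 2) (i : ℤ) :
    blk (σ + σ') a b i = blk σ a b i + blk σ' a b i := by
  rw [blk, blk, blk, ← Finset.sum_add_distrib]
  rfl

open Classical in
theorem blk_measQ (m : Fin 3) (σ : Matrix (Cfg (ext S)) (Cfg (ext S)) ℂ) (a b : Fin 2) (i : ℤ) :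
    blk (measQ m σ) a b i = if outcome m a b then blk σ a b i else 0 := by
  have h : ∀ c : Cfg S, sl (measQ m σ) (c, a, b, i) (c, a, b, i) =
      if outcome m a b then sl σ (c, a, b, i) (c, a, b, i) else 0 := by
    intro c
    ext x y
    rw [sl_apply, measQ_apply]
    change (if outcome m a b ∧ outcome m a b then _ else _) = _
    by_cases h : outcome m a b
    · rw [if_pos ⟨h, h⟩, if_pos h, sl_apply]
    · rw [if_neg fun h' => h h'.1, if_neg h]
      rfl
  simp_rw [blk, h]
  split_ifs
  · rfl
  · simp

theorem rtr_beta_eq (σ : Matrix (Cfg (ext S)) (Cfg (ext S)) ℂ) (i : ℤ) :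
    rtr (beta σ i) = (btr σ 1 i).re := by
  rw [btr_eq, beta, rtr_add]

/-- The statements inserted before a rotation. -/
def gadget (μ : ℕ → ℝ) {ι : Type} (q : ι → S.Var) (τ : Matrix (RCfg q) (RCfg q) ℂ)
    (σ : Matrix (Cfg (ext S)) (Cfg (ext S)) ℂ) : Matrix (Cfg (ext S)) (Cfg (ext S)) ℂ :=
  countStep μ (measQ 0 σ) + copyStep q τ (measQ 1 σ) + measQ 2 σ

theorem Good.blk_eq_zero {μ : ℕ → ℝ} {σ : Matrix (Cfg (ext S)) (Cfg (ext S)) ℂ} (h : Good μ σ)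
    (a b : Fin 2) {i : ℤ} (hi : i ≤ 0) : blk σ a b i = 0 := by
  rw [blk]
  refine Finset.sum_eq_zero fun c _ => ?_
  ext x y
  refine PSD.eq_zero_of_diag (sl_posSemidef h.psd _) x y ?_
  rw [sl_apply, h.neg x _ hi, Complex.zero_re]

/-- A positive block without trace vanishes. Applied with `a = 0`: after outcome `1` all the mass
has been moved to `q₁ = |1⟩`. -/
theorem blk_copyStep_eq_zero (hq : Function.Injective q) (hτ : IsDensity τ)
    {σ : Matrix (Cfg (ext S)) (Cfg (ext S)) ℂ} (hσ : σ.PosSemidef) {a : Fin 2} {i : ℤ}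
    (h : (btr σ (1 - a) i).re = 0) (b : Fin 2) : blk (copyStep q τ σ) a b i = 0 := by
  have hp := fun b => blk_posSemidef (copyStep_posSemidef hq hτ hσ) a b i
  have h0 := fun b => rtr_nonneg (hp b)
  have h1 := btr_eq (copyStep q τ σ) a i
  rw [btr_copyStep hq hτ, h] at h1
  refine PSD.eq_zero_of_rtr (hp b) ?_
  have h2 := h0 0
  have h3 := h0 1
  fin_cases b <;> simp only [Fin.zero_eta, Fin.mk_one, Fin.isValue] <;> linarith

theorem btr_measQ_one (σ : Matrix (Cfg (ext S)) (Cfg (ext S)) ℂ) (a : Fin 2) (i : ℤ) :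
    (btr (measQ 1 σ) a i).re = if a = 0 then rtr (blk σ 0 1 i) else 0 := by
  have h0 : rtr (0 : Matrix (Cfg S) (Cfg S) ℂ) = 0 := rtr_zero
  rw [btr_eq, blk_measQ, blk_measQ]
  fin_cases a <;> simp [outcome, h0]

theorem gadget_posSemidef (μ : ℕ → ℝ) (hq : Function.Injective q) (hτ : IsDensity τ)
    {σ : Matrix (Cfg (ext S)) (Cfg (ext S)) ℂ} (hσ : σ.PosSemidef) :
    (gadget μ q τ σ).PosSemidef :=
  ((countStep_posSemidef μ (measQ_posSemidef 0 hσ)).add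
    (copyStep_posSemidef hq hτ (measQ_posSemidef 1 hσ))).add (measQ_posSemidef 2 hσ)

/-- Only the counting branch ends with `q₁ = |0⟩`: the copying branch flips `q₁` to `|1⟩`, and under
outcome `2` it is `|1⟩` already. -/
theorem blk_gadget_zero (μ : ℕ → ℝ) (hq : Function.Injective q) (hτ : IsDensity τ)
    {σ : Matrix (Cfg (ext S)) (Cfg (ext S)) ℂ} (hσ : σ.PosSemidef) (b : Fin 2) {i : ℤ}
    (hi : 1 ≤ i) : blk (gadget μ q τ σ) 0 b i =
      (gpRy μ i b 0 * star (gpRy μ i b 0)) • blk σ 0 0 (i - 1) := by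
  rw [gadget, blk_add, blk_add, blk_countStep_measQ, if_pos ⟨rfl, hi⟩,
    blk_copyStep_eq_zero hq hτ (measQ_posSemidef 1 hσ) (by rw [btr_measQ_one]; simp), blk_measQ,
    if_neg (by simp [outcome]), add_zero, add_zero]

/-- The gain is the mass of outcome `1`, at an unchanged counter, because copying does not touch the
counter. -/
theorem rtr_beta_gadget (μ : ℕ → ℝ) (hq : Function.Injective q) (hτ : IsDensity τ)
    (σ : Matrix (Cfg (ext S)) (Cfg (ext S)) ℂ) (i : ℤ) :
    rtr (beta (gadget μ q τ σ) i) = rtr (beta σ i) + rtr (blk σ 0 1 i) := by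
  have h1 : rtr (beta (copyStep q τ (measQ 1 σ)) i) = rtr (blk σ 0 1 i) := by
    rw [rtr_beta_eq, btr_copyStep hq hτ, btr_measQ_one]
    simp
  have h2 : beta (gadget μ q τ σ) i = beta (copyStep q τ (measQ 1 σ)) i + beta σ i := by
    simp only [beta, gadget, blk_add, blk_countStep_measQ, blk_measQ]
    simp [outcome]
    abel
  rw [h2, rtr_add, h1, add_comm]

theorem Good.gadget {μ : ℕ → ℝ} (hμ : IsPosDistribution μ) (hq : Function.Injective q)
    (hτ : IsDensity τ) {σ : Matrix (Cfg (ext S)) (Cfg (ext S)) ℂ} (hσ : Good μ σ) :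
    Good μ (QWhile.gadget μ q τ σ) := by
  have hp := gadget_posSemidef μ hq hτ hσ.psd
  refine ⟨hp, ?_, fun n => ?_⟩
  · rintro x ⟨c, a, b, i⟩ hi
    have hi' : i ≤ 0 := hi
    have hb : blk (QWhile.gadget μ q τ σ) a b i = 0 := by
      rw [QWhile.gadget, blk_add, blk_add, blk_countStep_measQ, if_neg (fun h => by omega), blk_measQ,
        hσ.blk_eq_zero a b hi', ite_self, blk_copyStep_eq_zero hq hτ (measQ_posSemidef 1 hσ.psd),
        add_zero, add_zero]
      rw [btr_measQ_one, hσ.blk_eq_zero 0 1 hi', rtr_zero, ite_self]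
    have h1 := diag_le_rtr_blk hp x c a b i
    rw [hb, rtr_zero] at h1
    have h2 := PSD.diag_re_nonneg hp (QWhile.mk x (c, a, b, i))
    rw [PSD.diag_eq hp, le_antisymm h1 h2, Complex.ofReal_zero]
  · have hn : (1 : ℤ) ≤ (n : ℤ) + 1 := by omega
    rw [blk_gadget_zero μ hq hτ hσ.psd 1 hn, blk_gadget_zero μ hq hτ hσ.psd 0 hn, gpRy_zero hμ,
      gpRy_one hμ, smul_smul, smul_smul, ← Complex.ofReal_mul, ← Complex.ofReal_mul]
    congr 2
    ring

/-- Each undecided level moves up by one. The probability of continuing replaces one tail by the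
next, so after normalisation only the factor `ζ` remains. The bottom level receives nothing, since
counter `0` carries no mass, and the top level leaves the truncated sum. -/
theorem psi_gadget {μ : ℕ → ℝ} (hμ : IsPosDistribution μ) (hq : Function.Injective q)
    (hτ : IsDensity τ) {σ : Matrix (Cfg (ext S)) (Cfg (ext S)) ℂ} (hσ : Good μ σ) (ζ : ℝ) (J : ℕ) :
    psi μ ζ (J + 1) (gadget μ q τ σ) = (ζ : ℂ) • psi μ ζ J σ := by
  have h : ∀ n : ℕ, ((ζ ^ n / tail μ (n + 2) : ℝ) : ℂ) • blk (gadget μ q τ σ) 0 0 ((n : ℤ) + 1) =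
      ((ζ ^ n / tail μ (n + 1) : ℝ) : ℂ) • blk σ 0 0 n := by
    intro n
    rw [blk_gadget_zero μ hq hτ hσ.psd 0 (by omega), gpRy_zero hμ, smul_smul, ← Complex.ofReal_mul,
      add_sub_cancel_right]
    congr 2
    have := (tail_pos hμ (n + 1)).ne'
    field_simp
  rw [psi, Finset.sum_congr rfl fun n _ => h n, Finset.sum_range_succ', psi, Finset.smul_sum]
  rw [Nat.cast_zero, hσ.blk_eq_zero 0 0 le_rfl, smul_zero, add_zero]
  refine Finset.sum_congr rfl fun n _ => ?_
  rw [smul_smul, ← Complex.ofReal_mul]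
  push_cast
  congr 1
  ring

/-- The top level that `psi` loses reappears in `beta`, so the first two terms of the potential
become `ζ tr psi` plus the old `beta` term, while `tr Z` becomes `ζ tr Z`. The net change is `-(ζ -
1)(tr Z - tr psi)`, nonpositive because `psi ≤ Z`. -/
theorem sim_gadget {μ : ℕ → ℝ} (hμ : IsPosDistribution μ) (hq : Function.Injective q)
    (hτ : IsDensity τ) {ζ : ℝ} (hζ : 1 ≤ ζ) :
    Sim μ ζ (gadget μ q τ) fun Z => (ζ : ℂ) • Z := by
  have hζ0 : 0 < ζ := by linarith
  intro σ hσ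
  refine ⟨hσ.gadget hμ hq hτ, fun J Z hZ => ?_⟩
  have hlast : psi μ ζ (J + 1) σ =
      psi μ ζ J σ + ((ζ ^ J / tail μ (J + 2) : ℝ) : ℂ) • blk σ 0 0 (J + 1) :=
    Finset.sum_range_succ _ _
  rw [slack, slack, psi_gadget hμ hq hτ hσ, rtr_beta_gadget μ hq hτ, rtr_smul, rtr_smul]
  constructor
  · rw [← smul_sub]
    refine PSD.smul ?_ hζ0.le
    have h1 := hZ.add (PSD.smul (blk_posSemidef hσ.psd 0 0 ((J : ℤ) + 1)) (psi_coeff_pos hμ hζ0 J).le)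
    have h2 : Z - psi μ ζ J σ = Z - psi μ ζ (J + 1) σ +
        ((ζ ^ J / tail μ (J + 2) : ℝ) : ℂ) • blk σ 0 0 (J + 1) := by
      rw [hlast]
      abel
    rw [h2]
    exact h1
  · have h1 := rtr_mono hZ
    have h2 := congrArg rtr (hσ.pure J)
    rw [rtr_smul, rtr_smul] at h2
    have h3 := congrArg rtr hlast
    rw [rtr_add, rtr_smul] at h3
    have h4 := tail_pos hμ (J + 1)
    have h5 := hμ.1 (J + 1) (by omega)
    -- By the invariant `pure`, the stopping mass divided by `μ (J + 1)` equals the undecided mass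
    -- divided by its tail, so the term entering `beta` matches the one leaving `psi`.
    have h6 : ζ ^ (J + 1) / μ (J + 1) * rtr (blk σ 0 1 ((J : ℤ) + 1)) =
        ζ * (ζ ^ J / tail μ (J + 2) * rtr (blk σ 0 0 ((J : ℤ) + 1))) := by
      have h4' : tail μ (J + 2) ≠ 0 := h4.ne'
      field_simp
      linear_combination ζ ^ (J + 1) * h2
    have h7 : (ζ - 1) * (rtr Z - rtr (psi μ ζ (J + 1) σ)) ≥ 0 :=
      mul_nonneg (by linarith) (by linarith)
    rw [mul_add, h6]
    linear_combination h7 - ζ * h3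

end Gadget

/-! ### Assembling the simulation over the syntax -/

section Master

variable {S : QSystem} [Fintype (Cfg S)] {k : ℕ}

theorem Sim.congr {μ : ℕ → ℝ} {ζ : ℝ} (hμ : IsPosDistribution μ) (hζ : 0 < ζ)
    {G : Matrix (Cfg (ext S)) (Cfg (ext S)) ℂ → Matrix (Cfg (ext S)) (Cfg (ext S)) ℂ}
    {W W' : Matrix (Cfg S) (Cfg S) ℂ → Matrix (Cfg S) (Cfg S) ℂ} (h : Sim μ ζ G W)
    (hW : ∀ Z, Z.PosSemidef → W Z = W' Z) : Sim μ ζ G W' := by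
  intro σ hσ
  refine ⟨(h σ hσ).1, fun J Z hZ => ?_⟩
  rw [← hW Z (PSD.of_sub hZ (psi_posSemidef hμ hζ hσ.psd _))]
  exact (h σ hσ).2 J Z hZ

theorem Prog.sem_trans_rot (μ : ℕ → ℝ) (j : Fin k) {ι : Type} (q : ι → S.Var)
    (τ : Matrix (RCfg q) (RCfg q) ℂ) (θ : Fin k → ℝ) :
    ((Prog.rot j ι q τ).trans μ j).sem θ = fun σ =>
      conj (lift (regOrig S q) (iexp ((-(Complex.I * (θ j : ℂ))) • τ))) (gadget μ q τ σ) := by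
  rw [Prog.trans, if_pos rfl]
  funext σ
  refine congrArg (conj (lift (regOrig S q) (iexp ((-(Complex.I * (θ j : ℂ))) • τ)))) ?_
  exact Fin.sum_univ_three _

/-- The weighted semantics of a program simulates the transformed program. -/
theorem Prog.sim_trans {μ : ℕ → ℝ} (hμ : IsPosDistribution μ) {ζ : ℝ} (hζ : 1 ≤ ζ) (j : Fin k)
    {θ : Fin k → ℝ} {P : Prog S k} (hP : P.WellFormed) (hT : P.Tame (weight j ζ) θ) :
    Sim μ ζ ((P.trans μ j).sem θ) (P.wsem (weight j ζ) θ) := by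
  have hζ0 : 0 < ζ := by linarith
  have hw : 0 ≤ weight j ζ := zero_le_one.trans (one_le_weight j hζ)
  induction P using Prog.induction with
  | skip => exact Sim.id
  | init q => exact (sliceMap_resetVar q).sim hμ hζ0 (tp_resetVar q)
  | initState ι q σ =>
    exact (sliceMap_resetReg hP.1 hP.2).sim hμ hζ0 (tp_resetReg hP.1 hP.2)
  | unitary ι q U => exact (sliceMap_conj_lift hP.1 U).sim hμ hζ0 (tp_conj_lift hP.1 hP.2)
  | rot j' ι q σ =>
    have := finite_rcfg hP.1
    have hs := (sliceMap_conj_lift hP.1 (iexp ((-(Complex.I * (θ j' : ℂ))) • σ))).sim hμ hζ0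
      (tp_conj_lift hP.1 (isUnitary_rot hP.2 (θ j')))
    by_cases hj : j' = j
    · subst hj
      rw [Prog.sem_trans_rot]
      refine Sim.congr hμ hζ0 (hs.comp (sim_gadget hμ hP.1 hP.2 hζ)) fun Z hZ => ?_
      rw [(posMap_conj_lift hP.1 _).smul ζ Z hζ0.le hZ]
      simp [Prog.wsem, weight]
    · rw [Prog.trans, if_neg hj]
      refine Sim.congr hμ hζ0 hs fun Z _ => ?_
      simp [Prog.wsem, weight, hj]
  | seq P₁ P₂ h1 h2 => exact (h2 hP.2 hT.2).comp (h1 hP.1 hT.1)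
  | ite ι q m M P h =>
    exact Sim.measure (fun i => sliceMap_conj_lift hP.1 (M i)) (fun A _ => sum_rtr_conj_lift hP.1 hP.2.1 A)
      hμ hζ0 fun i => h i (hP.2.2 i) (hT i)
  | loop ι q M₀ M₁ Q h =>
    exact Sim.loop (sliceMap_conj_lift hP.1 M₀) (sliceMap_conj_lift hP.1 M₁)
      (measPair_conj_lift hP.1 hP.2.1) hμ hζ0 (h hP.2.2 hT.2)
      (Prog.posMap_wsem hw hP.2.2 hT.2) hT.1

end Master

/-! ### Initialisation of the additional variables -/

section Init

section Reset

variable {S : QSystem} (v : S.Var)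

open Classical in
/-- Splitting off the label of a variable. -/
def splitVar : {x : Cfg S // x v = S.zero v} × S.Basis v ≃ Cfg S where
  toFun p := Function.update p.1 v p.2
  invFun z := (⟨Function.update z v (S.zero v), by simp⟩, z v)
  left_inv p := by
    obtain ⟨⟨x, hx⟩, n⟩ := p
    have : Function.update x v (S.zero v) = x := by rw [← hx, Function.update_eq_self]
    simp [this]
  right_inv z := by simp

/-- The sum over all labels is regrouped by the label of `v`; for the counter this is a genuinely
infinite regrouping. -/
theorem hasSum_resetVar_diag {ρ : Matrix (Cfg S) (Cfg S) ℂ} (hρ : Summable fun x => ρ x x) :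
    HasSum (fun x => resetVar v ρ x x) (itrace ρ) := by
  classical
  have h1 : HasSum (fun p => ρ (splitVar v p) (splitVar v p)) (itrace ρ) :=
    (splitVar v).hasSum_iff.2 hρ.hasSum
  have h2 := h1.prod_fiberwise fun x => (h1.summable.prod_factor x).hasSum
  rw [← (Subtype.val_injective (p := fun x : Cfg S => x v = S.zero v)).hasSum_iff]
  · convert h2 using 2 with x
    simp [resetVar, x.2, splitVar]
  · intro x hx
    have : ¬ x v = S.zero v := by simpa using hx
    simp [resetVar, this]

/-- The reset is the sum of the maps with Kraus operators `|0⟩⟨n|`. For the counter the sum is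
infinite, and its entries converge because the diagonal does. -/
theorem isPartialDensity_resetVar {ρ : Matrix (Cfg S) (Cfg S) ℂ} (hρ : IsPartialDensity ρ) :
    IsPartialDensity (resetVar v ρ) := by
  classical
  have ht := hasSum_resetVar_diag v hρ.2.1
  refine ⟨?_, ht.summable, (congrArg Complex.re ht.tsum_eq).trans_le hρ.2.2⟩
  let f : S.Basis v → Unit → Cfg S → Cfg S := fun n _ x => Function.update x v n
  let g : Unit → Cfg S → ℂ := fun _ x => if x v = S.zero v then 1 else 0
  let L : S.Basis v → Matrix (Cfg S) (Cfg S) ℂ := fun n x z => ∑ k, if z = f n k x then g k x else 0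
  have hL : ∀ n, IsBranch (L n) (f n) g := fun n x z => by
    simp only [L]
  refine posSemidef_of_hasSum (fun n => conj_posSemidef (hL n) hρ.1) fun x y => ?_
  have hd : ∀ x : Cfg S, Summable fun n => (ρ (Function.update x v n) (Function.update x v n)).re :=
    fun x => (hρ.2.1.comp_injective (Function.update_injective x v)).mapL Complex.reCLM
  have hs : Summable fun n => ρ (Function.update x v n) (Function.update y v n) :=
    Summable.of_norm_bounded ((hd x).add (hd y)) fun n => PSD.norm_le hρ.1 _ _
  have he : ∀ n, conj (L n) ρ x y = if x v = S.zero v ∧ y v = S.zero v then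
      ρ (Function.update x v n) (Function.update y v n) else 0 := by
    intro n
    rw [conj_apply (hL n), Fintype.sum_unique, Fintype.sum_unique]
    by_cases h1 : x v = S.zero v <;> by_cases h2 : y v = S.zero v <;> simp [f, g, h1, h2]
  simp_rw [he]
  unfold resetVar
  by_cases h : x v = S.zero v ∧ y v = S.zero v
  · simp only [if_pos h]
    convert hs.hasSum
  · simp only [if_neg h]
    exact hasSum_zero

open Classical in
theorem resetVar_eq_zero {ρ : Matrix (Cfg S) (Cfg S) ℂ} {x y : Cfg S}
    (h : x v = S.zero v → ∀ n, ρ (Function.update x v n) (Function.update y v n) = 0) :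
    resetVar v ρ x y = 0 := by
  unfold resetVar
  split_ifs with hc
  · simp [h hc.1]
  · rfl

end Reset

variable {S : QSystem}

/-- `q₁ := |0⟩; q₂ := |0⟩; q_c := |0⟩` -/
def resetQ (ρ : Matrix (Cfg (ext S)) (Cfg (ext S)) ℂ) : Matrix (Cfg (ext S)) (Cfg (ext S)) ℂ :=
  resetVar (S := ext S) .qc (resetVar (S := ext S) .q₂ (resetVar (S := ext S) .q₁ ρ))

theorem isPartialDensity_resetQ {ρ : Matrix (Cfg (ext S)) (Cfg (ext S)) ℂ}
    (hρ : IsPartialDensity ρ) : IsPartialDensity (resetQ ρ) :=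
  isPartialDensity_resetVar _ (isPartialDensity_resetVar _ (isPartialDensity_resetVar _ hρ))

theorem resetQ_diag {ρ : Matrix (Cfg (ext S)) (Cfg (ext S)) ℂ} {z : Cfg (ext S)}
    (hz : ¬ (bit₁ z = 0 ∧ bit₂ z = 0 ∧ counter z = 0)) : resetQ ρ z z = 0 := by
  classical
  refine resetVar_eq_zero _ fun h3 n => resetVar_eq_zero _ fun h2 m => resetVar_eq_zero _ fun h1 l => ?_
  have e12 : (DVar.q₁ : (ext S).Var) ≠ DVar.q₂ := fun h => by cases h
  have e1c : (DVar.q₁ : (ext S).Var) ≠ DVar.qc := fun h => by cases h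
  have e2c : (DVar.q₂ : (ext S).Var) ≠ DVar.qc := fun h => by cases h
  have h1' := ((Function.update_of_ne e12 m _).trans (Function.update_of_ne e1c n z)).symm.trans h1
  have h2' := (Function.update_of_ne e2c n z).symm.trans h2
  exact absurd ⟨h1', h2', h3⟩ hz

/-- Lets the initial `C` and `GP` be read as the counting branch of the inserted statements, so that
its block formulas apply to the start state. -/
theorem measQ_resetQ {ρ : Matrix (Cfg (ext S)) (Cfg (ext S)) ℂ} (hρ : IsPartialDensity ρ) :
    measQ 0 (resetQ ρ) = resetQ ρ := by
  classical
  have hp := (isPartialDensity_resetQ hρ).1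
  have h0 : ∀ z z', ¬ outcome 0 (bit₁ z) (bit₂ z) → resetQ ρ z z' = 0 := by
    intro z z' h
    refine PSD.eq_zero_of_diag hp z z' ?_
    rw [resetQ_diag, Complex.zero_re]
    intro h'
    exact h (Or.inl ⟨rfl, h'.1, h'.2.1⟩)
  ext z z'
  rw [measQ_apply]
  split_ifs with h
  · rfl
  · rcases not_and_or.1 h with h | h
    · exact (h0 z z' h).symm
    · rw [← hp.1.apply z z', h0 z' z h, star_zero]

variable [Fintype (Cfg S)]

theorem rtr_blk_le_itrace {σ : Matrix (Cfg (ext S)) (Cfg (ext S)) ℂ} (hσ : IsPartialDensity σ)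
    (a b : Fin 2) (i : ℤ) : rtr (blk σ a b i) ≤ 1 := by
  have hp := fun b => rtr_nonneg (blk_posSemidef hσ.1 a b i)
  have h1 : (btr σ a i).re ≤ 1 := by
    classical
    refine le_trans ?_ hσ.2.2
    have h2 : HasSum (fun z => (σ z z).re) (itrace σ).re := Complex.hasSum_re hσ.2.1.hasSum
    have h3 := sum_le_hasSum (Finset.univ.image (emb (S := S) a i))
      (fun z _ => PSD.diag_re_nonneg hσ.1 z) h2
    rw [Finset.sum_image fun d _ d' _ h => (regClosed_emb (S := S) (q := reg1 S .q₂) a i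
      (by rintro k h; cases h) (by rintro k h; cases h)).1 h] at h3
    rw [btr, Complex.re_sum]
    exact h3
  rw [btr_eq] at h1
  have h2 := hp 0
  have h3 := hp 1
  fin_cases b <;> simp only [Fin.zero_eta, Fin.mk_one, Fin.isValue] <;> linarith

theorem blk_resetQ_eq_zero {ρ : Matrix (Cfg (ext S)) (Cfg (ext S)) ℂ} (hρ : IsPartialDensity ρ)
    (a b : Fin 2) {i : ℤ} (hi : i ≠ 0) : blk (resetQ ρ) a b i = 0 := by
  rw [blk]
  refine Finset.sum_eq_zero fun c _ => ?_
  ext x y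
  refine PSD.eq_zero_of_diag (sl_posSemidef (isPartialDensity_resetQ hρ).1 _) x y ?_
  rw [sl_apply, resetQ_diag (z := mk x (c, a, b, i)) fun h => hi h.2.2, Complex.zero_re]

/-- The state before the transformed program. -/
def startState (μ : ℕ → ℝ) (ρ : Matrix (Cfg (ext S)) (Cfg (ext S)) ℂ) :
    Matrix (Cfg (ext S)) (Cfg (ext S)) ℂ :=
  countStep μ (resetQ ρ)

theorem blk_startState (μ : ℕ → ℝ) {ρ : Matrix (Cfg (ext S)) (Cfg (ext S)) ℂ}
    (hρ : IsPartialDensity ρ) (a b : Fin 2) (i : ℤ) :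
    blk (startState μ ρ) a b i = if a = 0 ∧ 1 ≤ i then
      (gpRy μ i b 0 * star (gpRy μ i b 0)) • blk (resetQ ρ) 0 0 (i - 1) else 0 := by
  rw [startState, ← measQ_resetQ hρ, blk_countStep_measQ, measQ_resetQ hρ]

theorem good_startState {μ : ℕ → ℝ} (hμ : IsPosDistribution μ)
    {ρ : Matrix (Cfg (ext S)) (Cfg (ext S)) ℂ} (hρ : IsPartialDensity ρ) :
    Good μ (startState μ ρ) := by
  have hp : (startState μ ρ).PosSemidef := countStep_posSemidef μ (isPartialDensity_resetQ hρ).1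
  refine ⟨hp, ?_, fun n => ?_⟩
  · rintro x ⟨c, a, b, i⟩ hi
    have hi' : i ≤ 0 := hi
    have h1 := diag_le_rtr_blk hp x c a b i
    rw [blk_startState μ hρ, if_neg (fun h => by omega), rtr_zero] at h1
    have h2 := PSD.diag_re_nonneg hp (mk x (c, a, b, i))
    rw [PSD.diag_eq hp, le_antisymm h1 h2, Complex.ofReal_zero]
  · have hn : (1 : ℤ) ≤ (n : ℤ) + 1 := by omega
    rw [blk_startState μ hρ, blk_startState μ hρ, if_pos ⟨rfl, hn⟩, if_pos ⟨rfl, hn⟩, gpRy_zero hμ,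
      gpRy_one hμ, smul_smul, smul_smul, ← Complex.ofReal_mul, ← Complex.ofReal_mul]
    congr 2
    ring

/-- All the mass sits at level `0`; dividing by `tail μ 2` undoes the first `GP`, as `tail μ 1 = 1`.
-/
theorem psi_startState {μ : ℕ → ℝ} (hμ : IsPosDistribution μ)
    {ρ : Matrix (Cfg (ext S)) (Cfg (ext S)) ℂ} (hρ : IsPartialDensity ρ) (ζ : ℝ) (J : ℕ) :
    psi μ ζ (J + 1) (startState μ ρ) = blk (resetQ ρ) 0 0 0 := by
  rw [psi, Finset.sum_eq_single_of_mem 0 (by simp)]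
  · have h1 := gpRy_zero hμ 0
    have h2 := tail_pos hμ 1
    rw [Nat.cast_zero] at h1
    rw [blk_startState μ hρ, if_pos ⟨rfl, by simp⟩, Nat.cast_zero, h1, smul_smul,
      ← Complex.ofReal_mul]
    have h3 : tail μ 1 = 1 := by simp [tail]
    have h4 : ζ ^ 0 / tail μ (0 + 2) * (tail μ (0 + 2) / tail μ (0 + 1)) = 1 := by
      rw [zero_add, zero_add, h3]
      have : tail μ 2 ≠ 0 := h2.ne'
      field_simp
    rw [h4]
    simp
  · intro n _ hn
    rw [blk_startState μ hρ, add_sub_cancel_right, blk_resetQ_eq_zero hρ 0 0 (by exact_mod_cast hn),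
      smul_zero, ite_self, smul_zero]

theorem beta_startState {μ : ℕ → ℝ}
    {ρ : Matrix (Cfg (ext S)) (Cfg (ext S)) ℂ} (hρ : IsPartialDensity ρ) (i : ℤ) :
    beta (startState μ ρ) i = 0 := by
  rw [beta, blk_startState μ hρ, blk_startState μ hρ]
  simp

variable {k : ℕ}

/-- The weight of the final state in which `q₁` is `|1⟩` and the counter is `J + 1`. -/
theorem Prog.rtr_beta_diff_le {μ : ℕ → ℝ} (hμ : IsPosDistribution μ) {ζ : ℝ} (hζ : 1 ≤ ζ) (j : Fin k)
    {θ : Fin k → ℝ} {P : Prog S k} (hP : P.WellFormed) (hT : P.Tame (weight j ζ) θ) {D : ℝ}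
    (hD0 : 0 ≤ D)
    (hD : ∀ Z : Matrix (Cfg S) (Cfg S) ℂ, Z.PosSemidef → rtr (P.wsem (weight j ζ) θ Z) ≤ D * rtr Z)
    {ρ : Matrix (Cfg (ext S)) (Cfg (ext S)) ℂ} (hρ : IsPartialDensity ρ) :
    Good μ ((P.diff μ j).sem θ ρ) ∧ ∀ J : ℕ,
      rtr (beta ((P.diff μ j).sem θ ρ) (J + 1)) ≤ D * μ (J + 1) / ζ ^ (J + 1) := by
  have hζ0 : 0 < ζ := by linarith
  have h1 := Prog.sim_trans hμ hζ j hP hT _ (good_startState hμ hρ)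
  change Good μ ((P.trans μ j).sem θ (startState μ ρ)) ∧ ∀ J : ℕ,
    rtr (beta ((P.trans μ j).sem θ (startState μ ρ)) (J + 1)) ≤ _
  refine ⟨h1.1, fun J => ?_⟩
  have hZ : (blk (resetQ ρ) 0 0 0).PosSemidef := blk_posSemidef (isPartialDensity_resetQ hρ).1 _ _ _
  -- The companion is taken equal to the initial `psi`, so the initial potential is exactly zero.
  have h2 := (h1.2 J (blk (resetQ ρ) 0 0 0)
    (by rw [psi_startState hμ hρ, sub_self]; exact Matrix.PosSemidef.zero)).2
  have h3 : slack μ ζ J (startState μ ρ) (blk (resetQ ρ) 0 0 0) = 0 := by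
    rw [slack, psi_startState hμ hρ, beta_startState hρ, rtr_zero]
    ring
  have h4 := rtr_beta_le_slack hμ hζ0 h1.1.psd J (P.wsem (weight j ζ) θ (blk (resetQ ρ) 0 0 0))
  have h5 := hD _ hZ
  have h6 := mul_le_mul_of_nonneg_left (rtr_blk_le_itrace (isPartialDensity_resetQ hρ) 0 0 0) hD0
  have h7 := hμ.1 (J + 1) (by omega)
  have h8 : ζ ^ (J + 1) / μ (J + 1) *
      rtr (beta ((P.trans μ j).sem θ (startState μ ρ)) (J + 1)) ≤ D := by linarith
  rw [le_div_iff₀ (by positivity)]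
  rw [div_mul_eq_mul_div, div_le_iff₀ h7] at h8
  linarith

end Init

/-! ### The second moment -/

section Moment

theorem sum_normSq_mulVec_le {I : Type} [Fintype I] (O : Matrix I I ℂ) (v : I → ℂ) :
    ∑ i, ‖(O *ᵥ v) i‖ ^ 2 ≤ opNorm O ^ 2 * ∑ i, ‖v i‖ ^ 2 := by
  classical
  have h := (Matrix.toEuclideanCLM (n := I) (𝕜 := ℂ) O).le_opNorm (WithLp.toLp 2 v)
  have h2 := pow_le_pow_left₀ (norm_nonneg _) h 2
  rw [mul_pow, EuclideanSpace.norm_sq_eq, EuclideanSpace.norm_sq_eq] at h2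
  exact h2

/-- Writing `B = C†C`, the trace is the sum of the squared norms of `O` applied to the columns of
`C†`. -/
theorem trace_sandwich {I : Type} [Fintype I] {O B : Matrix I I ℂ} (hO : O.IsHermitian)
    (hB : B.PosSemidef) : ∃ v : ℝ, (O * O * B).trace = v ∧ 0 ≤ v ∧ v ≤ opNorm O ^ 2 * rtr B := by
  classical
  open scoped MatrixOrder in
  obtain ⟨C, rfl⟩ := CStarAlgebra.nonneg_iff_eq_star_mul_self.mp hB.nonneg
  rw [Matrix.star_eq_conjTranspose]
  have hn : ∀ M : Matrix I I ℂ, (M * Mᴴ).trace = ((∑ k, ∑ i, ‖M i k‖ ^ 2 : ℝ) : ℂ) := by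
    intro M
    rw [Finset.sum_comm, Matrix.trace]
    push_cast
    refine Finset.sum_congr rfl fun i _ => ?_
    rw [Matrix.diag_apply, Matrix.mul_apply]
    refine Finset.sum_congr rfl fun k _ => ?_
    rw [Matrix.conjTranspose_apply, Complex.star_def, Complex.mul_conj']
  have h1 : (O * O * (Cᴴ * C)).trace = ((O * Cᴴ) * (O * Cᴴ)ᴴ).trace := by
    rw [Matrix.conjTranspose_mul, hO.eq, Matrix.conjTranspose_conjTranspose, Matrix.mul_assoc,
      Matrix.trace_mul_comm, Matrix.mul_assoc, Matrix.mul_assoc, Matrix.mul_assoc]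
  refine ⟨_, h1.trans (hn _), by positivity, ?_⟩
  have h2 : rtr (Cᴴ * C) = ∑ k, ∑ i, ‖Cᴴ i k‖ ^ 2 := by
    have := hn Cᴴ
    rw [Matrix.conjTranspose_conjTranspose] at this
    rw [rtr, this, Complex.ofReal_re]
  rw [h2, Finset.mul_sum]
  exact Finset.sum_le_sum fun k _ => sum_normSq_mulVec_le O fun i => Cᴴ i k

variable {S : QSystem}

/-- The diagonal entries of `O_d²`. -/
def odSq (μ : ℕ → ℝ) (a : Fin 2) (i : ℤ) : ℝ := if 1 ≤ i ∧ a = 1 then (2 / μ i.toNat) ^ 2 else 0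

/-- The sign from `Z` squares away, so `O_d²` is diagonal and independent of `q₂`. -/
theorem opOd_mul_self (μ : ℕ → ℝ) (u w : RCfg (reg3 S)) :
    imul (opOd S μ) (opOd S μ) u w = open Classical in
      if u = w then ((odSq μ (u (.inr (.inl ()))) (u (.inl ())) : ℝ) : ℂ) else 0 := by
  classical
  have he : ∀ u w : RCfg (reg3 S), u = w ↔ (u (.inl ()) : ℤ) = w (.inl ()) ∧
      (u (.inr (.inl ())) : Fin 2) = w (.inr (.inl ())) ∧
      (u (.inr (.inr ())) : Fin 2) = w (.inr (.inr ())) := by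
    intro u w
    constructor
    · rintro rfl
      exact ⟨rfl, rfl, rfl⟩
    · rintro ⟨h1, h2, h3⟩
      funext i
      rcases i with ⟨⟩ | ⟨⟩ | ⟨⟩
      exacts [h1, h2, h3]
  have hne : ∀ u w : RCfg (reg3 S), u ≠ w → opOd S μ u w = 0 := by
    intro u w h
    refine if_neg fun h' => h ((he u w).2 h'.1)
  unfold imul
  rw [tsum_eq_single u fun z hz => by rw [hne u z hz.symm, zero_mul]]
  by_cases h : u = w
  · subst h
    rw [if_pos rfl]
    let i : ℤ := u (.inl ())
    let a : Fin 2 := u (.inr (.inl ()))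
    change opOd S μ u u * opOd S μ u u = ((odSq μ a i : ℝ) : ℂ)
    by_cases hc : 1 ≤ i ∧ a = 1
    · have h1 : ∃ s : ℂ, s * s = 1 ∧ opOd S μ u u = ((2 / μ i.toNat : ℝ) : ℂ) * s := by
        refine ⟨_, ?_, if_pos ⟨⟨rfl, rfl, rfl⟩, hc⟩⟩
        split_ifs <;> norm_num
      have h2 : odSq μ a i = (2 / μ i.toNat) ^ 2 := if_pos hc
      obtain ⟨s, hs, h1⟩ := h1
      rw [h1, h2, Complex.ofReal_pow]
      linear_combination ((2 / μ i.toNat : ℝ) : ℂ) ^ 2 * hs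
    · have h1 : opOd S μ u u = 0 := if_neg fun h => hc h.2
      have h2 : odSq μ a i = 0 := if_neg hc
      rw [h1, h2, mul_zero, Complex.ofReal_zero]
  · rw [hne u w h, mul_zero, if_neg h]

theorem lift_opOd (μ : ℕ → ℝ) : IsBranch (κ := Unit)
    (lift (reg3 S) (imul (opOd S μ) (opOd S μ))) (fun _ z => z)
    (fun _ z => ((odSq μ (bit₁ z) (counter z) : ℝ) : ℂ)) := by
  classical
  intro z z'
  rw [Fintype.sum_unique]
  unfold lift
  rw [opOd_mul_self]
  by_cases h : z' = z
  · subst h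
    rw [if_pos fun _ _ => rfl, if_pos rfl, if_pos rfl]
    rfl
  · rw [if_neg h]
    split_ifs with h1 h2
    · exfalso
      refine h (funext fun v => ?_)
      by_cases hv : ∀ i, reg3 S i ≠ v
      · exact (h1 v hv).symm
      · push Not at hv
        obtain ⟨i, rfl⟩ := hv
        exact (congrFun h2 i).symm
    · rfl
    · rfl

variable [Fintype (Cfg S)]

theorem imul_secondMomentOp (μ : ℕ → ℝ) (O : Matrix (Cfg S) (Cfg S) ℂ)
    (σ : Matrix (Cfg (ext S)) (Cfg (ext S)) ℂ) (x : Cfg S) (r : Rest S) :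
    imul (secondMomentOp S μ O) σ (mk x r) (mk x r) =
      ((odSq μ r.2.1 r.2.2.2 : ℝ) : ℂ) * (O * O * sl σ r r) x x := by
  classical
  let id' : S.Var → S.Var := fun v => v
  have hq : Function.Injective id' := fun _ _ h => h
  let _ : Fintype (RCfg (regOrig S id')) := ‹Fintype (Cfg S)›
  have hA := lift_isBranch (regOrig_injective hq) (imul O O)
  have h1 : ∀ z z', secondMomentOp S μ O z z' = ((odSq μ (bit₁ z) (counter z) : ℝ) : ℂ) *
      lift (regOrig S id') (imul O O) z z' := by
    intro z z'
    change ∑' u, lift (reg3 S) (imul (opOd S μ) (opOd S μ)) z u *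
      lift (regOrig S id') (imul O O) u z' = _
    refine (tsum_congr fun u => congrArg (· * _) (lift_opOd μ z u)).trans ?_
    exact (tsum_branch _ _ _).trans (Fintype.sum_unique _)
  change ∑' z, secondMomentOp S μ O (mk x r) z * σ z (mk x r) = _
  refine (tsum_congr fun z => (congrArg (· * σ z (mk x r)) (h1 _ z)).trans (mul_assoc _ _ _)).trans ?_
  rw [tsum_mul_left]
  refine congrArg₂ _ rfl ?_
  have h2 := tsum_branch (fun w : RCfg (regOrig S id') => setReg (regOrig S id') (mk x r) w)
    (fun w => imul O O (readReg (regOrig S id') (mk x r)) w) (fun z => σ z (mk x r))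
  refine Eq.trans (tsum_congr fun u => congrArg (· * _) (hA (mk x r) u)) (h2.trans ?_)
  rw [Matrix.mul_apply, ← imul_eq_mul]
  refine Finset.sum_congr (ι := Cfg S) rfl fun w _ => ?_
  refine congrArg₂ (· * ·) rfl ?_
  rw [sl_apply]
  refine congrArg (fun z => σ z (mk x r)) ?_
  refine (setReg_regOrig hq x r w).trans (congrArg (fun z => mk z r) ?_)
  exact (setReg_ext hq rfl fun v hv => absurd rfl (hv v)).symm

theorem summable_moment {κ : Type} {A : κ → Matrix (Cfg S) (Cfg S) ℂ}
    (hA : ∀ n, (A n).PosSemidef) {c u : κ → ℝ} (hc : ∀ n, 0 ≤ c n) (hu : Summable u)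
    (hle : ∀ n, c n * rtr (A n) ≤ u n) (B : Matrix (Cfg S) (Cfg S) ℂ) (x : Cfg S) :
    Summable fun n => (c n : ℂ) * (B * A n) x x := by
  refine Summable.of_norm_bounded (g := fun n => ∑ y, ‖B x y‖ * (2 * u n)) ?_ fun n => ?_
  · exact summable_sum fun y _ => (hu.mul_left 2).mul_left _
  · rw [norm_mul, Complex.norm_real, Real.norm_of_nonneg (hc n), Matrix.mul_apply]
    refine (mul_le_mul_of_nonneg_left (norm_sum_le _ _) (hc n)).trans ?_
    rw [Finset.mul_sum]
    refine Finset.sum_le_sum fun y _ => ?_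
    rw [norm_mul]
    have h1 := PSD.norm_le_rtr (hA n) y x
    have h2 := hle n
    have h3 := mul_le_mul_of_nonneg_left h1 (mul_nonneg (hc n) (norm_nonneg (B x y)))
    have h4 := mul_le_mul_of_nonneg_left h2 (norm_nonneg (B x y))
    linarith

theorem hasSum_prod_fintype {F X : Type} [Fintype F] {t : F × X → ℂ} {s : F → ℂ}
    (h : ∀ f, HasSum (fun x => t (f, x)) (s f)) : HasSum t (∑ f, s f) := by
  classical
  have h1 : ∀ f, HasSum (fun p : F × X => if p.1 = f then t p else 0) (s f) := by
    intro f
    rw [← (Prod.mk_right_injective f).hasSum_iff]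
    · convert h f using 2 with x
      simp
    · rintro ⟨f', x⟩ hx
      refine if_neg fun e => hx ⟨x, ?_⟩
      rw [← e]
  convert hasSum_sum (s := Finset.univ) fun f _ => h1 f using 2 with p
  simp

/-- `O_d²` lives on `q₁ = |1⟩` with positive counter, and grouping by counter turns the trace into a
weighted sum of `tr (O² · beta)`. Unconditional convergence is shown along the counter for each of
the finitely many remaining labels and then assembled. -/
theorem secondMomentLE_of_beta {k : ℕ} {μ : ℕ → ℝ} {θ : Fin k → ℝ}
    {j : Fin k} {P : Prog S k} {O : Matrix (Cfg S) (Cfg S) ℂ} (hO : O.IsHermitian)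
    {ρ : Matrix (Cfg (ext S)) (Cfg (ext S)) ℂ} (hσ : ((P.diff μ j).sem θ ρ).PosSemidef) {u : ℕ → ℝ}
    (hu : Summable u)
    (hle : ∀ n : ℕ, (2 / μ (n + 1)) ^ 2 * rtr (beta ((P.diff μ j).sem θ ρ) (n + 1)) ≤ u n) :
    SecondMomentLE μ θ j P O ρ (opNorm O ^ 2 * ∑' n, u n) := by
  set σ := (P.diff μ j).sem θ ρ with hσdef
  set c : ℕ → ℝ := fun n => (2 / μ (n + 1)) ^ 2 with hc
  have hc0 : ∀ n, 0 ≤ c n := fun n => sq_nonneg _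
  have hb := fun n : ℕ => beta_posSemidef hσ ((n : ℤ) + 1)
  let e : (Cfg S × Cfg S × Fin 2) × ℕ → Cfg (ext S) := fun p => emb 1 ((p.2 : ℤ) + 1) p.1
  have he : Function.Injective e := by
    rintro ⟨⟨x, y, b⟩, n⟩ ⟨⟨x', y', b'⟩, n'⟩ h
    have h1 := mk_inj.1 h
    simp only [Prod.mk.injEq] at h1
    obtain ⟨rfl, rfl, -, rfl, h2⟩ := h1
    have : n = n' := by omega
    rw [this]
  have hterm : ∀ d n, secondMomentTerm μ θ j P O ρ (e (d, n)) =
      (c n : ℂ) * (O * O * sl σ (d.2.1, 1, d.2.2, (n : ℤ) + 1) (d.2.1, 1, d.2.2, (n : ℤ) + 1)) d.1 d.1 := by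
    intro d n
    refine (imul_secondMomentOp μ O σ d.1 (d.2.1, 1, d.2.2, (n : ℤ) + 1)).trans ?_
    have h1 : odSq μ 1 ((n : ℤ) + 1) = c n := by
      rw [odSq, if_pos ⟨by omega, rfl⟩]
      have : ((n : ℤ) + 1).toNat = n + 1 := by omega
      rw [this]
    change ((odSq μ 1 ((n : ℤ) + 1) : ℝ) : ℂ) * _ = _
    rw [h1]
  have hbeta : ∀ n : ℕ, beta σ ((n : ℤ) + 1) = ∑ p : Cfg S × Fin 2,
      sl σ (p.1, 1, p.2, (n : ℤ) + 1) (p.1, 1, p.2, (n : ℤ) + 1) := by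
    intro n
    rw [beta, blk, blk, Fintype.sum_prod_type, ← Finset.sum_add_distrib]
    simp_rw [Fin.sum_univ_two]
  have hsl : ∀ (p : Cfg S × Fin 2) (n : ℕ),
      rtr (sl σ (p.1, 1, p.2, (n : ℤ) + 1) (p.1, 1, p.2, (n : ℤ) + 1)) ≤ rtr (beta σ ((n : ℤ) + 1)) := by
    intro p n
    rw [hbeta, rtr_sum]
    exact Finset.single_le_sum (f := fun p : Cfg S × Fin 2 =>
      rtr (sl σ (p.1, 1, p.2, (n : ℤ) + 1) (p.1, 1, p.2, (n : ℤ) + 1)))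
      (fun p _ => rtr_nonneg (sl_posSemidef hσ _)) (Finset.mem_univ p)
  have hs : ∀ d : Cfg S × Cfg S × Fin 2,
      Summable fun n => secondMomentTerm μ θ j P O ρ (e (d, n)) := by
    intro d
    simp_rw [hterm]
    exact summable_moment (fun n => sl_posSemidef hσ _) hc0 hu
      (fun n => (mul_le_mul_of_nonneg_left (hsl d.2 n) (hc0 n)).trans (hle n)) _ _
  choose v hv hv0 hvle using fun n => trace_sandwich hO (hb n)
  have hsum : ∀ n, ∑ d, secondMomentTerm μ θ j P O ρ (e (d, n)) = ((c n * v n : ℝ) : ℂ) := by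
    intro n
    simp_rw [hterm]
    rw [← Finset.mul_sum, Complex.ofReal_mul, ← hv, hbeta, Matrix.mul_sum, Matrix.trace_sum,
      Fintype.sum_prod_type, Finset.sum_comm]
    rfl
  have hvu : ∀ n, c n * v n ≤ opNorm O ^ 2 * u n := fun n => by
    have h1 := mul_le_mul_of_nonneg_left (hvle n) (hc0 n)
    have h2 := mul_le_mul_of_nonneg_left (hle n) (sq_nonneg (opNorm O))
    linarith
  have hcv : Summable fun n => c n * v n :=
    Summable.of_nonneg_of_le (fun n => mul_nonneg (hc0 n) (hv0 n)) hvu (hu.mul_left _)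
  refine ⟨∑' n, c n * v n, ?_, ?_⟩
  · have h1 := hasSum_prod_fintype (t := fun p => secondMomentTerm μ θ j P O ρ (e p))
      fun d => (hs d).hasSum
    have h2 : ∑ d, ∑' n, secondMomentTerm μ θ j P O ρ (e (d, n)) = ((∑' n, c n * v n : ℝ) : ℂ) := by
      rw [Complex.ofReal_tsum, ← Summable.tsum_finsetSum fun d _ => hs d]
      exact tsum_congr hsum
    rw [h2] at h1
    refine (he.hasSum_iff ?_).1 h1
    · intro z hz
      obtain ⟨x, ⟨y, a, b, i⟩, rfl⟩ := exists_mk z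
      refine (imul_secondMomentOp μ O σ x (y, a, b, i)).trans ?_
      have : odSq μ a i = 0 := by
        refine if_neg fun h => hz ?_
        obtain ⟨h1, rfl⟩ := h
        refine ⟨((x, y, b), (i - 1).toNat), ?_⟩
        have h2 : (((i - 1).toNat : ℕ) : ℤ) + 1 = i := by omega
        change mk x (y, 1, b, (((i - 1).toNat : ℕ) : ℤ) + 1) = _
        rw [h2]
      change ((odSq μ a i : ℝ) : ℂ) * _ = 0
      rw [this, Complex.ofReal_zero, zero_mul]
  · rw [← tsum_mul_left]
    exact hcv.tsum_le_tsum hvu (hu.mul_left _)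

/-- The bound on the second moment that follows from a bound on the weighted semantics. -/
theorem secondMomentLE_of_wsem {k : ℕ} {μ : ℕ → ℝ} (hμ : IsPosDistribution μ) {ζ : ℝ} (hζ : 1 ≤ ζ)
    {θ : Fin k → ℝ} {j : Fin k} {P : Prog S k} (hP : P.WellFormed) (hT : P.Tame (weight j ζ) θ)
    {D : ℝ} (hD0 : 0 ≤ D)
    (hD : ∀ Z : Matrix (Cfg S) (Cfg S) ℂ, Z.PosSemidef → rtr (P.wsem (weight j ζ) θ Z) ≤ D * rtr Z)
    {O : Matrix (Cfg S) (Cfg S) ℂ} (hO : O.IsHermitian)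
    {ρ : Matrix (Cfg (ext S)) (Cfg (ext S)) ℂ} (hρ : IsPartialDensity ρ)
    (hs : Summable fun n : ℕ => 1 / (μ (n + 1) * ζ ^ (n + 1))) :
    SecondMomentLE μ θ j P O ρ
      (opNorm O ^ 2 * (4 * D * ∑' n : ℕ, 1 / (μ (n + 1) * ζ ^ (n + 1)))) := by
  have h := Prog.rtr_beta_diff_le hμ hζ j hP hT hD0 hD hρ
  rw [← tsum_mul_left]
  refine secondMomentLE_of_beta hO h.1.psd (hs.mul_left _) fun n => ?_
  have h1 := hμ.1 (n + 1) (by omega)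
  have h2 : 0 < ζ ^ (n + 1) := by positivity
  -- One power of `μ` in `4 / μ²` cancels against the probability of stopping at this counter.
  refine (mul_le_mul_of_nonneg_left (h.2 n) (sq_nonneg _)).trans_eq ?_
  field_simp
  ring

end Moment

/-! ### The logarithmic distribution -/

section Log

/-- The function `n ln^{1+s}(n + e)`. -/
def logWeight (s : ℝ) (n : ℕ) : ℝ := n * Real.log (n + Real.exp 1) ^ (1 + s)

theorem one_le_log (n : ℕ) : 1 ≤ Real.log (n + Real.exp 1) := by
  rw [Real.le_log_iff_exp_le (by positivity)]
  linarith [(Nat.cast_nonneg n : (0 : ℝ) ≤ n)]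

theorem logWeight_pos (s : ℝ) {n : ℕ} (hn : 1 ≤ n) : 0 < logWeight s n :=
  mul_pos (by exact_mod_cast hn) (Real.rpow_pos_of_pos (by linarith [one_le_log n]) _)

theorem logWeight_nonneg (s : ℝ) (n : ℕ) : 0 ≤ logWeight s n :=
  mul_nonneg (Nat.cast_nonneg n) (Real.rpow_nonneg (by linarith [one_le_log n]) _)

theorem logWeight_mono {s : ℝ} (hs : 0 < s) {n m : ℕ} (h : n ≤ m) :
    logWeight s n ≤ logWeight s m := by
  have h' : (n : ℝ) ≤ m := by exact_mod_cast h
  have h1 := one_le_log n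
  refine mul_le_mul h' (Real.rpow_le_rpow (by linarith) ?_ (by linarith))
    (Real.rpow_nonneg (by linarith) _) (Nat.cast_nonneg m)
  exact Real.log_le_log (by positivity) (by linarith)

/-- The logarithm is bounded crudely by `3 n`. This loss is the origin of the exponent `3 + s` in
the final rate. -/
theorem logWeight_le {s : ℝ} (hs : 0 < s) (hs1 : s ≤ 1) {n : ℕ} (hn : 1 ≤ n) :
    logWeight s n ≤ 9 * (n : ℝ) ^ (2 + s) := by
  have hn' : (1 : ℝ) ≤ n := by exact_mod_cast hn
  have hn0 : (0 : ℝ) < n := by linarith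
  have h1 := one_le_log n
  have h2 : Real.log (n + Real.exp 1) ≤ 3 * n := by
    have := Real.log_le_sub_one_of_pos (x := n + Real.exp 1) (by positivity)
    linarith [Real.exp_one_lt_d9]
  have h3 : Real.log (n + Real.exp 1) ^ (1 + s) ≤ (3 * n : ℝ) ^ (1 + s) :=
    Real.rpow_le_rpow (by linarith) h2 (by linarith)
  have h4 : (3 : ℝ) ^ (1 + s) ≤ 9 := by
    have : (3 : ℝ) ^ (1 + s) ≤ 3 ^ (2 : ℝ) :=
      Real.rpow_le_rpow_of_exponent_le (by norm_num) (by linarith)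
    refine this.trans_eq ?_
    norm_num
  have h5 : (n : ℝ) ^ (2 + s) = n * (n : ℝ) ^ (1 + s) := by
    rw [show 2 + s = 1 + (1 + s) by ring, Real.rpow_add hn0, Real.rpow_one]
  rw [Real.mul_rpow (by norm_num) hn0.le] at h3
  rw [logWeight, h5]
  have h6 : 0 ≤ (n : ℝ) ^ (1 + s) := Real.rpow_nonneg hn0.le _
  calc (n : ℝ) * Real.log (n + Real.exp 1) ^ (1 + s)
      ≤ n * (3 ^ (1 + s) * (n : ℝ) ^ (1 + s)) := mul_le_mul_of_nonneg_left h3 hn0.le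
    _ ≤ n * (9 * (n : ℝ) ^ (1 + s)) :=
        mul_le_mul_of_nonneg_left (mul_le_mul_of_nonneg_right h4 h6) hn0.le
    _ = _ := by ring

/-- `y^(2+s) ≤ 1 + y³`, and the cubic term of the exponential series at `r y / 2` bounds `y³`; `48`
is `3! · 2³`. -/
theorem rpow_le_exp {s : ℝ} (hs : 0 < s) (hs1 : s ≤ 1) {r : ℝ} (hr : 0 < r) {y : ℝ} (hy : 0 ≤ y) :
    y ^ (2 + s) ≤ (1 + 48 / r ^ 3) * Real.exp (r * y / 2) := by
  have h1 : y ^ (2 + s) ≤ 1 + y ^ 3 := by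
    rcases le_total y 1 with h | h
    · have := Real.rpow_le_one hy h (by linarith : 0 ≤ 2 + s)
      have : 0 ≤ y ^ 3 := by positivity
      linarith
    · have h2 : y ^ (2 + s) ≤ y ^ ((3 : ℕ) : ℝ) :=
        Real.rpow_le_rpow_of_exponent_le h (by push_cast; linarith)
      rw [Real.rpow_natCast] at h2
      linarith
  have h2 := Real.pow_div_factorial_le_exp (r * y / 2) (by positivity) 3
  have h3 : 1 ≤ Real.exp (r * y / 2) := Real.one_le_exp (by positivity)
  have h4 : y ^ 3 = 48 / r ^ 3 * ((r * y / 2) ^ 3 / (Nat.factorial 3)) := by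
    simp only [Nat.factorial]
    field_simp
    norm_num
    ring
  have h5 := mul_le_mul_of_nonneg_left h2 (by positivity : 0 ≤ 48 / r ^ 3)
  rw [← h4] at h5
  linarith

/-- The sum is `1 / (eˣ - 1)`, and `eˣ - 1 ≥ x`. -/
theorem hasSum_geometric_exp {x : ℝ} (hx : 0 < x) :
    ∃ v : ℝ, HasSum (fun n : ℕ => Real.exp (-x) ^ (n + 1)) v ∧ v ≤ 1 / x := by
  have h1 : Real.exp (-x) < 1 := by rw [Real.exp_lt_one_iff]; linarith
  have h := (hasSum_geometric_of_lt_one (Real.exp_pos _).le h1).mul_left (Real.exp (-x))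
  refine ⟨_, by simpa only [pow_succ'] using h, ?_⟩
  have h2 := Real.add_one_le_exp x
  have h3 : Real.exp (-x) * Real.exp x = 1 := by rw [← Real.exp_add]; simp
  rw [← div_eq_mul_inv, div_le_div_iff₀ (by linarith) hx]
  nlinarith [Real.exp_pos (-x)]

/-- Exponentially weighted sums of the inverse logarithmic distribution. -/
theorem sum_logWeight_le {s : ℝ} (hs : 0 < s) (hs1 : s ≤ 1) {r : ℝ} (hr : 0 < r) {M : ℕ}
    (hM : 1 ≤ M) : ∃ v : ℝ, HasSum (fun n : ℕ => logWeight s (n + 1) / Real.exp (r / M) ^ (n + 1)) v ∧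
      v ≤ 18 * (1 + 48 / r ^ 3) / r * (M : ℝ) ^ (3 + s) := by
  have hM0 : (0 : ℝ) < M := by exact_mod_cast hM
  obtain ⟨w, hw, hw1⟩ := hasSum_geometric_exp (x := r / (2 * M)) (by positivity)
  set A := 9 * (1 + 48 / r ^ 3) * (M : ℝ) ^ (2 + s) with hA
  have hA0 : 0 ≤ A := by positivity
  have hle : ∀ n : ℕ, logWeight s (n + 1) / Real.exp (r / M) ^ (n + 1) ≤
      A * Real.exp (-(r / (2 * M))) ^ (n + 1) := by
    intro n
    have hn0 : (0 : ℝ) ≤ ((n + 1 : ℕ) : ℝ) := Nat.cast_nonneg _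
    have h1 := logWeight_le hs hs1 (n := n + 1) (by omega)
    -- At `y = (n + 1) / M` half of the exponential decay pays for the polynomial; the other half
    -- remains as a geometric series.
    have h2 := rpow_le_exp hs hs1 hr (y := ((n + 1 : ℕ) : ℝ) / M) (by positivity)
    rw [Real.div_rpow hn0 hM0.le, div_le_iff₀ (Real.rpow_pos_of_pos hM0 _)] at h2
    rw [← Real.exp_nat_mul, ← Real.exp_nat_mul, div_le_iff₀ (Real.exp_pos _), mul_assoc,
      ← Real.exp_add]
    have h3 : ((n + 1 : ℕ) : ℝ) * -(r / (2 * M)) + ((n + 1 : ℕ) : ℝ) * (r / M) =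
        r * (((n + 1 : ℕ) : ℝ) / M) / 2 := by
      field_simp
      ring
    rw [h3, hA]
    linarith
  have h0 : ∀ n : ℕ, 0 ≤ logWeight s (n + 1) / Real.exp (r / M) ^ (n + 1) := fun n =>
    div_nonneg (logWeight_nonneg _ _) (by positivity)
  have hsum := Summable.of_nonneg_of_le h0 hle (hw.mul_left A).summable
  refine ⟨_, hsum.hasSum, (hasSum_le hle hsum.hasSum (hw.mul_left A)).trans ?_⟩
  refine (mul_le_mul_of_nonneg_left hw1 hA0).trans_eq ?_
  rw [hA, show 3 + s = (2 + s) + 1 by ring, Real.rpow_add_one hM0.ne']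
  field_simp
  ring

/-- The inverse of the normalising constant of the logarithmic distribution. -/
def logMass (s : ℝ) : ℝ := ∑' n : ℕ, 1 / logWeight s (n + 1)

theorem logMass_nonneg (s : ℝ) : 0 ≤ logMass s :=
  tsum_nonneg fun _ => one_div_nonneg.2 (logWeight_nonneg _ _)

/-- Total mass one reads `c * logMass s = 1`. Taking a constant out of `tsum` needs no summability,
so no convergence estimate for `logMass` is involved. -/
theorem IsLogDistribution.inv_eq {s : ℝ} {μ : ℕ → ℝ} (h : IsLogDistribution s μ) {n : ℕ}
    (hn : 1 ≤ n) : 1 / μ n = logMass s * logWeight s n := by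
  obtain ⟨⟨hpos, hsum⟩, c, hc⟩ := h
  have hc' : ∀ n : ℕ, 1 ≤ n → μ n = c * (1 / logWeight s n) := hc
  have h1 : c * logMass s = 1 := by
    rw [logMass, ← tsum_mul_left]
    refine Eq.trans ?_ hsum.tsum_eq
    exact tsum_congr fun n => (hc' (n + 1) (by omega)).symm
  have h2 := hpos n hn
  have h3 := logWeight_pos s hn
  have h4 : μ n * logWeight s n = c := by
    rw [hc' n hn]
    field_simp
  rw [div_eq_iff h2.ne']
  linear_combination -h1 - logMass s * h4

end Log

/-! ### The bounds -/

section Bounds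

variable {S : QSystem} [Fintype (Cfg S)] {k : ℕ}

/-- Eventually `μ n ≥ exp (-(a/2) n)`, so `1 / μ` uses up only half of the exponential decay. -/
theorem summable_inv_mul_exp {μ : ℕ → ℝ} (hμ : IsPosDistribution μ)
    (hlim : Filter.Tendsto (fun n : ℕ => μ n ^ ((1 : ℝ) / n)) Filter.atTop (nhds 1)) {a : ℝ}
    (ha : 0 < a) : Summable fun n : ℕ => 1 / (μ (n + 1) * Real.exp a ^ (n + 1)) := by
  have h1 : Real.exp (-(a / 2)) < 1 := by rw [Real.exp_lt_one_iff]; linarith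
  have h2 := hlim.eventually (lt_mem_nhds h1)
  have hg : Summable fun n : ℕ => Real.exp (-(a / 2)) ^ n :=
    summable_geometric_of_lt_one (Real.exp_pos _).le h1
  refine (summable_nat_add_iff (f := fun n : ℕ => 1 / (μ n * Real.exp a ^ n)) 1).2 ?_
  refine Summable.of_norm_bounded_eventually_nat hg ?_
  filter_upwards [h2, Filter.eventually_ge_atTop 1] with n hn hn1
  have hp := hμ.1 n hn1
  have hn0 : (n : ℝ) ≠ 0 := by positivity
  have h3 : Real.exp (-(a / 2)) ^ n ≤ μ n := by
    refine (pow_le_pow_left₀ (Real.exp_pos _).le hn.le n).trans_eq ?_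
    rw [← Real.rpow_natCast, ← Real.rpow_mul hp.le, one_div_mul_cancel hn0, Real.rpow_one]
  rw [Real.norm_of_nonneg (by positivity), div_le_iff₀ (by positivity)]
  have h4 : Real.exp (-(a / 2)) ^ n * (Real.exp (-(a / 2)) ^ n * Real.exp a ^ n) = 1 := by
    rw [← mul_pow, ← mul_pow, ← Real.exp_add, ← Real.exp_add]
    have : -(a / 2) + (-(a / 2) + a) = 0 := by ring
    rw [this, Real.exp_zero, one_pow]
  rw [← h4]
  gcongr

/-- Boundedness of the second moment. -/
theorem exists_secondMoment_bound {P : Prog S k} {θ : Fin k → ℝ} (j : Fin k)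
    {O : Matrix (Cfg S) (Cfg S) ℂ} {μ : ℕ → ℝ} (hP : P.WellFormed) (hO : O.IsHermitian)
    (hT : P.LoopsTerminateAS θ) (hμ : IsPosDistribution μ)
    (hlim : Filter.Tendsto (fun n : ℕ => μ n ^ ((1 : ℝ) / n)) Filter.atTop (nhds 1)) :
    ∃ B : ℝ, ∀ ρ : Matrix (Cfg (ext S)) (Cfg (ext S)) ℂ, IsPartialDensity ρ →
      SecondMomentLE μ θ j P O ρ B := by
  obtain ⟨N, hN, hD⟩ := Prog.exists_loopsDecay hP hT (ε := 1 / 2) (by norm_num) (by norm_num)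
  obtain ⟨l, hl, H⟩ := exists_wsem_bound (ε := 1 / 2) (by norm_num) (by norm_num) hN P.LC 1 one_pos
  -- The shift by one in the denominator covers `RC = 0` and keeps `ζ = exp a` strictly above `1`.
  set a := Real.log (1 + l) / (P.RC j + 1) with ha
  have hlog : 0 < Real.log (1 + l) := Real.log_pos (by linarith)
  have ha0 : 0 < a := by positivity
  have hζ : 1 ≤ Real.exp a := Real.one_le_exp ha0.le
  have hpow : Real.exp a ^ P.RC j ≤ 1 + l := by
    rw [← Real.exp_nat_mul, ← Real.le_log_iff_exp_le (by linarith), ha, mul_div_assoc',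
      div_le_iff₀ (by positivity)]
    linarith
  have h := H S k P θ j (Real.exp a) hP hT hD le_rfl hζ fun _ => hpow
  exact ⟨_, fun ρ hρ => secondMomentLE_of_wsem hμ hζ hP h.1 (by positivity) h.2 hO hρ
    (summable_inv_mul_exp hμ hlim ha0)⟩

theorem SecondMomentLE.mono {μ : ℕ → ℝ} {θ : Fin k → ℝ} {j : Fin k} {P : Prog S k}
    {O : Matrix (Cfg S) (Cfg S) ℂ} {ρ : Matrix (Cfg (ext S)) (Cfg (ext S)) ℂ} {B B' : ℝ}
    (h : SecondMomentLE μ θ j P O ρ B) (hB : B ≤ B') : SecondMomentLE μ θ j P O ρ B' := by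
  obtain ⟨v, hv, hle⟩ := h
  exact ⟨v, hv, hle.trans hB⟩

/-- Let `ζ` tend to infinity. -/
theorem le_zero_of_forall_le_div_pow {x A : ℝ} {m n : ℕ} (hmn : m < n)
    (h : ∀ ζ : ℝ, 1 ≤ ζ → x ≤ A * ζ ^ m / ζ ^ n) (hA : 0 ≤ A) : x ≤ 0 := by
  have h1 : Filter.Tendsto (fun ζ : ℝ => A / ζ) Filter.atTop (nhds 0) :=
    tendsto_const_nhds.div_atTop Filter.tendsto_id
  refine ge_of_tendsto h1 ?_
  filter_upwards [Filter.eventually_ge_atTop 1] with ζ hζ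
  refine (h ζ hζ).trans ?_
  have h0 : 0 < ζ := by linarith
  rw [div_le_div_iff₀ (by positivity) h0, mul_assoc, ← pow_succ]
  exact mul_le_mul_of_nonneg_left (pow_le_pow_right₀ hζ hmn) hA

/-- The second moment, if there are no loops or the counter never moves. -/
theorem secondMomentLE_of_forall {P : Prog S k} {θ : Fin k → ℝ} {j : Fin k}
    {O : Matrix (Cfg S) (Cfg S) ℂ} {μ : ℕ → ℝ} (hP : P.WellFormed) (hO : O.IsHermitian)
    (hμ : IsPosDistribution μ) {D : ℝ} (hD0 : 0 ≤ D)
    (h : ∀ ζ : ℝ, 1 ≤ ζ → P.Tame (weight j ζ) θ ∧ ∀ Z : Matrix (Cfg S) (Cfg S) ℂ, Z.PosSemidef →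
        rtr (P.wsem (weight j ζ) θ Z) ≤ D * ζ ^ P.RC j * rtr Z)
    {ρ : Matrix (Cfg (ext S)) (Cfg (ext S)) ℂ} (hρ : IsPartialDensity ρ) :
    SecondMomentLE μ θ j P O ρ
      (opNorm O ^ 2 * ∑ n ∈ Finset.range (P.RC j), 4 * D * (1 / μ (n + 1))) := by
  have hb := fun ζ (hζ : 1 ≤ ζ) => Prog.rtr_beta_diff_le hμ hζ j hP (h ζ hζ).1
    (mul_nonneg hD0 (pow_nonneg (zero_le_one.trans hζ) _)) (h ζ hζ).2 hρ
  have hs : HasSum (fun n => if n ∈ Finset.range (P.RC j) then 4 * D * (1 / μ (n + 1)) else 0)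
      (∑ n ∈ Finset.range (P.RC j), 4 * D * (1 / μ (n + 1))) := by
    rw [← Finset.sum_congr rfl fun n hn => if_pos hn]
    exact hasSum_sum_of_ne_finset_zero fun n hn => if_neg hn
  rw [← hs.tsum_eq]
  refine secondMomentLE_of_beta hO (hb 1 le_rfl).1.psd hs.summable fun n => ?_
  have hp := hμ.1 (n + 1) (by omega)
  split_ifs with hn
  · have h1 := mul_le_mul_of_nonneg_left ((hb 1 le_rfl).2 n) (sq_nonneg (2 / μ (n + 1)))
    refine h1.trans_eq ?_
    rw [one_pow, one_pow, mul_one, div_one]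
    field_simp
    ring
  -- Counters above `RC` are never reached: the weighted bound holds for every `ζ`, and its limit at
  -- infinity is zero. The counters up to `RC` were handled with `ζ = 1`.
  · have h1 : rtr (beta ((P.diff μ j).sem θ ρ) ((n : ℤ) + 1)) ≤ 0 := by
      refine le_zero_of_forall_le_div_pow (A := D * μ (n + 1)) (m := P.RC j) (n := n + 1) ?_ ?_
        (by positivity)
      · have := Finset.mem_range.not.1 hn
        omega
      · intro ζ hζ
        refine ((hb ζ hζ).2 n).trans_eq ?_
        ring
    exact mul_nonpos_of_nonneg_of_nonpos (sq_nonneg _) h1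

/-- The constants in the bound on the second moment, for the admissible growth `l` of the weight of
a loop. -/
def loopConst (l : ℝ) (m : ℕ) : ℝ :=
  (1 + l) * 2 ^ m * (18 * (1 + 48 / Real.log (1 + l) ^ 3) / Real.log (1 + l))

theorem loopConst_pos {l : ℝ} (hl : 0 < l) (m : ℕ) : 0 < loopConst l m := by
  have := Real.log_pos (show 1 < 1 + l by linarith)
  unfold loopConst
  positivity

/-- `K` depends on `s` only, through the normalising constant of `μ`; all dependence on `ε`, `N` and
the number of loops is put into `C`, since the admissible growth `l` depends only on them. -/
theorem secondMoment_rate {s : ℝ} (hs : 0 < s) (hs1 : s ≤ 1) :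
    ∃ K : ℝ, 0 < K ∧ ∀ ε : ℝ, 0 < ε → ε < 1 → ∀ N : ℕ, 1 ≤ N → ∃ C : ℕ → ℝ, (∀ m, 0 < C m) ∧
      ∀ (S : QSystem) [Fintype (Cfg S)] (k : ℕ) (P : Prog S k) (θ : Fin k → ℝ) (j : Fin k)
        (O : Matrix (Cfg S) (Cfg S) ℂ) (μ : ℕ → ℝ),
        P.WellFormed → O.IsHermitian → P.LoopsTerminateAS θ → P.LoopsDecay θ ε N →
        IsLogDistribution s μ →
        ∀ ρ : Matrix (Cfg (ext S)) (Cfg (ext S)) ℂ, IsPartialDensity ρ →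
          SecondMomentLE μ θ j P O ρ
            (K * opNorm O ^ 2 *
              ((P.RC j : ℝ) ^ 2 * Real.log ((P.RC j : ℝ) + Real.exp 1) ^ (1 + s) +
                (P.RC j : ℝ) ^ (3 + s) * (P.LC : ℝ) ^ (2 + s) * C P.LC)) := by
  have hS := logMass_nonneg s
  -- The summand `1` makes `K` positive from the nonnegativity of `logMass` alone.
  refine ⟨4 * logMass s + 1, by positivity, fun ε hε hε1 N hN => ?_⟩
  choose l hl H using fun m => exists_wsem_bound hε hε1 hN m 1 one_pos
  refine ⟨fun m => loopConst (l m) m, fun m => loopConst_pos (hl m) m, ?_⟩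
  intro S _ k P θ j O μ hP hO hT hD hμ ρ hρ
  have hC := loopConst_pos (hl P.LC) P.LC
  have hlog : 0 ≤ Real.log ((P.RC j : ℝ) + Real.exp 1) ^ (1 + s) :=
    Real.rpow_nonneg (by linarith [one_le_log (P.RC j)]) _
  have hO2 := sq_nonneg (opNorm O)
  -- In both cases every `ζ ≥ 1` is admissible: without loops nothing is required, and for `RC = 0`
  -- the power `ζ^RC` is `1`. The possible factor `2^LC` does no harm, because for `RC = 0` the sum
  -- is empty.
  by_cases hcase : P.LC = 0 ∨ P.RC j = 0
  · have h : ∀ ζ : ℝ, 1 ≤ ζ → P.Tame (weight j ζ) θ ∧ ∀ Z : Matrix (Cfg S) (Cfg S) ℂ,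
        Z.PosSemidef → rtr (P.wsem (weight j ζ) θ Z) ≤ 2 ^ P.LC * ζ ^ P.RC j * rtr Z := by
      intro ζ hζ
      have h1 := H P.LC S k P θ j ζ hP hT hD le_rfl hζ fun h0 => by
        rw [hcase.resolve_left h0, pow_zero]
        linarith [hl P.LC]
      refine ⟨h1.1, fun Z hZ => (h1.2 Z hZ).trans_eq ?_⟩
      rw [one_add_one_eq_two, mul_comm (ζ ^ P.RC j)]
    refine (secondMomentLE_of_forall hP hO hμ.1 (by positivity) h hρ).mono ?_
    have h2 : ∀ n ∈ Finset.range (P.RC j), 4 * 2 ^ P.LC * (1 / μ (n + 1)) ≤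
        4 * logMass s * logWeight s (P.RC j) := by
      intro n hn
      have hn' := Finset.mem_range.1 hn
      have h0 : P.LC = 0 := hcase.resolve_right (by omega)
      rw [h0, hμ.inv_eq (by omega), pow_zero, mul_one, ← mul_assoc]
      exact mul_le_mul_of_nonneg_left (logWeight_mono hs (by omega)) (by positivity)
    have h3 := Finset.sum_le_card_nsmul _ _ _ h2
    rw [Finset.card_range, nsmul_eq_mul] at h3
    have h4 : (P.RC j : ℝ) * (4 * logMass s * logWeight s (P.RC j)) = 4 * logMass s *
        ((P.RC j : ℝ) ^ 2 * Real.log ((P.RC j : ℝ) + Real.exp 1) ^ (1 + s)) := by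
      rw [logWeight]
      ring
    rw [h4] at h3
    set X := (P.RC j : ℝ) ^ 2 * Real.log ((P.RC j : ℝ) + Real.exp 1) ^ (1 + s) with hX
    have hX0 : 0 ≤ X := mul_nonneg (sq_nonneg _) hlog
    have hY0 : 0 ≤ (P.RC j : ℝ) ^ (3 + s) * (P.LC : ℝ) ^ (2 + s) * loopConst (l P.LC) P.LC := by
      positivity
    calc _ ≤ opNorm O ^ 2 * (4 * logMass s * X) := mul_le_mul_of_nonneg_left h3 hO2
      _ = 4 * logMass s * opNorm O ^ 2 * X := by ring
      _ ≤ (4 * logMass s + 1) * opNorm O ^ 2 * (X + _) := by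
        gcongr
        · linarith
        · linarith
  · push Not at hcase
    obtain ⟨h0, h1⟩ := hcase
    have hM : 1 ≤ P.RC j := by omega
    have hM0 : (0 : ℝ) < P.RC j := by exact_mod_cast hM
    have hL1 : (1 : ℝ) ≤ P.LC := by exact_mod_cast Nat.one_le_iff_ne_zero.2 h0
    have hl' := hl P.LC
    have hr : 0 < Real.log (1 + l P.LC) := Real.log_pos (by linarith)
    set r := Real.log (1 + l P.LC) with hr'
    set ζ := Real.exp (r / P.RC j) with hζ'
    have hζ : 1 ≤ ζ := Real.one_le_exp (by positivity)
    have hpow : ζ ^ P.RC j = 1 + l P.LC := by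
      rw [hζ', ← Real.exp_nat_mul, mul_div_cancel₀ _ hM0.ne', hr', Real.exp_log (by linarith)]
    have h2 := H P.LC S k P θ j ζ hP hT hD le_rfl hζ fun _ => hpow.le
    obtain ⟨v, hv, hv1⟩ := sum_logWeight_le hs hs1 hr hM
    have hv2 : HasSum (fun n : ℕ => 1 / (μ (n + 1) * ζ ^ (n + 1))) (logMass s * v) := by
      have he : (fun n : ℕ => 1 / (μ (n + 1) * ζ ^ (n + 1))) =
          fun n => logMass s * (logWeight s (n + 1) / ζ ^ (n + 1)) := by
        funext n
        rw [one_div, mul_inv, ← one_div, hμ.inv_eq (by omega), mul_div_assoc', div_eq_mul_inv]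
      rw [he]
      exact hv.mul_left (logMass s)
    refine (secondMomentLE_of_wsem hμ.1 hζ hP h2.1 (by positivity) h2.2 hO hρ hv2.summable).mono ?_
    rw [hv2.tsum_eq, hpow]
    set X := (P.RC j : ℝ) ^ 2 * Real.log ((P.RC j : ℝ) + Real.exp 1) ^ (1 + s) with hX
    have hX0 : 0 ≤ X := mul_nonneg (sq_nonneg _) hlog
    set Y := (P.RC j : ℝ) ^ (3 + s) with hY
    have hY0 : 0 ≤ Y := by positivity
    -- Only `1 ≤ LC^(2+s)` is needed, as `C` already accounts for the number of loops.
    have hLpow : 1 ≤ (P.LC : ℝ) ^ (2 + s) := Real.one_le_rpow hL1 (by linarith)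
    have hconst : (1 + l P.LC) * 2 ^ P.LC * v ≤ Y * loopConst (l P.LC) P.LC := by
      have := mul_le_mul_of_nonneg_left hv1 (by positivity : 0 ≤ (1 + l P.LC) * 2 ^ P.LC)
      refine this.trans_eq ?_
      rw [loopConst]
      ring
    have hYC : 0 ≤ Y * loopConst (l P.LC) P.LC := mul_nonneg hY0 hC.le
    calc opNorm O ^ 2 * (4 * ((1 + l P.LC) * (1 + 1) ^ P.LC) * (logMass s * v))
        = 4 * logMass s * opNorm O ^ 2 * ((1 + l P.LC) * 2 ^ P.LC * v) := by norm_num; ring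
      _ ≤ 4 * logMass s * opNorm O ^ 2 * (Y * loopConst (l P.LC) P.LC) := by gcongr
      _ ≤ (4 * logMass s + 1) * opNorm O ^ 2 *
          (X + Y * (P.LC : ℝ) ^ (2 + s) * loopConst (l P.LC) P.LC) := by
        refine mul_le_mul (mul_le_mul_of_nonneg_right (by linarith) hO2) ?_ hYC (by positivity)
        have := mul_le_mul_of_nonneg_left hLpow hYC
        linarith

end Bounds

end QWhile

end

theorem theorem5p2 :
    -- boundedness, for every admissible distribution
    (∀ (S : QWhile.QSystem) [Finite S.Var] [Fintype (QWhile.Cfg S)] (k : ℕ)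
      (P : QWhile.Prog S k) (θ : Fin k → ℝ) (j : Fin k)
      (O : Matrix (QWhile.Cfg S) (QWhile.Cfg S) ℂ) (μ : ℕ → ℝ),
      P.WellFormed → O.IsHermitian → P.LoopsTerminateAS θ →
      QWhile.IsPosDistribution μ →
      Filter.Tendsto (fun n : ℕ => μ n ^ ((1 : ℝ) / n)) Filter.atTop (nhds 1) →
      ∃ B : ℝ, ∀ ρ : Matrix (QWhile.Cfg (QWhile.ext S)) (QWhile.Cfg (QWhile.ext S)) ℂ,
        QWhile.IsPartialDensity ρ → QWhile.SecondMomentLE μ θ j P O ρ B) ∧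
    -- for every `ε`, the loops of every program decay with some `N`
    (∀ (S : QWhile.QSystem) [Finite S.Var] [Fintype (QWhile.Cfg S)] (k : ℕ)
      (P : QWhile.Prog S k) (θ : Fin k → ℝ),
      P.WellFormed → P.LoopsTerminateAS θ →
      ∀ ε : ℝ, 0 < ε → ε < 1 → ∃ N : ℕ, 1 ≤ N ∧ P.LoopsDecay θ ε N) ∧
    -- the rate, with constants that do not depend on the program beyond `ε` and `N`
    (∀ s : ℝ, 0 < s → s ≤ 1 → ∃ K : ℝ, 0 < K ∧
      ∀ ε : ℝ, 0 < ε → ε < 1 → ∀ N : ℕ, 1 ≤ N → ∃ C : ℕ → ℝ, (∀ m, 0 < C m) ∧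
        ∀ (S : QWhile.QSystem) [Finite S.Var] [Fintype (QWhile.Cfg S)] (k : ℕ)
          (P : QWhile.Prog S k) (θ : Fin k → ℝ) (j : Fin k)
          (O : Matrix (QWhile.Cfg S) (QWhile.Cfg S) ℂ) (μ : ℕ → ℝ),
          P.WellFormed → O.IsHermitian → P.LoopsTerminateAS θ → P.LoopsDecay θ ε N →
          QWhile.IsLogDistribution s μ →
          ∀ ρ : Matrix (QWhile.Cfg (QWhile.ext S)) (QWhile.Cfg (QWhile.ext S)) ℂ,
            QWhile.IsPartialDensity ρ →
            QWhile.SecondMomentLE μ θ j P O ρ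
              (K * QWhile.opNorm O ^ 2 *
                ((P.RC j : ℝ) ^ 2 * Real.log ((P.RC j : ℝ) + Real.exp 1) ^ (1 + s) +
                  (P.RC j : ℝ) ^ (3 + s) * (P.LC : ℝ) ^ (2 + s) * C P.LC))) := by
  refine ⟨?_, ?_, ?_⟩
  · intro S _ _ k P θ j O μ hP hO hT hμ hlim
    exact QWhile.exists_secondMoment_bound j hP hO hT hμ hlim
  · intro S _ _ k P θ hP hT ε hε hε1
    exact QWhile.Prog.exists_loopsDecay hP hT hε hε1
  · intro s hs hs1
    obtain ⟨K, hK, h⟩ := QWhile.secondMoment_rate hs hs1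
    refine ⟨K, hK, fun ε hε hε1 N hN => ?_⟩
    obtain ⟨C, hC, h⟩ := h ε hε hε1 N hN
    refine ⟨C, hC, ?_⟩
    intro S _ _ k P θ j O μ hP hO hT hD hμ ρ hρ
    exact h S k P θ j O μ hP hO hT hD hμ ρ hρ
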